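/- Let $k\in2\mathbb Z$, $n\in\mathbb Z$, $m\in\mathbb Z_{\ge 0}$, $\lambda\in\mathbb C$, and write $\lambda=s_0(s_0+k-1)$ with $s_0\in\mathbb C$. Let $$\Delta_k=y^2\Big(\frac{\partial^2}{\partial x^2}+\frac{\partial^2}{\partial y^2}\Big)-iky\Big(\frac{\partial}{\partial x}+i\frac{\partial}{\partial y}\Big)$$ be the weight $k$ hyperbolic Laplacian on the upper half-plane $\mathbb H$, $z=x+iy$. Suppose that $f_n(z)=h_n(y)e^{2\pi i n x}$ is of class $C^{2m}$ on $\mathbb H$, satisfies $(\Delta_k-\lambda)^m f_n=0$ on $\mathbb H$, and has at most polynomial growth at the cusp, that is, $f_n(x+iy)=O(y^K)$ as $y\to\infty$, uniformly in $x$, for some $K\in\mathbb R$. For $n\neq0$ and $j\ge0$ put $$u_{k,n}^{[j],-}(y;s_0)=y^{-k/2}\,\frac{\partial^{j'}}{\partial s^{j'}}W_{\operatorname{sgn}(n)\frac k2,\;s+\frac{k-1}2}(4\pi|n|y)\Big|_{s=s_0},\qquad u_{k,n}^{[j],+}(y;s_0)=y^{-k/2}\,\frac{\partial^{j'}}{\partial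 s^{j'}}\mathcal M^+_{\operatorname{sgn}(n)\frac k2,\;s+\frac{k-1}2}(4\pi|n|y)\Big|_{s=s_0},$$ where $j'=j$ if $s_0\ne\frac{1-k}2$ and $j'=2j$ if $s_0=\frac{1-k}2$. Here $W_{\kappa,\mu}$ is the Whittaker $W$-function and $\mathcal M^+_{\kappa,\mu}(y)=W_{-\kappa,\mu}(ye^{\pi i})$ for $y>0$, the analytic continuation being along a path in the upper half-plane. For $n=0$ put $$u_{k,0}^{[j],-}=(\log y)^j y^{1-k-s_0},\quad u_{k,0}^{[j],+}=(\log y)^j y^{s_0}\qquad\text{if } s_0\neq\tfrac{1-k}2,$$ $$u_{k,0}^{[j],-}=(\log y)^{2j} y^{\frac{1-k}2},\quad u_{k,0}^{[j],+}=(\log y)^{2j+1} y^{\frac{1-k}2}\qquad\text{if } s_0=\tfrac{1-k}2.$$ Then there are constants $a_{n,j}^{\pm}\in\mathbb C$ such that for all $y>0$ $$h_n(y)=\sum_{j=0}^{m-1}\Big(a_{n,j}^-\,u_{k,n}^{[j],-}(y;s_0)+a_{n,j}^+\,u_{k,n}^{[j],+}(y;s_0)\Big),$$ and if $n\ne0$,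 then in every such representation $a_{n,j}^+=0$ for all $0\le j\le m-1$; that is, no $\mathcal M^+$-type functions occur. -/

import Mathlib

open Complex Filter Topology Asymptotics
open scoped UpperHalfPlane

noncomputable section

namespace PolyMaass

/-! ### The weight `k` hyperbolic Laplacian -/

/-- `∂f/∂x` for a function `f` of `z = x + iy` in the upper half-plane. -/
def partialX (f : ℍ → ℂ) (z : ℍ) : ℂ :=
  deriv (fun t : ℝ => f (UpperHalfPlane.ofComplex ((z : ℂ) + t))) 0

/-- `∂f/∂y` for a function `f` of `z = x + iy` in the upper half-plane. -/
def partialY (f : ℍ → ℂ) (z : ℍ) : ℂ :=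
  deriv (fun t : ℝ => f (UpperHalfPlane.ofComplex ((z : ℂ) + t * I))) 0

/-- `Δ_k = y² (∂²/∂x² + ∂²/∂y²) - i k y (∂/∂x + i ∂/∂y)`. -/
def hypLaplacian (k : ℤ) (f : ℍ → ℂ) (z : ℍ) : ℂ :=
  (z.im : ℂ) ^ 2 * (partialX (partialX f) z + partialY (partialY f) z)
    - I * k * z.im * (partialX f z + I * partialY f z)

/-- The operator `Δ_k - λ`. -/
def shiftedLaplacian (k : ℤ) (lam : ℂ) (f : ℍ → ℂ) : ℍ → ℂ :=
  fun z => hypLaplacian k f z - lam * f z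

/-- `f` is `r` times continuously differentiable on `ℍ` in the real variables `x, y`. -/
def ContDiffUHP (r : ℕ) (f : ℍ → ℂ) : Prop :=
  ContDiffOn ℝ r (fun z : ℂ => f (UpperHalfPlane.ofComplex z)) {z : ℂ | 0 < z.im}

/-- `f` is of class `C^{2m}` on `ℍ` and `(Δ_k - λ)^m f = 0` there. -/
def IsShiftedPolyharmonic (k : ℤ) (lam : ℂ) (m : ℕ) (f : ℍ → ℂ) : Prop :=
  ContDiffUHP (2 * m) f ∧ ∀ z : ℍ, (shiftedLaplacian k lam)^[m] f z = 0

/-- At most polynomial growth at the cusp: `f(x + iy) = O(y^K)` as `y → ∞`, uniformly in `x`,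
for some real `K`. -/
def HasPolynomialGrowth (f : ℍ → ℂ) : Prop :=
  ∃ K : ℝ, f =O[UpperHalfPlane.atImInfty] fun z : ℍ => z.im ^ K

/-! ### Whittaker functions

Whittaker functions are multivalued in `z`, with branch point `0`. They are given here as
functions on the Riemann surface of the logarithm, that is, of a variable `w ∈ ℂ` with `z = e^w`.
The principal branch on the positive axis is `w = log z`, and `w ↦ w + π i` is the
analytic continuation from `z` to `z e^{π i}` along a path in the upper half plane. -/

/-- Kummer's function `M(a, b, z) = ₁F₁(a; b; z) = ∑ (a)_n / ((b)_n n!) z^n`, for `b` not a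
non-positive integer, from Mathlib's regularized `M(a, b, z) / Γ(b) = ∑ (a)_n / (Γ(b+n) n!) z^n`. -/
def kummerM (a b z : ℂ) : ℂ :=
  Gamma b * regularizedHGFun {a} {b} z

/-- `M_{κ,μ}(z) = e^{-z/2} z^{μ+1/2} M(μ-κ+1/2, 1+2μ, z)` with `z = e^w`. -/
def whittakerMLog (κ μ w : ℂ) : ℂ :=
  exp (-exp w / 2) * exp ((μ + 1 / 2) * w) * kummerM (μ - κ + 1 / 2) (1 + 2 * μ) (exp w)

/-- `W_{κ,μ}(z) = Γ(-2μ)/Γ(1/2-μ-κ) M_{κ,μ}(z) + Γ(2μ)/Γ(1/2+μ-κ) M_{κ,-μ}(z)` with `z = e^w`.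
This expression in `μ` has removable singularities where `2μ` is an integer, and `W` is its limit
there; elsewhere the limit is the value of the expression, by continuity. (In Mathlib
`1 / Gamma` is `0` at the poles of `Gamma`, as it should be.) -/
def whittakerWLog (κ μ w : ℂ) : ℂ :=
  limUnder (𝓝[≠] μ) fun ν : ℂ =>
    Gamma (-2 * ν) / Gamma (1 / 2 - ν - κ) * whittakerMLog κ ν w
      + Gamma (2 * ν) / Gamma (1 / 2 + ν - κ) * whittakerMLog κ (-ν) w

/-- `W_{κ,μ}(y)` for real `y > 0`. -/
def whittakerW (κ μ : ℂ) (y : ℝ) : ℂ :=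
  whittakerWLog κ μ (Real.log y : ℂ)

/-- `𝓜⁺_{κ,μ}(y) = W_{-κ,μ}(y e^{π i})` for real `y > 0`. -/
def whittakerMPlus (κ μ : ℂ) (y : ℝ) : ℂ :=
  whittakerWLog (-κ) μ ((Real.log y : ℂ) + Real.pi * I)

/-! ### The basic Fourier coefficient functions -/

/-- For `n ≠ 0`: `y^{-k/2} ∂^j/∂s^j W_{sgn(n) k/2, s+(k-1)/2}(4π|n|y)` at `s = s₀`, with `2j` in
place of `j` if `s₀ = (1-k)/2`. For `n = 0`: `(log y)^j y^{1-k-s₀}`, or `(log y)^{2j} y^{(1-k)/2}`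
if `s₀ = (1-k)/2`. -/
def uMinus (k n : ℤ) (j : ℕ) (s₀ : ℂ) (y : ℝ) : ℂ :=
  open scoped Classical in
  if n = 0 then
    if s₀ = (1 - k) / 2 then (Real.log y : ℂ) ^ (2 * j) * (y : ℂ) ^ (((1 : ℂ) - k) / 2)
    else (Real.log y : ℂ) ^ j * (y : ℂ) ^ (1 - k - s₀)
  else
    (y : ℂ) ^ (-(k : ℂ) / 2) *
      iteratedDeriv (if s₀ = (1 - k) / 2 then 2 * j else j)
        (fun s : ℂ => whittakerW (n.sign * (k / 2)) (s + (k - 1) / 2) (4 * Real.pi * |(n : ℝ)| * y))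
        s₀

/-- For `n ≠ 0`: `y^{-k/2} ∂^j/∂s^j 𝓜⁺_{sgn(n) k/2, s+(k-1)/2}(4π|n|y)` at `s = s₀`, with `2j` in
place of `j` if `s₀ = (1-k)/2`. For `n = 0`: `(log y)^j y^{s₀}`, or `(log y)^{2j+1} y^{(1-k)/2}`
if `s₀ = (1-k)/2`. -/
def uPlus (k n : ℤ) (j : ℕ) (s₀ : ℂ) (y : ℝ) : ℂ :=
  open scoped Classical in
  if n = 0 then
    if s₀ = (1 - k) / 2 then (Real.log y : ℂ) ^ (2 * j + 1) * (y : ℂ) ^ (((1 : ℂ) - k) / 2)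
    else (Real.log y : ℂ) ^ j * (y : ℂ) ^ s₀
  else
    (y : ℂ) ^ (-(k : ℂ) / 2) *
      iteratedDeriv (if s₀ = (1 - k) / 2 then 2 * j else j)
        (fun s : ℂ =>
          whittakerMPlus (n.sign * (k / 2)) (s + (k - 1) / 2) (4 * Real.pi * |(n : ℝ)| * y))
        s₀

/-- `h(y) = ∑_{j<m} (a⁻_j u^{[j],-}_{k,n}(y; s₀) + a⁺_j u^{[j],+}_{k,n}(y; s₀))` for all `y > 0`. -/
def IsExpansion (k n : ℤ) (m : ℕ) (s₀ : ℂ) (h : ℝ → ℂ) (aMinus aPlus : Fin m → ℂ) : Prop :=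
  ∀ y : ℝ, 0 < y →
    h y = ∑ j : Fin m, (aMinus j * uMinus k n j s₀ y + aPlus j * uPlus k n j s₀ y)

end PolyMaass

end

open scoped Nat

noncomputable section

namespace PolyMaass

/-! ### Kummer's regularized function -/

/-! Put `y = e^t` and `G(t) = e^{kt/2} h(e^t)`. Separation of variables turns `Δ_k - λ` into `L = D²
- D + q(t)` with `q = 1/4 - μ² + κ c e^t - c² e^{2t}/4`, where `μ = s₀ + (k-1)/2`, `κ = sgn(n) k/2`
and `c = 4π|n|` (`isLinearSol_normalForm`). The hypothesis becomes `L^m G = 0`. For `n = 0` the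
operator has constant coefficients.

Existence. The parameter enters `L` only through `-μ²`, so the `j`-th `μ`-derivative `u_j` of a
family of solutions satisfies `L u_j = 2μ j u_{j-1} + j(j-1) u_{j-2}`. For `μ ≠ 0` the operator
therefore lowers the order by one with a nonzero factor. For `μ = 0` it lowers the order by two,
which is why only even derivatives of the Whittaker functions occur there. Two such chains whose
first members have nonzero Wronskian span the kernel of `L^m`, by induction on `m`
(`IsChain.exists_expansion`). For `n ≠ 0` the first members are `W_{κ,μ}(z)` and `W_{-κ,μ}(z
e^{πi})`, with normalized Wronskian `e^{-πiκ}` in `log z` (`whittakerWLog_wronskian`). This is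
computed from the functions `M_{κ,±μ}` when `2μ` is not an integer and extends by continuity. Cauchy
integrals over circles on which `2ν` is never an integer handle the removable singularities in the
parameter (`whittakerWDeriv_ode`). For `n = 0` the chains are `t^j e^{(±μ+1/2)t}`.

Vanishing of the growing part. All `μ`-derivatives of `W_{κ,μ}(c e^t)` are `O(e^{-b e^t})` for every
`b < c/2` (`whittakerWDeriv_decay`): Tricomi's Laplace integral gives this for `Re κ` very negative,
a raising operator carries it to all `κ`, and Cauchy's estimate passes to the derivatives. No
asymptotics of the second solution are needed. A nonzero Wronskian with a decaying solution already
prevents growth below `e^{a e^t}` with `a < c/2` (`IsExpPotential.not_subExp`). An energy estimate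
and a Landau inequality show that `L` preserves such growth on the span of a chain, so repeated
application of `L` isolates the top coefficient of the growing chain and forces it to vanish
(`IsChain.coeff_top_eq_zero`). Polynomial growth in `y` is `e^{O(t)}`, far below the threshold. -/

/-- The coefficients of Kummer's regularized function. -/
def kummerCoeff (a b : ℂ) (n : ℕ) : ℂ := (ascPochhammer ℂ n).eval a * (Gamma (b + n))⁻¹ / n !

/-- Kummer's regularized function `M(a, b, z) / Γ(b)`. -/
def regKummer (a b z : ℂ) : ℂ := regularizedHGFun {a} {b} z

lemma regKummer_eq_tsum (a b z : ℂ) : regKummer a b z = ∑' n, kummerCoeff a b n * z ^ n := by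
  have : regKummer a b z = FormalMultilinearSeries.ofScalarsSum (regularizedHGFunCoeff {a} {b}) z := rfl
  rw [this, FormalMultilinearSeries.ofScalars_sum_eq]
  refine tsum_congr fun n => ?_
  simp only [regularizedHGFunCoeff, kummerCoeff, Multiset.map_singleton, Multiset.prod_singleton,
    smul_eq_mul]
  rw [div_eq_mul_inv, div_eq_mul_inv, mul_inv]
  ring

lemma continuous_kummerCoeff (n : ℕ) : Continuous fun p : ℂ × ℂ => kummerCoeff p.1 p.2 n := by
  unfold kummerCoeff
  have h1 : Continuous fun p : ℂ × ℂ => (Gamma (p.2 + n))⁻¹ :=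
    differentiable_one_div_Gamma.continuous.comp (by fun_prop : Continuous fun p : ℂ × ℂ => p.2 + n)
  have h2 : Continuous fun p : ℂ × ℂ => (ascPochhammer ℂ n).eval p.1 :=
    (ascPochhammer ℂ n).continuous.comp continuous_fst
  exact (h2.mul h1).div_const _

lemma differentiable_kummerCoeff {α β : ℂ → ℂ} (hα : Differentiable ℂ α) (hβ : Differentiable ℂ β)
    (n : ℕ) : Differentiable ℂ fun x => kummerCoeff (α x) (β x) n := by
  unfold kummerCoeff
  have h1 : Differentiable ℂ fun x => (Gamma (β x + n))⁻¹ :=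
    differentiable_one_div_Gamma.comp (hβ.add_const _)
  have h2 : Differentiable ℂ fun x => (ascPochhammer ℂ n).eval (α x) :=
    (ascPochhammer ℂ n).differentiable.comp hα
  exact (h2.mul h1).div_const _

lemma kummerCoeff_succ {a b : ℂ} {n : ℕ} (h : b + n ≠ 0) :
    kummerCoeff a b (n + 1) * (n + 1)! = kummerCoeff a b n * n ! * ((a + n) / (b + n)) := by
  have h1 := one_div_Gamma_eq_self_mul_one_div_Gamma_add_one (b + n)
  have hf : ((n ! : ℕ) : ℂ) ≠ 0 := by exact_mod_cast Nat.factorial_ne_zero n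
  have hf' : (((n + 1)! : ℕ) : ℂ) ≠ 0 := by exact_mod_cast Nat.factorial_ne_zero (n + 1)
  unfold kummerCoeff
  rw [ascPochhammer_succ_eval, div_mul_cancel₀ _ hf', div_mul_cancel₀ _ hf, h1]
  push_cast
  rw [← add_assoc]
  field_simp

/-- Once `n > 2A`, the ratio `(a+n)/(b+n)` of consecutive values of `n!` times the coefficient is at
most `(A+n)/(n-A) ≤ 3`. The finitely many earlier coefficients are bounded by compactness, which
covers the zeros of `1/Γ`. -/
lemma exists_kummerCoeff_bound (A : ℝ) : ∃ D : ℝ, 0 ≤ D ∧ ∀ a b : ℂ, ‖a‖ ≤ A → ‖b‖ ≤ A → ∀ n,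
    ‖kummerCoeff a b n‖ ≤ D * 3 ^ n / n ! := by
  set K : Set (ℂ × ℂ) := Metric.closedBall 0 A ×ˢ Metric.closedBall 0 A with hK
  have hKc : IsCompact K := (isCompact_closedBall _ _).prod (isCompact_closedBall _ _)
  have hb : ∀ n, ∃ C, ∀ p ∈ K, ‖kummerCoeff p.1 p.2 n * (n ! : ℂ)‖ ≤ C := fun n =>
    hKc.exists_bound_of_continuousOn ((continuous_kummerCoeff n).mul continuous_const).continuousOn
  choose C hC using hb
  obtain ⟨N, hN⟩ := exists_nat_gt (2 * A)
  refine ⟨∑ i ∈ Finset.range (N + 1), |C i|, Finset.sum_nonneg fun _ _ => abs_nonneg _, ?_⟩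
  intro a b ha hb n
  have hp : (a, b) ∈ K := by simp [hK, ha, hb]
  have hA : 0 ≤ A := (norm_nonneg a).trans ha
  have key : ‖kummerCoeff a b n * (n ! : ℂ)‖ ≤ (∑ i ∈ Finset.range (N + 1), |C i|) * 3 ^ n := by
    rcases le_or_gt n N with h | h
    · calc _ ≤ |C n| := (hC n _ hp).trans (le_abs_self _)
        _ ≤ ∑ i ∈ Finset.range (N + 1), |C i| :=
            Finset.single_le_sum (f := fun i => |C i|) (fun _ _ => abs_nonneg _)
              (Finset.mem_range.2 (by omega))
        _ ≤ _ := le_mul_of_one_le_right (Finset.sum_nonneg fun _ _ => abs_nonneg _)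
              (one_le_pow₀ (by norm_num))
    · induction n, h.le using Nat.le_induction with
      | base => exact absurd h (lt_irrefl _)
      | succ n hn ih =>
        have hn' : (N : ℝ) ≤ n := by exact_mod_cast hn
        have hlow : (n : ℝ) - A ≤ ‖b + n‖ := by
          have := norm_sub_le (b + n) b
          rw [add_sub_cancel_left, norm_natCast] at this
          linarith
        have hpos : 0 < ‖b + n‖ := by linarith
        have hne : b + n ≠ 0 := norm_pos_iff.1 hpos
        have ih' : ‖kummerCoeff a b n * (n ! : ℂ)‖ ≤ (∑ i ∈ Finset.range (N + 1), |C i|) * 3 ^ n := by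
          rcases hn.lt_or_eq with h' | h'
          · exact ih h'
          · subst h'
            calc _ ≤ |C N| := (hC N _ hp).trans (le_abs_self _)
              _ ≤ ∑ i ∈ Finset.range (N + 1), |C i| :=
                  Finset.single_le_sum (f := fun i => |C i|) (fun _ _ => abs_nonneg _)
                    (Finset.mem_range.2 (by omega))
              _ ≤ _ := le_mul_of_one_le_right (Finset.sum_nonneg fun _ _ => abs_nonneg _)
                    (one_le_pow₀ (by norm_num))
        rw [kummerCoeff_succ hne, norm_mul, pow_succ, ← mul_assoc]
        refine mul_le_mul ih' ?_ (norm_nonneg _) (by positivity)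
        rw [norm_div, div_le_iff₀ hpos]
        have := norm_add_le a n
        rw [norm_natCast] at this
        linarith
  have hf : (0 : ℝ) < n ! := by exact_mod_cast Nat.factorial_pos n
  rw [le_div_iff₀ hf]
  simpa [norm_mul] using key

/-- A Weierstrass majorant uniform in all three variables. It yields joint continuity, holomorphy in
the parameters and termwise differentiation. -/
lemma exists_kummerTerm_bound (A : ℝ) : ∃ u : ℕ → ℝ, Summable u ∧ ∀ a b z : ℂ, ‖a‖ ≤ A → ‖b‖ ≤ A →
    ‖z‖ ≤ A → ∀ n, ‖kummerCoeff a b n * z ^ n‖ ≤ u n := by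
  obtain ⟨D, hD, h⟩ := exists_kummerCoeff_bound A
  refine ⟨fun n => D * ((3 * A) ^ n / n !), (Real.summable_pow_div_factorial (3 * A)).mul_left D, ?_⟩
  intro a b z ha hb hz n
  rw [norm_mul, norm_pow]
  calc _ ≤ D * 3 ^ n / n ! * A ^ n :=
        mul_le_mul (h a b ha hb n) (pow_le_pow_left₀ (norm_nonneg _) hz n) (by positivity)
          (by positivity)
    _ = D * ((3 * A) ^ n / n !) := by rw [mul_pow]; ring

lemma hasSum_regKummer (a b z : ℂ) :
    HasSum (fun n => kummerCoeff a b n * z ^ n) (regKummer a b z) := by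
  obtain ⟨u, hu, h⟩ := exists_kummerTerm_bound (max ‖a‖ (max ‖b‖ ‖z‖))
  rw [regKummer_eq_tsum]
  exact (Summable.of_norm_bounded hu (h a b z (by simp) (by simp) (by simp))).hasSum

lemma continuous_regKummer : Continuous fun p : ℂ × ℂ × ℂ => regKummer p.1 p.2.1 p.2.2 := by
  rw [continuous_iff_continuousAt]
  intro p
  obtain ⟨u, hu, h⟩ := exists_kummerTerm_bound (‖p‖ + 1)
  have hc : ContinuousOn (fun p : ℂ × ℂ × ℂ => ∑' n, kummerCoeff p.1 p.2.1 n * p.2.2 ^ n)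
      (Metric.ball p 1) := by
    refine continuousOn_tsum (fun n => ?_) hu ?_
    · exact (((continuous_kummerCoeff n).comp
        (by fun_prop : Continuous fun p : ℂ × ℂ × ℂ => (p.1, p.2.1))).mul
        ((by fun_prop : Continuous fun p : ℂ × ℂ × ℂ => p.2.2 ^ n))).continuousOn
    · intro n q hq
      have hq' : ‖q‖ ≤ ‖p‖ + 1 := by
        have h1 : ‖q - p‖ < 1 := by simpa [dist_eq_norm] using hq
        have h2 := norm_add_le p (q - p)
        rw [add_sub_cancel] at h2
        linarith
      exact h _ _ _ ((norm_fst_le q).trans hq') (((norm_fst_le q.2).trans (norm_snd_le q)).trans hq')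
        (((norm_snd_le q.2).trans (norm_snd_le q)).trans hq') n
  refine (hc.continuousAt (Metric.ball_mem_nhds p one_pos)).congr ?_
  exact Eventually.of_forall fun q => (regKummer_eq_tsum _ _ _).symm

lemma differentiable_regKummer_param {α β : ℂ → ℂ} (hα : Differentiable ℂ α)
    (hβ : Differentiable ℂ β) (z : ℂ) : Differentiable ℂ fun x => regKummer (α x) (β x) z := by
  intro x
  have hα' := hα.continuous.norm.continuousAt (x := x)
  have hβ' := hβ.continuous.norm.continuousAt (x := x)
  set A := max (‖α x‖ + 1) (max (‖β x‖ + 1) ‖z‖)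
  have e1 : ∀ᶠ y in 𝓝 x, ‖α y‖ < ‖α x‖ + 1 := hα'.eventually (gt_mem_nhds (by linarith))
  have e2 : ∀ᶠ y in 𝓝 x, ‖β y‖ < ‖β x‖ + 1 := hβ'.eventually (gt_mem_nhds (by linarith))
  obtain ⟨s, hs, hso, hxs⟩ := eventually_nhds_iff.1 (e1.and e2)
  obtain ⟨u, hu, h⟩ := exists_kummerTerm_bound A
  have hd : DifferentiableOn ℂ (fun x => ∑' n, kummerCoeff (α x) (β x) n * z ^ n) s := by
    refine differentiableOn_tsum_of_summable_norm hu
      (fun n => ((differentiable_kummerCoeff hα hβ n).mul_const _).differentiableOn) hso ?_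
    intro n y hy
    exact h _ _ _ ((hs y hy).1.le.trans (le_max_left _ _))
      ((hs y hy).2.le.trans ((le_max_left _ _).trans (le_max_right _ _)))
      ((le_max_right _ _).trans (le_max_right _ _)) n
  refine (hd.differentiableAt (hso.mem_nhds hxs)).congr_of_eventuallyEq ?_
  exact Eventually.of_forall fun q => regKummer_eq_tsum _ _ _

/-! ### Derivative, contiguous relations and differential equation of Kummer's function -/

lemma ascPochhammer_eval_succ_left (n : ℕ) (a : ℂ) :
    (ascPochhammer ℂ (n + 1)).eval a = a * (ascPochhammer ℂ n).eval (a + 1) := by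
  rw [ascPochhammer_succ_left, Polynomial.eval_mul, Polynomial.eval_X, Polynomial.eval_comp]
  simp

lemma kummerCoeff_succ_mul (a b : ℂ) (n : ℕ) :
    (n + 1) * kummerCoeff a b (n + 1) = a * kummerCoeff (a + 1) (b + 1) n := by
  unfold kummerCoeff
  have hf : ((n ! : ℕ) : ℂ) ≠ 0 := by exact_mod_cast Nat.factorial_ne_zero n
  have hn : (n : ℂ) + 1 ≠ 0 := by exact_mod_cast Nat.succ_ne_zero n
  rw [ascPochhammer_eval_succ_left, Nat.factorial_succ]
  push_cast
  rw [show b + ((n : ℂ) + 1) = b + 1 + n by ring]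
  field_simp

lemma hasSum_of_shift {g : ℕ → ℂ} {s : ℂ} (f : ℕ → ℂ) (k : ℕ) (h : HasSum g s)
    (hf : ∀ n, f (n + k) = g n) : HasSum f (s + ∑ i ∈ Finset.range k, f i) :=
  (hasSum_nat_add_iff k).1 (h.congr_fun hf)

/-- Termwise differentiation. Dividing by `Γ(b)` removes the usual factor `1/b`, so the formula
holds for every `b`. -/
lemma hasDerivAt_regKummer (a b z : ℂ) :
    HasDerivAt (regKummer a b) (a * regKummer (a + 1) (b + 1) z) z := by
  set A := max ‖a‖ (max ‖b‖ (‖z‖ + 1))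
  obtain ⟨u, hu, h⟩ := exists_kummerTerm_bound A
  have hb : ∀ n, ∀ w ∈ Metric.ball (0 : ℂ) (‖z‖ + 1), ‖kummerCoeff a b n * w ^ n‖ ≤ u n := by
    intro n w hw
    have hw' : ‖w‖ < ‖z‖ + 1 := by simpa using hw
    exact h _ _ _ (le_max_left _ _) ((le_max_left _ _).trans (le_max_right _ _))
      (hw'.le.trans ((le_max_right _ _).trans (le_max_right _ _))) n
  have hz : z ∈ Metric.ball (0 : ℂ) (‖z‖ + 1) := by simp
  have hF : ∀ n, DifferentiableOn ℂ (fun w : ℂ => kummerCoeff a b n * w ^ n)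
      (Metric.ball (0 : ℂ) (‖z‖ + 1)) := fun n => by fun_prop
  have hfun : regKummer a b = fun w => ∑' n, kummerCoeff a b n * w ^ n :=
    funext (regKummer_eq_tsum a b)
  have hd := (differentiableOn_tsum_of_summable_norm hu hF Metric.isOpen_ball hb).differentiableAt
    (Metric.isOpen_ball.mem_nhds hz)
  have hs := hasSum_deriv_of_summable_norm hu hF Metric.isOpen_ball hb hz
  have hs2 : HasSum (fun n => deriv (fun w : ℂ => kummerCoeff a b n * w ^ n) z)
      (a * regKummer (a + 1) (b + 1) z) := by
    have h0 := (hasSum_regKummer (a + 1) (b + 1) z).mul_left a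
    have := hasSum_of_shift (fun n => deriv (fun w : ℂ => kummerCoeff a b n * w ^ n) z) 1 h0 (by
      intro n
      rw [deriv_const_mul_field, deriv_pow_field, Nat.add_sub_cancel]
      push_cast
      linear_combination z ^ n * kummerCoeff_succ_mul a b n)
    simpa using this
  rw [hfun, ← hs.unique hs2]
  exact hd.hasDerivAt

lemma hasSum_euler_regKummer (a b z : ℂ) :
    HasSum (fun n : ℕ => (n : ℂ) * (kummerCoeff a b n * z ^ n))
      (z * (a * regKummer (a + 1) (b + 1) z)) := by
  have h0 := ((hasSum_regKummer (a + 1) (b + 1) z).mul_left a).mul_left z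
  have := hasSum_of_shift (fun n : ℕ => (n : ℂ) * (kummerCoeff a b n * z ^ n)) 1 h0 (by
    intro n
    push_cast
    rw [pow_succ]
    linear_combination z ^ n * z * kummerCoeff_succ_mul a b n)
  simpa using this

/-- On coefficients this is `(b+n)/Γ(b+n+1) = 1/Γ(b+n)`; the factor `n` comes from the Euler
operator `z d/dz`. -/
lemma regKummer_contiguous_right (a b z : ℂ) :
    z * (a * regKummer (a + 1) (b + 2) z) + b * regKummer a (b + 1) z = regKummer a b z := by
  have h1 := hasSum_euler_regKummer a (b + 1) z
  have h2 := (hasSum_regKummer a (b + 1) z).mul_left b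
  rw [show b + 1 + 1 = b + 2 by ring] at h1
  refine (h1.add h2).unique ((hasSum_regKummer a b z).congr_fun fun n => ?_)
  unfold kummerCoeff
  rw [one_div_Gamma_eq_self_mul_one_div_Gamma_add_one (b + n),
    show b + 1 + (n : ℂ) = b + n + 1 by ring]
  ring

/-- On coefficients this is `(n+a)(a)_n = (a)_{n+1} = a (a+1)_n`. -/
lemma regKummer_contiguous_left (a b z : ℂ) :
    z * (a * regKummer (a + 1) (b + 1) z) + a * regKummer a b z = a * regKummer (a + 1) b z := by
  have h1 := hasSum_euler_regKummer a b z
  have h2 := (hasSum_regKummer a b z).mul_left a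
  refine (h1.add h2).unique (((hasSum_regKummer (a + 1) b z).mul_left a).congr_fun fun n => ?_)
  have := ascPochhammer_succ_eval n a
  rw [ascPochhammer_eval_succ_left] at this
  unfold kummerCoeff
  linear_combination (-(Gamma (b + n))⁻¹ / n ! * z ^ n) * this

/-- Eliminating `M(a+1, b)` between the two contiguous relations leaves Kummer's equation. -/
lemma regKummer_ode (a b z : ℂ) :
    z * (a * ((a + 1) * regKummer (a + 2) (b + 2) z)) + (b - z) * (a * regKummer (a + 1) (b + 1) z)
      - a * regKummer a b z = 0 := by
  have h1 := regKummer_contiguous_right (a + 1) b z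
  have h2 := regKummer_contiguous_left a b z
  rw [show a + 1 + 1 = a + 2 by ring] at h1
  linear_combination a * h1 - h2

/-- The first-order operator that lowers `a` at fixed `b`. It becomes the raising operator `κ → κ +
1` for Whittaker functions. -/
lemma regKummer_lower (a b z : ℂ) :
    z * (a * regKummer (a + 1) (b + 1) z) - z * regKummer a b z + (b - a) * regKummer a b z
      = (b - a) * regKummer (a - 1) b z := by
  have h1 := hasSum_euler_regKummer a b z
  have h2 := (hasSum_regKummer a b z).mul_left (b - a)
  have h3 := (hasSum_regKummer (a - 1) b z).mul_left (b - a)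
  have h := (h1.add h2).sub h3
  have h4 := (hasSum_regKummer a b z).mul_left z
  have h5 := hasSum_of_shift (fun n : ℕ => (n : ℂ) * (kummerCoeff a b n * z ^ n)
      + (b - a) * (kummerCoeff a b n * z ^ n) - (b - a) * (kummerCoeff (a - 1) b n * z ^ n)) 1 h4 (by
    intro n
    have e1 := ascPochhammer_succ_eval n a
    have e2 := ascPochhammer_eval_succ_left n (a - 1)
    rw [sub_add_cancel] at e2
    have e3 := one_div_Gamma_eq_self_mul_one_div_Gamma_add_one (b + n)
    unfold kummerCoeff
    rw [e1, e2, e3, Nat.factorial_succ]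
    have hf : ((n ! : ℕ) : ℂ) ≠ 0 := by exact_mod_cast Nat.factorial_ne_zero n
    have hn : (n : ℂ) + 1 ≠ 0 := by exact_mod_cast Nat.succ_ne_zero n
    push_cast
    rw [show b + ((n : ℂ) + 1) = b + n + 1 by ring]
    field_simp
    ring)
  have h6 := h.unique h5
  simp [kummerCoeff] at h6
  linear_combination h6

lemma regKummer_zero (a b : ℂ) : regKummer a b 0 = (Gamma b)⁻¹ := by
  have := (hasSum_regKummer a b 0).unique (hasSum_single 0 fun n hn => by simp [hn])
  simpa [kummerCoeff] using this

lemma ascPochhammer_eval_mul_inv_Gamma (a : ℂ) (N : ℕ) :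
    (ascPochhammer ℂ N).eval a * (Gamma (a + N))⁻¹ = (Gamma a)⁻¹ := by
  induction N with
  | zero => simp
  | succ n ih =>
    rw [← ih, ascPochhammer_succ_eval, one_div_Gamma_eq_self_mul_one_div_Gamma_add_one (a + n)]
    push_cast
    rw [← add_assoc]
    ring

/-- At `b = 1 - N` the first `N` coefficients vanish because `1/Γ` does. The remaining series is the
second Frobenius solution, so the two standard solutions become proportional. -/
lemma regKummer_one_sub_nat (a z : ℂ) (N : ℕ) :
    regKummer a (1 - N) z
      = (ascPochhammer ℂ N).eval a * z ^ N * regKummer (a + N) (1 + N) z := by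
  have h0 := (hasSum_regKummer (a + N) (1 + N) z).mul_left ((ascPochhammer ℂ N).eval a * z ^ N)
  have h1 := hasSum_of_shift (fun n => kummerCoeff a (1 - N) n * z ^ n) N h0 (by
    intro n
    have e := congrArg (Polynomial.eval a) (ascPochhammer_mul ℂ N n)
    rw [Polynomial.eval_mul, Polynomial.eval_comp, add_comm N n] at e
    simp only [Polynomial.eval_add, Polynomial.eval_X, Polynomial.eval_natCast] at e
    unfold kummerCoeff
    rw [← e, show (1 - N + (n + N : ℕ) : ℂ) = n + 1 by push_cast; ring, Gamma_nat_eq_factorial,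
      show (1 + N + n : ℂ) = (n + N : ℕ) + 1 by push_cast; ring, Gamma_nat_eq_factorial, pow_add]
    field_simp)
  have h2 := (hasSum_regKummer a (1 - N) z).unique h1
  rw [h2, add_eq_left]
  refine Finset.sum_eq_zero fun n hn => ?_
  have hn' := Finset.mem_range.1 hn
  have : Gamma (1 - N + n : ℂ) = 0 := by
    rw [show (1 - N + n : ℂ) = -((N - 1 - n : ℕ) : ℂ) by
      rw [Nat.cast_sub (by omega), Nat.cast_sub (by omega)]; push_cast; ring]
    exact Gamma_neg_nat_eq_zero _
  simp [kummerCoeff, this]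

/-! ### Whittaker functions as functions of the parameter and of the logarithm -/

/-- `M_{κ,ν}(e^w) / Γ(1 + 2ν)`. -/
def whittakerR (κ ν w : ℂ) : ℂ :=
  exp (-exp w / 2) * exp ((ν + 1 / 2) * w) * regKummer (ν - κ + 1 / 2) (1 + 2 * ν) (exp w)

/-- The derivative of `whittakerR` in `w`. -/
def whittakerR' (κ ν w : ℂ) : ℂ :=
  exp (-exp w / 2) * exp ((ν + 1 / 2) * w) *
    ((-exp w / 2 + (ν + 1 / 2)) * regKummer (ν - κ + 1 / 2) (1 + 2 * ν) (exp w)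
      + exp w * ((ν - κ + 1 / 2) * regKummer (ν - κ + 1 / 2 + 1) (1 + 2 * ν + 1) (exp w)))

/-- `g' = dg/dw` and `g'' - g' + (1/4 - ν² + κ e^w - e^{2w}/4) g = 0`: Whittaker's equation in the
variable `w = log z`. -/
def IsWhittakerSol (κ ν : ℂ) (g g' : ℂ → ℂ) : Prop :=
  ∀ w, HasDerivAt g (g' w) w ∧
    HasDerivAt g' (g' w - (1 / 4 - ν ^ 2 + κ * exp w - exp w ^ 2 / 4) * g w) w

lemma isWhittakerSol_whittakerR (κ ν : ℂ) :
    IsWhittakerSol κ ν (whittakerR κ ν) (whittakerR' κ ν) := by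
  intro w
  set a := ν - κ + 1 / 2 with ha
  set b := 1 + 2 * ν with hb
  have he := hasDerivAt_exp w
  have h1 : HasDerivAt (fun w => exp (-exp w / 2)) (exp (-exp w / 2) * (-exp w / 2)) w :=
    (he.neg.div_const 2).cexp
  have h2 : HasDerivAt (fun w => exp ((ν + 1 / 2) * w)) (exp ((ν + 1 / 2) * w) * (ν + 1 / 2)) w := by
    simpa using ((hasDerivAt_id w).const_mul (ν + 1 / 2)).cexp
  have h3 : HasDerivAt (fun w => regKummer a b (exp w))
      (a * regKummer (a + 1) (b + 1) (exp w) * exp w) w :=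
    (hasDerivAt_regKummer a b (exp w)).comp w he
  have h4 : HasDerivAt (fun w => regKummer (a + 1) (b + 1) (exp w))
      ((a + 1) * regKummer (a + 2) (b + 2) (exp w) * exp w) w := by
    have := (hasDerivAt_regKummer (a + 1) (b + 1) (exp w)).comp w he
    rwa [show a + 1 + 1 = a + 2 by ring, show b + 1 + 1 = b + 2 by ring] at this
  have h5 : HasDerivAt (fun w => -exp w / 2 + (ν + 1 / 2)) (-exp w / 2) w :=
    (he.neg.div_const 2).add_const _
  constructor
  · refine ((h1.mul h2).mul h3).congr_deriv ?_
    unfold whittakerR'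
    simp only [Pi.mul_apply]
    ring
  · refine ((h1.mul h2).mul ((h5.mul h3).add (he.mul (h4.const_mul a)))).congr_deriv ?_
    have ode := regKummer_ode a b (exp w)
    unfold whittakerR' whittakerR
    simp only [Pi.mul_apply, Pi.add_apply, ← ha, ← hb]
    rw [hb, ha] at *
    linear_combination exp (-exp w / 2) * exp ((ν + 1 / 2) * w) * exp w * ode

lemma IsWhittakerSol.add {κ ν : ℂ} {g g' f f' : ℂ → ℂ} (hg : IsWhittakerSol κ ν g g')
    (hf : IsWhittakerSol κ ν f f') :
    IsWhittakerSol κ ν (fun w => g w + f w) (fun w => g' w + f' w) := fun w =>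
  ⟨(hg w).1.add (hf w).1, ((hg w).2.add (hf w).2).congr_deriv (by ring)⟩

lemma IsWhittakerSol.const_mul {κ ν : ℂ} {g g' : ℂ → ℂ} (c : ℂ) (hg : IsWhittakerSol κ ν g g') :
    IsWhittakerSol κ ν (fun w => c * g w) (fun w => c * g' w) := fun w =>
  ⟨(hg w).1.const_mul c, ((hg w).2.const_mul c).congr_deriv (by ring)⟩

lemma IsWhittakerSol.neg_param {κ ν : ℂ} {g g' : ℂ → ℂ} (hg : IsWhittakerSol κ (-ν) g g') :
    IsWhittakerSol κ ν g g' := fun w =>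
  ⟨(hg w).1, (hg w).2.congr_deriv (by ring)⟩

/-- Translation by `πi` changes the sign of `e^w`, which the sign of `κ` compensates; the term in
`e^{2w}` is unaffected. -/
lemma IsWhittakerSol.rotate {κ ν : ℂ} {g g' : ℂ → ℂ} (hg : IsWhittakerSol (-κ) ν g g') :
    IsWhittakerSol κ ν (fun w => g (w + Real.pi * I)) (fun w => g' (w + Real.pi * I)) := fun w => by
  have he : exp (w + Real.pi * I) = -exp w := by rw [exp_add, exp_pi_mul_I]; ring
  refine ⟨(hg _).1.comp_add_const w _, ((hg _).2.comp_add_const w _).congr_deriv ?_⟩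
  rw [he]; ring

/-- The Wronskian of two solutions, normalized so as to be constant. -/
lemma IsWhittakerSol.wronskian_const {κ ν : ℂ} {g g' f f' : ℂ → ℂ} (hg : IsWhittakerSol κ ν g g')
    (hf : IsWhittakerSol κ ν f f') (w v : ℂ) :
    exp (-w) * (g w * f' w - g' w * f w) = exp (-v) * (g v * f' v - g' v * f v) := by
  have hd : ∀ w, HasDerivAt (fun w => exp (-w) * (g w * f' w - g' w * f w)) 0 w := by
    intro w
    have he : HasDerivAt (fun w => exp (-w)) (exp (-w) * (-1)) w := (hasDerivAt_neg w).cexp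
    refine (he.mul (((hg w).1.mul (hf w).2).sub ((hg w).2.mul (hf w).1))).congr_deriv ?_
    simp only [Pi.mul_apply, Pi.sub_apply]
    ring
  exact is_const_of_deriv_eq_zero (fun w => (hd w).differentiableAt) (fun w => (hd w).deriv) w v

lemma continuous_whittakerR (κ : ℂ) : Continuous fun p : ℂ × ℂ => whittakerR κ p.1 p.2 := by
  unfold whittakerR
  have : Continuous fun p : ℂ × ℂ => regKummer (p.1 - κ + 1 / 2) (1 + 2 * p.1) (exp p.2) :=
    continuous_regKummer.comp (g := fun p : ℂ × ℂ × ℂ => regKummer p.1 p.2.1 p.2.2)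
      (f := fun p : ℂ × ℂ => (p.1 - κ + 1 / 2, 1 + 2 * p.1, exp p.2)) (by fun_prop)
  fun_prop

lemma continuous_whittakerR' (κ : ℂ) : Continuous fun p : ℂ × ℂ => whittakerR' κ p.1 p.2 := by
  unfold whittakerR'
  have : Continuous fun p : ℂ × ℂ => regKummer (p.1 - κ + 1 / 2) (1 + 2 * p.1) (exp p.2) :=
    continuous_regKummer.comp (g := fun p : ℂ × ℂ × ℂ => regKummer p.1 p.2.1 p.2.2)
      (f := fun p : ℂ × ℂ => (p.1 - κ + 1 / 2, 1 + 2 * p.1, exp p.2)) (by fun_prop)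
  have : Continuous fun p : ℂ × ℂ =>
      regKummer (p.1 - κ + 1 / 2 + 1) (1 + 2 * p.1 + 1) (exp p.2) :=
    continuous_regKummer.comp (g := fun p : ℂ × ℂ × ℂ => regKummer p.1 p.2.1 p.2.2)
      (f := fun p : ℂ × ℂ => (p.1 - κ + 1 / 2 + 1, 1 + 2 * p.1 + 1, exp p.2)) (by fun_prop)
  fun_prop

lemma differentiable_whittakerR_param (κ w : ℂ) : Differentiable ℂ fun ν => whittakerR κ ν w := by
  unfold whittakerR
  have := differentiable_regKummer_param (α := fun ν => ν - κ + 1 / 2) (β := fun ν => 1 + 2 * ν)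
    (by fun_prop) (by fun_prop) (exp w)
  fun_prop

/-! ### Removing the singularities of the Whittaker function in its parameter -/

/-- The combination of `whittakerR κ (± ν)` proportional to `W_{κ,ν}`. -/
def whittakerB (κ ν w : ℂ) : ℂ :=
  whittakerR κ ν w * (Gamma (1 / 2 - ν - κ))⁻¹ - whittakerR κ (-ν) w * (Gamma (1 / 2 + ν - κ))⁻¹

/-- The derivative of `whittakerB` in `w`. -/
def whittakerB' (κ ν w : ℂ) : ℂ :=
  whittakerR' κ ν w * (Gamma (1 / 2 - ν - κ))⁻¹ - whittakerR' κ (-ν) w * (Gamma (1 / 2 + ν - κ))⁻¹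

/-- `W_{κ,ν}(e^w)` for `2ν` not an integer. -/
def whittakerWGen (κ ν w : ℂ) : ℂ := -Real.pi / sin (2 * Real.pi * ν) * whittakerB κ ν w

/-- The derivative of `whittakerWGen` in `w`. -/
def whittakerWGen' (κ ν w : ℂ) : ℂ := -Real.pi / sin (2 * Real.pi * ν) * whittakerB' κ ν w

lemma isWhittakerSol_whittakerWGen (κ ν : ℂ) :
    IsWhittakerSol κ ν (whittakerWGen κ ν) (whittakerWGen' κ ν) := by
  have h := (((isWhittakerSol_whittakerR κ ν).const_mul (Gamma (1 / 2 - ν - κ))⁻¹).add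
    ((isWhittakerSol_whittakerR κ (-ν)).neg_param.const_mul
      (-(Gamma (1 / 2 + ν - κ))⁻¹))).const_mul (-Real.pi / sin (2 * Real.pi * ν))
  convert h using 1
  · ext w; unfold whittakerWGen whittakerB; ring
  · ext w; unfold whittakerWGen' whittakerB'; ring

lemma continuous_inv_Gamma_comp {X : Type*} [TopologicalSpace X] {f : X → ℂ} (hf : Continuous f) :
    Continuous fun x => (Gamma (f x))⁻¹ :=
  differentiable_one_div_Gamma.continuous.comp hf

lemma continuous_whittakerB (κ : ℂ) : Continuous fun p : ℂ × ℂ => whittakerB κ p.1 p.2 := by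
  unfold whittakerB
  have h1 := continuous_whittakerR κ
  have h2 : Continuous fun p : ℂ × ℂ => whittakerR κ (-p.1) p.2 :=
    h1.comp (g := fun p : ℂ × ℂ => whittakerR κ p.1 p.2) (f := fun p : ℂ × ℂ => (-p.1, p.2))
      (by fun_prop)
  exact (h1.mul (continuous_inv_Gamma_comp (by fun_prop))).sub
    (h2.mul (continuous_inv_Gamma_comp (by fun_prop)))

lemma continuous_whittakerB' (κ : ℂ) : Continuous fun p : ℂ × ℂ => whittakerB' κ p.1 p.2 := by
  unfold whittakerB'
  have h1 := continuous_whittakerR' κ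
  have h2 : Continuous fun p : ℂ × ℂ => whittakerR' κ (-p.1) p.2 :=
    h1.comp (g := fun p : ℂ × ℂ => whittakerR' κ p.1 p.2) (f := fun p : ℂ × ℂ => (-p.1, p.2))
      (by fun_prop)
  exact (h1.mul (continuous_inv_Gamma_comp (by fun_prop))).sub
    (h2.mul (continuous_inv_Gamma_comp (by fun_prop)))

lemma differentiable_whittakerB_param (κ w : ℂ) : Differentiable ℂ fun ν => whittakerB κ ν w := by
  unfold whittakerB
  have h1 := differentiable_whittakerR_param κ w
  have h2 : Differentiable ℂ fun ν => whittakerR κ (-ν) w := h1.comp differentiable_neg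
  have h3 : Differentiable ℂ fun ν => (Gamma (1 / 2 - ν - κ))⁻¹ :=
    differentiable_one_div_Gamma.comp (by fun_prop)
  have h4 : Differentiable ℂ fun ν => (Gamma (1 / 2 + ν - κ))⁻¹ :=
    differentiable_one_div_Gamma.comp (by fun_prop)
  exact (h1.mul h3).sub (h2.mul h4)

/-- The Pochhammer factor relating the two solutions at `ν = N/2` is exactly the quotient of the two
Gamma factors, so the two terms cancel. -/
lemma whittakerB_half_nat (κ w : ℂ) (N : ℕ) : whittakerB κ (N / 2) w = 0 := by
  unfold whittakerB whittakerR
  have h1 := regKummer_one_sub_nat (1 / 2 - N / 2 - κ) (exp w) N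
  have h2 := ascPochhammer_eval_mul_inv_Gamma (1 / 2 - N / 2 - κ) N
  rw [show (-(N / 2 : ℂ) - κ + 1 / 2) = 1 / 2 - N / 2 - κ by ring,
    show (1 + 2 * -(N / 2 : ℂ)) = 1 - N by ring, h1, ← h2,
    show (1 / 2 - (N / 2 : ℂ) - κ + N) = 1 / 2 + N / 2 - κ by ring,
    show ((N / 2 : ℂ) - κ + 1 / 2) = 1 / 2 + N / 2 - κ by ring,
    show (1 + 2 * (N / 2 : ℂ)) = 1 + N by ring]
  have h3 : exp (((N : ℂ) / 2 + 1 / 2) * w) = exp ((-((N : ℂ) / 2) + 1 / 2) * w) * exp w ^ N := by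
    rw [← exp_nat_mul, ← exp_add]; ring_nf
  rw [h3]
  ring

lemma whittakerB_neg (κ ν w : ℂ) : whittakerB κ (-ν) w = -whittakerB κ ν w := by
  unfold whittakerB
  rw [neg_neg, sub_neg_eq_add, ← sub_eq_add_neg]
  ring

lemma whittakerB_eq_zero (κ w : ℂ) {ν : ℂ} (h : sin (2 * Real.pi * ν) = 0) :
    whittakerB κ ν w = 0 := by
  obtain ⟨m, hm⟩ := sin_eq_zero_iff.1 h
  have hpi : (Real.pi : ℂ) ≠ 0 := by exact_mod_cast Real.pi_ne_zero
  have hν : ν = m / 2 := by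
    have : (Real.pi : ℂ) * (2 * ν) = Real.pi * m := by linear_combination hm
    have := mul_left_cancel₀ hpi this
    linear_combination this / 2
  rcases Int.eq_nat_or_neg m with ⟨N, rfl | rfl⟩
  · rw [hν]; simpa using whittakerB_half_nat κ w N
  · rw [hν, show ((-(N : ℤ) : ℤ) : ℂ) / 2 = -((N : ℂ) / 2) by push_cast; ring, whittakerB_neg,
      whittakerB_half_nat, neg_zero]

/-- The reflection formula at `±2ν`. No value of `ν` is excluded: at the poles both sides of the
reflection formula are `0` by the conventions for `Gamma` and division. -/
lemma whittakerW_expr_eq (κ ν w : ℂ) :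
    Gamma (-2 * ν) / Gamma (1 / 2 - ν - κ) * whittakerMLog κ ν w
      + Gamma (2 * ν) / Gamma (1 / 2 + ν - κ) * whittakerMLog κ (-ν) w = whittakerWGen κ ν w := by
  have h1 := Gamma_mul_Gamma_one_sub (-2 * ν)
  have h2 := Gamma_mul_Gamma_one_sub (2 * ν)
  rw [show (Real.pi : ℂ) * (-2 * ν) = -(2 * Real.pi * ν) by ring, sin_neg,
    show 1 - -2 * ν = 1 + 2 * ν by ring, div_neg] at h1
  rw [show (Real.pi : ℂ) * (2 * ν) = 2 * Real.pi * ν by ring] at h2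
  unfold whittakerMLog kummerM whittakerWGen whittakerB whittakerR
  change _ * (_ * (_ * regKummer _ _ _)) + _ * (_ * (_ * regKummer _ _ _)) = _
  rw [show (1 + 2 * -ν) = 1 - 2 * ν by ring]
  simp only [div_eq_mul_inv (Gamma _)]
  linear_combination (Gamma (1 / 2 - ν - κ))⁻¹ * exp (-exp w / 2) * exp ((ν + 1 / 2) * w) *
    regKummer (ν - κ + 1 / 2) (1 + 2 * ν) (exp w) * h1 +
    (Gamma (1 / 2 + ν - κ))⁻¹ * exp (-exp w / 2) * exp ((-ν + 1 / 2) * w) *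
    regKummer (-ν - κ + 1 / 2) (1 - 2 * ν) (exp w) * h2

lemma differentiable_sin_param : Differentiable ℂ fun ν : ℂ => sin (2 * Real.pi * ν) := by fun_prop

lemma hasDerivAt_sin_param (ν : ℂ) : HasDerivAt (fun ν : ℂ => sin (2 * Real.pi * ν))
    (cos (2 * Real.pi * ν) * (2 * Real.pi)) ν := by
  simpa using ((hasDerivAt_id ν).const_mul (2 * (Real.pi : ℂ))).csin

lemma deriv_sin_param_ne_zero {ν : ℂ} (h : sin (2 * Real.pi * ν) = 0) :
    deriv (fun ν : ℂ => sin (2 * Real.pi * ν)) ν ≠ 0 := by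
  rw [(hasDerivAt_sin_param ν).deriv]
  have hpi : (Real.pi : ℂ) ≠ 0 := by exact_mod_cast Real.pi_ne_zero
  have hc : cos (2 * Real.pi * ν) ≠ 0 := by
    intro hc
    have := sin_sq_add_cos_sq (2 * Real.pi * ν)
    rw [h, hc] at this
    norm_num at this
  exact mul_ne_zero hc (mul_ne_zero two_ne_zero hpi)

lemma eventually_sin_param_ne_zero (μ : ℂ) : ∀ᶠ ν in 𝓝[≠] μ, sin (2 * Real.pi * ν) ≠ 0 := by
  by_cases h : sin (2 * Real.pi * μ) = 0
  · have h' := (hasDerivAt_sin_param μ).eventually_ne (c := 0)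
      (by rw [← (hasDerivAt_sin_param μ).deriv]; exact deriv_sin_param_ne_zero h)
    exact h'
  · exact (differentiable_sin_param.continuous.continuousAt.eventually_ne h).filter_mono
      nhdsWithin_le_nhds

lemma differentiableAt_whittakerWGen {ν : ℂ} (h : sin (2 * Real.pi * ν) ≠ 0) (κ w : ℂ) :
    DifferentiableAt ℂ (fun ν => whittakerWGen κ ν w) ν :=
  ((differentiableAt_const _).div differentiable_sin_param.differentiableAt h).mul
    (differentiable_whittakerB_param κ w ν)

lemma whittakerWLog_eq_of_tendsto {κ μ w l : ℂ}
    (h : Tendsto (fun ν => whittakerWGen κ ν w) (𝓝[≠] μ) (𝓝 l)) : whittakerWLog κ μ w = l := by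
  refine Tendsto.limUnder_eq (h.congr' ?_)
  filter_upwards with ν using (whittakerW_expr_eq κ ν w).symm

lemma whittakerWLog_eq_gen {ν : ℂ} (h : sin (2 * Real.pi * ν) ≠ 0) (κ w : ℂ) :
    whittakerWLog κ ν w = whittakerWGen κ ν w :=
  whittakerWLog_eq_of_tendsto
    ((differentiableAt_whittakerWGen h κ w).continuousAt.tendsto.mono_left nhdsWithin_le_nhds)

/-- The zeros of `sin(2πν)` are simple and the numerator vanishes there too. Replacing both by their
divided differences at `μ` gives a differentiable function, whose value at `μ` is the limit defining
`W`. -/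
lemma differentiable_whittakerWLog_param (κ w : ℂ) :
    Differentiable ℂ fun ν => whittakerWLog κ ν w := by
  intro μ
  by_cases h : sin (2 * Real.pi * μ) = 0
  · set S : ℂ → ℂ := fun ν => sin (2 * Real.pi * ν) with hS
    set B : ℂ → ℂ := fun ν => whittakerB κ ν w with hB
    set g : ℂ → ℂ := fun ν => -Real.pi / dslope S μ ν * dslope B μ ν with hg
    have hdS : Differentiable ℂ (dslope S μ) := by
      rw [← differentiableOn_univ, differentiableOn_dslope univ_mem, differentiableOn_univ]
      exact differentiable_sin_param
    have hdB : Differentiable ℂ (dslope B μ) := by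
      rw [← differentiableOn_univ, differentiableOn_dslope univ_mem, differentiableOn_univ]
      exact differentiable_whittakerB_param κ w
    have hgd : DifferentiableAt ℂ g μ := by
      refine ((differentiableAt_const _).div (hdS μ) ?_).mul (hdB μ)
      rw [dslope_same]
      exact deriv_sin_param_ne_zero h
    have heq : ∀ᶠ ν in 𝓝[≠] μ, whittakerWGen κ ν w = g ν := by
      filter_upwards [self_mem_nhdsWithin] with ν hν
      have hne : ν - μ ≠ 0 := sub_ne_zero.2 hν
      simp only [hg, whittakerWGen]
      rw [dslope_of_ne _ hν, dslope_of_ne _ hν, slope_def_field, slope_def_field]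
      simp only [hS, hB, h, whittakerB_eq_zero κ w h, sub_zero]
      field_simp
    have hμ : whittakerWLog κ μ w = g μ := by
      refine whittakerWLog_eq_of_tendsto (Tendsto.congr' ?_
        (hgd.continuousAt.tendsto.mono_left nhdsWithin_le_nhds))
      filter_upwards [heq] with ν hν using hν.symm
    refine hgd.congr_of_eventuallyEq ?_
    have := heq.and (eventually_sin_param_ne_zero μ)
    rw [eventually_nhdsWithin_iff] at this
    filter_upwards [this] with ν hν
    by_cases hνμ : ν = μ
    · rw [hνμ, hμ]
    · rw [whittakerWLog_eq_gen (hν hνμ).2, (hν hνμ).1]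
  · refine (differentiableAt_whittakerWGen h κ w).congr_of_eventuallyEq ?_
    filter_upwards [differentiable_sin_param.continuous.continuousAt.eventually_ne h] with ν hν
    exact whittakerWLog_eq_gen hν κ w

/-! ### Derivatives with respect to the parameter -/

lemma hasDerivAt_integral_of_continuous {F F' : ℝ → ℂ → ℂ} (hF : Continuous (Function.uncurry F))
    (hF' : Continuous (Function.uncurry F')) (hd : ∀ θ w, HasDerivAt (F θ) (F' θ w) w) (a b : ℝ)
    (w : ℂ) : HasDerivAt (fun w => ∫ θ in a..b, F θ w) (∫ θ in a..b, F' θ w) w := by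
  obtain ⟨C, hC⟩ := (isCompact_uIcc (a := a) (b := b)).prod (isCompact_closedBall w 1)
    |>.exists_bound_of_continuousOn hF'.continuousOn
  have hc : ∀ v, Continuous fun θ => F θ v := fun v => hF.comp (by fun_prop : Continuous fun θ => (θ, v))
  have hc' : Continuous fun θ => F' θ w := hF'.comp (by fun_prop : Continuous fun θ => (θ, w))
  refine (intervalIntegral.hasDerivAt_integral_of_dominated_loc_of_deriv_le
    (F' := fun w θ => F' θ w) (F := fun w θ => F θ w)
    (s := Metric.closedBall w 1) (bound := fun _ => C) (Metric.closedBall_mem_nhds w one_pos)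
    (Eventually.of_forall fun v => (hc v).aestronglyMeasurable) ((hc w).intervalIntegrable _ _)
    hc'.aestronglyMeasurable ?_ intervalIntegrable_const ?_).2
  · refine Eventually.of_forall fun θ hθ v hv => hC (θ, v) ⟨?_, hv⟩
    exact Set.uIoc_subset_uIcc hθ
  · exact Eventually.of_forall fun θ _ v _ => hd θ v

/-- Only continuity over the circle is required, because the integrands used later may be singular
at points inside it. -/
lemma hasDerivAt_circleIntegral {c : ℂ} {R : ℝ} (hR : 0 ≤ R) {f f' : ℂ → ℂ → ℂ}
    (hf : ContinuousOn (Function.uncurry f) (Metric.sphere c R ×ˢ Set.univ))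
    (hf' : ContinuousOn (Function.uncurry f') (Metric.sphere c R ×ˢ Set.univ))
    (hd : ∀ ζ ∈ Metric.sphere c R, ∀ w, HasDerivAt (f ζ) (f' ζ w) w) (w : ℂ) :
    HasDerivAt (fun w => ∮ ζ in C(c, R), f ζ w) (∮ ζ in C(c, R), f' ζ w) w := by
  have hcirc : ∀ g : ℂ → ℂ → ℂ, ContinuousOn (Function.uncurry g) (Metric.sphere c R ×ˢ Set.univ) →
      Continuous (Function.uncurry fun (θ : ℝ) (w : ℂ) =>
        deriv (circleMap c R) θ • g (circleMap c R θ) w) := by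
    intro g hg
    have h1 : Continuous fun p : ℝ × ℂ => g (circleMap c R p.1) p.2 :=
      hg.comp_continuous (f := fun p : ℝ × ℂ => (circleMap c R p.1, p.2))
        (((continuous_circleMap c R).comp continuous_fst).prodMk continuous_snd)
        fun p => ⟨circleMap_mem_sphere c hR _, trivial⟩
    have h2 : Continuous fun p : ℝ × ℂ => deriv (circleMap c R) p.1 := by
      simp only [deriv_circleMap]
      exact ((continuous_circleMap 0 R).comp continuous_fst).mul continuous_const
    exact h2.smul h1
  exact hasDerivAt_integral_of_continuous (hcirc f hf) (hcirc f' hf')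
    (fun θ w => (hd _ (circleMap_mem_sphere c hR θ) w).fun_const_smul _) _ _ w

lemma exists_sphere_sin_param_ne_zero (μ : ℂ) :
    ∃ r : ℝ, 0 < r ∧ ∀ ζ ∈ Metric.sphere μ r, sin (2 * Real.pi * ζ) ≠ 0 := by
  have h := eventually_sin_param_ne_zero μ
  rw [eventually_nhdsWithin_iff, Metric.eventually_nhds_iff] at h
  obtain ⟨ε, hε, h⟩ := h
  refine ⟨ε / 2, by linarith, fun ζ hζ => h ?_ ?_⟩
  · rw [Metric.mem_sphere] at hζ; linarith
  · rintro rfl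
    simp at hζ
    linarith

/-- The `j`-th derivative of `W_{κ,μ}(e^w)` with respect to `μ`. -/
def whittakerWDeriv (κ μ : ℂ) (j : ℕ) (w : ℂ) : ℂ :=
  iteratedDeriv j (fun ν => whittakerWLog κ ν w) μ

lemma differentiable_iteratedDeriv_of_entire {f : ℂ → ℂ} (hf : Differentiable ℂ f) (j : ℕ) :
    Differentiable ℂ (iteratedDeriv j f) :=
  hf.contDiff.differentiable_iteratedDeriv j (n := ⊤) (WithTop.coe_lt_top _)

lemma iteratedDeriv_id_mul {f : ℂ → ℂ} (hf : Differentiable ℂ f) (j : ℕ) :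
    iteratedDeriv j (fun ν => ν * f ν)
      = fun ν => ν * iteratedDeriv j f ν + j * iteratedDeriv (j - 1) f ν := by
  have hd := differentiable_iteratedDeriv_of_entire hf
  induction j with
  | zero => simp
  | succ j ih =>
    rw [iteratedDeriv_succ, ih]
    ext ν
    have h1 := ((hasDerivAt_id ν).mul (hd j ν).hasDerivAt).add
      ((hd (j - 1) ν).hasDerivAt.const_mul (j : ℂ))
    refine h1.deriv.trans ?_
    rw [← iteratedDeriv_succ, ← iteratedDeriv_succ]
    rcases j with _ | j
    · simp
      ring
    · simp
      ring

/-- Leibniz' rule for the factor `ν²`. The coefficients `j` and `j(j-1)` vanish whenever the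
truncated subtractions `j - 1` and `j - 2` are wrong. -/
lemma iteratedDeriv_sq_mul {f : ℂ → ℂ} (hf : Differentiable ℂ f) (j : ℕ) (μ : ℂ) :
    iteratedDeriv j (fun ν => ν ^ 2 * f ν) μ = μ ^ 2 * iteratedDeriv j f μ
      + (2 * μ * j * iteratedDeriv (j - 1) f μ + j * (j - 1) * iteratedDeriv (j - 2) f μ) := by
  have h : (fun ν => ν ^ 2 * f ν) = fun ν => ν * (fun ν => ν * f ν) ν := by ext ν; ring
  rw [h, iteratedDeriv_id_mul (by fun_prop), iteratedDeriv_id_mul hf, iteratedDeriv_id_mul hf]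
  rcases j with _ | j
  · simp
    ring
  · simp only [Nat.add_sub_cancel, Nat.cast_add, Nat.cast_one,
      show j + 1 - 2 = j - 1 by omega]
    ring

lemma continuousOn_whittakerWGen {κ : ℂ} {s : Set ℂ} (hs : ∀ ζ ∈ s, sin (2 * Real.pi * ζ) ≠ 0) :
    ContinuousOn (fun p : ℂ × ℂ => whittakerWGen κ p.1 p.2) (s ×ˢ Set.univ) := by
  unfold whittakerWGen
  refine ContinuousOn.mul (ContinuousOn.div continuousOn_const ?_ fun p hp => hs _ hp.1)
    (continuous_whittakerB κ).continuousOn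
  exact (by fun_prop : Continuous fun p : ℂ × ℂ => sin (2 * Real.pi * p.1)).continuousOn

lemma continuousOn_whittakerWGen' {κ : ℂ} {s : Set ℂ} (hs : ∀ ζ ∈ s, sin (2 * Real.pi * ζ) ≠ 0) :
    ContinuousOn (fun p : ℂ × ℂ => whittakerWGen' κ p.1 p.2) (s ×ˢ Set.univ) := by
  unfold whittakerWGen'
  refine ContinuousOn.mul (ContinuousOn.div continuousOn_const ?_ fun p hp => hs _ hp.1)
    (continuous_whittakerB' κ).continuousOn
  exact (by fun_prop : Continuous fun p : ℂ × ℂ => sin (2 * Real.pi * p.1)).continuousOn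

/-- Cauchy's estimate: bounds for the explicit formula on a circle avoiding its singularities
control every derivative at the centre, even if the centre is exceptional. -/
lemma norm_whittakerWDeriv_le {κ μ w : ℂ} {r C : ℝ} (hr : 0 < r)
    (hs : ∀ ζ ∈ Metric.sphere μ r, sin (2 * Real.pi * ζ) ≠ 0)
    (hC : ∀ ζ ∈ Metric.sphere μ r, ‖whittakerWGen κ ζ w‖ ≤ C) (j : ℕ) :
    ‖whittakerWDeriv κ μ j w‖ ≤ j ! * C / r ^ j :=
  norm_iteratedDeriv_le_of_forall_mem_sphere_norm_le j hr
    (differentiable_whittakerWLog_param κ w).diffContOnCl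
    fun ζ hζ => by rw [whittakerWLog_eq_gen (hs ζ hζ)]; exact hC ζ hζ

/-- The differential equations satisfied by the derivatives of `W_{κ,μ}` with respect to `μ`. -/
theorem whittakerWDeriv_ode (κ μ : ℂ) (j : ℕ) : ∃ U' : ℂ → ℂ, ∀ w,
    HasDerivAt (whittakerWDeriv κ μ j) (U' w) w ∧
    HasDerivAt U' (U' w - (1 / 4 - μ ^ 2 + κ * exp w - exp w ^ 2 / 4) * whittakerWDeriv κ μ j w
      + (2 * μ * j * whittakerWDeriv κ μ (j - 1) w
        + j * (j - 1) * whittakerWDeriv κ μ (j - 2) w)) w := by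
  -- The point `μ` may be exceptional, but on a small circle around it `W` is given by the explicit
  -- formula, which solves Whittaker's equation. Cauchy's formula transfers the equation to the
  -- centre.
  obtain ⟨r, hr, hs⟩ := exists_sphere_sin_param_ne_zero μ
  have hj : ((j ! : ℕ) : ℂ) ≠ 0 := by exact_mod_cast Nat.factorial_ne_zero j
  set c : ℂ := (2 * Real.pi * I / j !)⁻¹ with hc
  set p : ℂ → ℂ := fun ζ => 1 / (ζ - μ) ^ (j + 1) with hp
  have hc0 : (2 * Real.pi * I / j ! : ℂ) ≠ 0 := div_ne_zero two_pi_I_ne_zero hj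
  have cauchy : ∀ f : ℂ → ℂ, Differentiable ℂ f →
      iteratedDeriv j f μ = c * ∮ ζ in C(μ, r), p ζ * f ζ := by
    intro f hf
    have := hf.differentiableOn.circleIntegral_one_div_sub_center_pow_smul (c := μ) hr j
    simp only [smul_eq_mul] at this
    rw [hp, hc, this, inv_mul_cancel_left₀ hc0]
  have hpc : ContinuousOn (fun q : ℂ × ℂ => p q.1) (Metric.sphere μ r ×ˢ Set.univ) := by
    refine ContinuousOn.div continuousOn_const (by fun_prop) fun q hq => pow_ne_zero _ ?_
    have := hq.1
    rw [mem_sphere_iff_norm] at this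
    exact norm_pos_iff.1 (by rw [this]; exact hr)
  have hg := continuousOn_whittakerWGen (κ := κ) hs
  have hg' := continuousOn_whittakerWGen' (κ := κ) hs
  have hq : ContinuousOn (fun q : ℂ × ℂ => 1 / 4 - q.1 ^ 2 + κ * exp q.2 - exp q.2 ^ 2 / 4)
      (Metric.sphere μ r ×ˢ Set.univ) := by fun_prop
  have hU : whittakerWDeriv κ μ j = fun w => c * ∮ ζ in C(μ, r), p ζ * whittakerWGen κ ζ w := by
    ext w
    rw [whittakerWDeriv, cauchy _ (differentiable_whittakerWLog_param κ w)]
    congr 1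
    exact circleIntegral.integral_congr hr.le fun ζ hζ => by
      simp only [whittakerWLog_eq_gen (hs ζ hζ)]
  refine ⟨fun w => c * ∮ ζ in C(μ, r), p ζ * whittakerWGen' κ ζ w, fun w => ⟨?_, ?_⟩⟩
  · rw [hU]
    refine HasDerivAt.const_mul c (hasDerivAt_circleIntegral
      (f := fun ζ w => p ζ * whittakerWGen κ ζ w) (f' := fun ζ w => p ζ * whittakerWGen' κ ζ w)
      hr.le (hpc.mul hg) (hpc.mul hg') ?_ w)
    intro ζ _ w
    exact (isWhittakerSol_whittakerWGen κ ζ w).1.const_mul _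
  · have hcont : ContinuousOn (fun q : ℂ × ℂ => p q.1 * (whittakerWGen' κ q.1 q.2
        - (1 / 4 - q.1 ^ 2 + κ * exp q.2 - exp q.2 ^ 2 / 4) * whittakerWGen κ q.1 q.2))
        (Metric.sphere μ r ×ˢ Set.univ) := hpc.mul (hg'.sub (hq.mul hg))
    have h2 := HasDerivAt.const_mul c (hasDerivAt_circleIntegral
      (f := fun ζ w => p ζ * whittakerWGen' κ ζ w)
      (f' := fun ζ w => p ζ * (whittakerWGen' κ ζ w
        - (1 / 4 - ζ ^ 2 + κ * exp w - exp w ^ 2 / 4) * whittakerWGen κ ζ w))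
      hr.le (hpc.mul hg') hcont
      (fun ζ _ w => (isWhittakerSol_whittakerWGen κ ζ w).2.const_mul _) w)
    refine h2.congr_deriv ?_
    have hslice : Continuous fun ζ : ℂ => (ζ, w) := by fun_prop
    have cp : ContinuousOn p (Metric.sphere μ r) :=
      hpc.comp (f := fun ζ : ℂ => (ζ, w)) hslice.continuousOn fun ζ hζ => ⟨hζ, trivial⟩
    have cg : ContinuousOn (fun ζ => whittakerWGen κ ζ w) (Metric.sphere μ r) :=
      hg.comp (f := fun ζ : ℂ => (ζ, w)) hslice.continuousOn fun ζ hζ => ⟨hζ, trivial⟩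
    have cg' : ContinuousOn (fun ζ => whittakerWGen' κ ζ w) (Metric.sphere μ r) :=
      hg'.comp (f := fun ζ : ℂ => (ζ, w)) hslice.continuousOn fun ζ hζ => ⟨hζ, trivial⟩
    have i1 : CircleIntegrable (fun ζ => p ζ * whittakerWGen' κ ζ w) μ r :=
      (cp.mul cg').circleIntegrable hr.le
    have i2 : CircleIntegrable (fun ζ => (1 / 4 + κ * exp w - exp w ^ 2 / 4) *
        (p ζ * whittakerWGen κ ζ w)) μ r :=
      (continuousOn_const.mul (cp.mul cg)).circleIntegrable hr.le
    have i3 : CircleIntegrable (fun ζ => p ζ * (ζ ^ 2 * whittakerWGen κ ζ w)) μ r :=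
      (cp.mul ((continuousOn_id.pow 2).mul cg)).circleIntegrable hr.le
    have e1 : (∮ ζ in C(μ, r), p ζ * (whittakerWGen' κ ζ w
        - (1 / 4 - ζ ^ 2 + κ * exp w - exp w ^ 2 / 4) * whittakerWGen κ ζ w))
        = (∮ ζ in C(μ, r), p ζ * whittakerWGen' κ ζ w)
          - (1 / 4 + κ * exp w - exp w ^ 2 / 4) * (∮ ζ in C(μ, r), p ζ * whittakerWGen κ ζ w)
          + ∮ ζ in C(μ, r), p ζ * (ζ ^ 2 * whittakerWGen κ ζ w) := by
      rw [← circleIntegral.integral_const_mul, ← circleIntegral.integral_sub i1 i2,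
        ← circleIntegral.integral_add (i1.fun_sub i2) i3]
      congr 1
      ext ζ
      ring
    -- Under the integral the equation carries the variable factor `ζ²`, not `μ²`. Cauchy's formula
    -- for `ν² W` together with Leibniz' rule produces the lower-order terms.
    have e2 := cauchy (fun ν => ν ^ 2 * whittakerWLog κ ν w)
      ((differentiable_id.pow 2).mul (differentiable_whittakerWLog_param κ w))
    rw [iteratedDeriv_sq_mul (differentiable_whittakerWLog_param κ w)] at e2
    have e3 : (∮ ζ in C(μ, r), p ζ * (ζ ^ 2 * whittakerWGen κ ζ w))
        = ∮ ζ in C(μ, r), p ζ * (ζ ^ 2 * whittakerWLog κ ζ w) :=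
      circleIntegral.integral_congr hr.le fun ζ hζ => by
        simp only [whittakerWLog_eq_gen (hs ζ hζ)]
    rw [e1, e3]
    have e4 := congrFun hU w
    simp only [whittakerWDeriv] at e4 ⊢
    linear_combination -e2 + (1 / 4 + κ * exp w - exp w ^ 2 / 4) * e4

/-! ### Wronskians of Whittaker functions -/

/-- With opposite exponents the powers cancel and the Wronskian is a continuous function of `e^w`.
Being constant, it equals its value at `0`, the limit as `w → -∞`. -/
lemma IsWhittakerSol.wronskian_of_exponents {κ ν : ℂ} {g g' f f' A B C D : ℂ → ℂ}
    (hg : IsWhittakerSol κ ν g g') (hf : IsWhittakerSol κ ν f f')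
    (hA : Continuous A) (hB : Continuous B) (hC : Continuous C) (hD : Continuous D)
    (eg : ∀ w, g w = exp ((ν + 1 / 2) * w) * A (exp w))
    (eg' : ∀ w, g' w = exp ((ν + 1 / 2) * w) * ((ν + 1 / 2) * A (exp w) + exp w * B (exp w)))
    (ef : ∀ w, f w = exp ((-ν + 1 / 2) * w) * C (exp w))
    (ef' : ∀ w, f' w = exp ((-ν + 1 / 2) * w) * ((-ν + 1 / 2) * C (exp w) + exp w * D (exp w)))
    (w : ℂ) : exp (-w) * (g w * f' w - g' w * f w) = -2 * ν * (A 0 * C 0) := by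
  set F : ℂ → ℂ := fun z => A z * ((-ν + 1 / 2) * C z + z * D z)
    - ((ν + 1 / 2) * A z + z * B z) * C z with hF
  have hFc : Continuous F := by fun_prop
  have hw : ∀ v, exp (-v) * (g v * f' v - g' v * f v) = F (exp v) := by
    intro v
    have he : exp (-v) * (exp ((ν + 1 / 2) * v) * exp ((-ν + 1 / 2) * v)) = 1 := by
      rw [← exp_add, ← exp_add, exp_eq_one_iff]
      exact ⟨0, by push_cast; ring⟩
    rw [eg, eg', ef, ef', hF]
    linear_combination (A (exp v) * ((-ν + 1 / 2) * C (exp v) + exp v * D (exp v))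
      - ((ν + 1 / 2) * A (exp v) + exp v * B (exp v)) * C (exp v)) * he
  have hlim : Tendsto (fun t : ℝ => F (exp t)) atBot (𝓝 (F 0)) := by
    refine (hFc.tendsto 0).comp ?_
    have := (continuous_ofReal.tendsto 0).comp Real.tendsto_exp_atBot
    simpa [Function.comp_def] using this
  have hconst : (fun t : ℝ => F (exp t)) = fun _ => exp (-w) * (g w * f' w - g' w * f w) := by
    ext t
    rw [← hw, hg.wronskian_const hf (t : ℂ) w]
  rw [hconst] at hlim
  rw [tendsto_nhds_unique tendsto_const_nhds hlim, hF]
  ring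

/-- The analytic factor of `whittakerR`. -/
def whittakerRCore (κ ν z : ℂ) : ℂ := exp (-z / 2) * regKummer (ν - κ + 1 / 2) (1 + 2 * ν) z

/-- The derivative of `whittakerRCore`. -/
def whittakerRCore' (κ ν z : ℂ) : ℂ :=
  exp (-z / 2) * ((ν - κ + 1 / 2) * regKummer (ν - κ + 1 / 2 + 1) (1 + 2 * ν + 1) z
    - 1 / 2 * regKummer (ν - κ + 1 / 2) (1 + 2 * ν) z)

lemma continuous_regKummer_right (a b : ℂ) : Continuous (regKummer a b) :=
  continuous_iff_continuousAt.2 fun z => (hasDerivAt_regKummer a b z).continuousAt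

lemma continuous_whittakerRCore (κ ν : ℂ) : Continuous (whittakerRCore κ ν) := by
  have := continuous_regKummer_right (ν - κ + 1 / 2) (1 + 2 * ν)
  unfold whittakerRCore
  fun_prop

lemma continuous_whittakerRCore' (κ ν : ℂ) : Continuous (whittakerRCore' κ ν) := by
  have := continuous_regKummer_right (ν - κ + 1 / 2) (1 + 2 * ν)
  have := continuous_regKummer_right (ν - κ + 1 / 2 + 1) (1 + 2 * ν + 1)
  unfold whittakerRCore'
  fun_prop

lemma whittakerR_eq_core (κ ν w : ℂ) :
    whittakerR κ ν w = exp ((ν + 1 / 2) * w) * whittakerRCore κ ν (exp w) := by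
  unfold whittakerR whittakerRCore; ring

lemma whittakerR'_eq_core (κ ν w : ℂ) :
    whittakerR' κ ν w = exp ((ν + 1 / 2) * w) *
      ((ν + 1 / 2) * whittakerRCore κ ν (exp w) + exp w * whittakerRCore' κ ν (exp w)) := by
  unfold whittakerR' whittakerRCore whittakerRCore'; ring

lemma whittakerRCore_zero (κ ν : ℂ) : whittakerRCore κ ν 0 = (Gamma (1 + 2 * ν))⁻¹ := by
  simp [whittakerRCore, regKummer_zero]

lemma inv_Gamma_mul_inv_Gamma_one_sub (z : ℂ) :
    (Gamma z)⁻¹ * (Gamma (1 - z))⁻¹ = sin (Real.pi * z) / Real.pi := by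
  rw [← mul_inv, Gamma_mul_Gamma_one_sub, inv_div]

lemma two_mul_inv_Gamma_mul_inv_Gamma (ν : ℂ) :
    2 * ν * ((Gamma (1 + 2 * ν))⁻¹ * (Gamma (1 + 2 * -ν))⁻¹) = sin (2 * Real.pi * ν) / Real.pi := by
  have h1 := inv_Gamma_mul_inv_Gamma_one_sub (2 * ν)
  rw [one_div_Gamma_eq_self_mul_one_div_Gamma_add_one (2 * ν)] at h1
  rw [show 2 * (Real.pi : ℂ) * ν = Real.pi * (2 * ν) by ring, ← h1,
    show 1 + 2 * ν = 2 * ν + 1 by ring, show 1 + 2 * -ν = 1 - 2 * ν by ring]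
  ring

lemma whittakerR_wronskian (κ ν w : ℂ) :
    exp (-w) * (whittakerR κ ν w * whittakerR' κ (-ν) w - whittakerR' κ ν w * whittakerR κ (-ν) w)
      = -(sin (2 * Real.pi * ν) / Real.pi) := by
  rw [(isWhittakerSol_whittakerR κ ν).wronskian_of_exponents
    (isWhittakerSol_whittakerR κ (-ν)).neg_param (continuous_whittakerRCore κ ν)
    (continuous_whittakerRCore' κ ν) (continuous_whittakerRCore κ (-ν))
    (continuous_whittakerRCore' κ (-ν)) (whittakerR_eq_core κ ν) (whittakerR'_eq_core κ ν)
    (whittakerR_eq_core κ (-ν)) (whittakerR'_eq_core κ (-ν)) w, whittakerRCore_zero,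
    whittakerRCore_zero, ← two_mul_inv_Gamma_mul_inv_Gamma]
  ring

lemma whittakerR_wronskian_rotate (κ ν w : ℂ) :
    exp (-w) * (whittakerR κ ν w * whittakerR' (-κ) (-ν) (w + Real.pi * I)
      - whittakerR' κ ν w * whittakerR (-κ) (-ν) (w + Real.pi * I))
      = -(exp ((-ν + 1 / 2) * (Real.pi * I)) * (sin (2 * Real.pi * ν) / Real.pi)) := by
  have he : ∀ w, exp (w + Real.pi * I) = -exp w := fun w => by
    rw [exp_add, exp_pi_mul_I]; ring
  have he' : ∀ w : ℂ, exp ((-ν + 1 / 2) * (w + Real.pi * I))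
      = exp ((-ν + 1 / 2) * w) * exp ((-ν + 1 / 2) * (Real.pi * I)) := fun w => by
    rw [← exp_add]; ring_nf
  rw [(isWhittakerSol_whittakerR κ ν).wronskian_of_exponents
    (isWhittakerSol_whittakerR (-κ) (-ν)).neg_param.rotate (continuous_whittakerRCore κ ν)
    (continuous_whittakerRCore' κ ν)
    (C := fun z => exp ((-ν + 1 / 2) * (Real.pi * I)) * whittakerRCore (-κ) (-ν) (-z))
    (D := fun z => -exp ((-ν + 1 / 2) * (Real.pi * I)) * whittakerRCore' (-κ) (-ν) (-z))
    (continuous_const.mul ((continuous_whittakerRCore (-κ) (-ν)).comp continuous_neg))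
    (continuous_const.mul ((continuous_whittakerRCore' (-κ) (-ν)).comp continuous_neg))
    (whittakerR_eq_core κ ν) (whittakerR'_eq_core κ ν)
    (fun w => by rw [whittakerR_eq_core, he, he']; ring)
    (fun w => by rw [whittakerR'_eq_core, he, he']; ring) w]
  rw [neg_zero, whittakerRCore_zero, whittakerRCore_zero, ← two_mul_inv_Gamma_mul_inv_Gamma]
  ring

/-- Translation by `2πi` multiplies both solutions by the same factor `E`, so the constant Wronskian
equals `E²` times itself. Here `E² = e^{4πiν} ≠ 1` because `sin(2πν) ≠ 0`. -/
lemma whittakerR_wronskian_rotate_self (κ : ℂ) {ν : ℂ} (hν : sin (2 * Real.pi * ν) ≠ 0) (w : ℂ) :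
    exp (-w) * (whittakerR κ ν w * whittakerR' (-κ) ν (w + Real.pi * I)
      - whittakerR' κ ν w * whittakerR (-κ) ν (w + Real.pi * I)) = 0 := by
  have hper : ∀ w, exp (w + 2 * Real.pi * I) = exp w := exp_periodic
  have e1 : ∀ κ w, whittakerR κ ν (w + 2 * Real.pi * I)
      = exp ((ν + 1 / 2) * (2 * Real.pi * I)) * whittakerR κ ν w := fun κ w => by
    rw [whittakerR_eq_core, whittakerR_eq_core, hper, mul_add, exp_add]; ring
  have e2 : ∀ κ w, whittakerR' κ ν (w + 2 * Real.pi * I)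
      = exp ((ν + 1 / 2) * (2 * Real.pi * I)) * whittakerR' κ ν w := fun κ w => by
    rw [whittakerR'_eq_core, whittakerR'_eq_core, hper, mul_add (ν + 1 / 2) w, exp_add]; ring
  have hc := (isWhittakerSol_whittakerR κ ν).wronskian_const
    (isWhittakerSol_whittakerR (-κ) ν).rotate (w + 2 * Real.pi * I) w
  have h3 : exp (-(w + 2 * Real.pi * I)) = exp (-w) := by rw [exp_neg, exp_neg, hper]
  rw [show w + 2 * Real.pi * I + Real.pi * I = w + Real.pi * I + 2 * Real.pi * I by ring,
    e1, e2, e1, e2, h3] at hc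
  set E := exp ((ν + 1 / 2) * (2 * Real.pi * I)) with hE
  have hE2 : E ^ 2 - 1 ≠ 0 := by
    intro h
    apply hν
    have h4 : E ^ 2 = exp (2 * (2 * Real.pi * ν * I)) := by
      rw [hE, ← exp_nat_mul, ← hper (2 * (2 * Real.pi * ν * I))]
      congr 1
      push_cast
      ring
    rw [h4, sub_eq_zero] at h
    have h5 : exp (2 * Real.pi * ν * I) * exp (2 * Real.pi * ν * I) = 1 := by
      rw [← exp_add, ← h]; ring_nf
    have h6 : exp (-(2 * Real.pi * ν) * I) * exp (2 * Real.pi * ν * I) = 1 := by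
      rw [← exp_add, exp_eq_one_iff]; exact ⟨0, by push_cast; ring⟩
    have h7 : exp (-(2 * Real.pi * ν) * I) = exp (2 * Real.pi * ν * I) :=
      mul_right_cancel₀ (exp_ne_zero _) (h6.trans h5.symm)
    rw [Complex.sin, h7]; ring
  refine (mul_eq_zero.1 ?_).resolve_left hE2
  linear_combination hc

/-- Bilinear expansion gives four Wronskians. Those with equal exponents vanish, and the reflection
formula turns the Gamma factors of the other two into cosines. The answer does not depend on `ν`,
hence survives passage to the exceptional parameters. -/
lemma whittakerWGen_wronskian (κ : ℂ) {ν : ℂ} (hν : sin (2 * Real.pi * ν) ≠ 0) (w : ℂ) :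
    exp (-w) * (whittakerWGen κ ν w * whittakerWGen' (-κ) ν (w + Real.pi * I)
      - whittakerWGen' κ ν w * whittakerWGen (-κ) ν (w + Real.pi * I)) = exp (-Real.pi * I * κ) := by
  have h1 := whittakerR_wronskian_rotate κ ν w
  have h2 := whittakerR_wronskian_rotate κ (-ν) w
  have h3 := whittakerR_wronskian_rotate_self κ hν w
  have h4 := whittakerR_wronskian_rotate_self κ (ν := -ν)
    (by rw [mul_neg, sin_neg]; exact neg_ne_zero.2 hν) w
  rw [neg_neg, mul_neg, sin_neg] at h2
  have g1 := inv_Gamma_mul_inv_Gamma_one_sub (1 / 2 + ν + κ)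
  have g2 := inv_Gamma_mul_inv_Gamma_one_sub (1 / 2 + ν - κ)
  rw [show 1 - (1 / 2 + ν + κ) = 1 / 2 - ν - κ by ring,
    show (Real.pi : ℂ) * (1 / 2 + ν + κ) = Real.pi * (ν + κ) + Real.pi / 2 by ring,
    sin_add_pi_div_two] at g1
  rw [show 1 - (1 / 2 + ν - κ) = 1 / 2 - ν + κ by ring,
    show (Real.pi : ℂ) * (1 / 2 + ν - κ) = Real.pi * (ν - κ) + Real.pi / 2 by ring,
    sin_add_pi_div_two] at g2
  have hpi : (Real.pi : ℂ) ≠ 0 := by exact_mod_cast Real.pi_ne_zero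
  have key : exp ((ν + 1 / 2) * (Real.pi * I)) * cos (Real.pi * (ν - κ))
      - exp ((-ν + 1 / 2) * (Real.pi * I)) * cos (Real.pi * (ν + κ))
      = -(exp (-Real.pi * I * κ) * sin (2 * Real.pi * ν)) := by
    have i1 : exp ((ν + 1 / 2) * (Real.pi * I)) = I * exp (Real.pi * ν * I) := by
      rw [show (ν + 1 / 2) * (Real.pi * I) = Real.pi / 2 * I + Real.pi * ν * I by ring, exp_add,
        exp_pi_div_two_mul_I]
    have i2 : exp ((-ν + 1 / 2) * (Real.pi * I)) = I * exp (-(Real.pi * ν * I)) := by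
      rw [show (-ν + 1 / 2) * (Real.pi * I) = Real.pi / 2 * I + -(Real.pi * ν * I) by ring, exp_add,
        exp_pi_div_two_mul_I]
    rw [i1, i2, Complex.cos, Complex.cos, Complex.sin]
    have j1 : exp (Real.pi * (ν - κ) * I) = exp (Real.pi * ν * I) * exp (-Real.pi * I * κ) := by
      rw [← exp_add]; ring_nf
    have j2 : exp (-(Real.pi * (ν - κ)) * I)
        = exp (-(Real.pi * ν * I)) * exp (Real.pi * I * κ) := by
      rw [← exp_add]; ring_nf
    have j3 : exp (Real.pi * (ν + κ) * I) = exp (Real.pi * ν * I) * exp (Real.pi * I * κ) := by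
      rw [← exp_add]; ring_nf
    have j4 : exp (-(Real.pi * (ν + κ)) * I)
        = exp (-(Real.pi * ν * I)) * exp (-Real.pi * I * κ) := by
      rw [← exp_add]; ring_nf
    have j5 : exp (-(2 * Real.pi * ν) * I) = exp (-(Real.pi * ν * I)) ^ 2 := by
      rw [← exp_nat_mul]; push_cast; ring_nf
    have j6 : exp (2 * Real.pi * ν * I) = exp (Real.pi * ν * I) ^ 2 := by
      rw [← exp_nat_mul]; push_cast; ring_nf
    rw [j1, j2, j3, j4, j5, j6]
    ring
  unfold whittakerWGen whittakerWGen' whittakerB whittakerB'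
  simp only [sub_neg_eq_add]
  set σ : ℂ := -Real.pi / sin (2 * Real.pi * ν) with hσ
  have hσ1 : σ ^ 2 * (sin (2 * Real.pi * ν) / Real.pi * (sin (2 * Real.pi * ν) / Real.pi)) = 1 := by
    rw [hσ]
    generalize sin (2 * Real.pi * ν) = S at hν
    field_simp
  have hmain : σ ^ 2 * ((Gamma (1 / 2 - ν - κ))⁻¹ * (Gamma (1 / 2 + ν + κ))⁻¹ *
      (exp ((-ν + 1 / 2) * (Real.pi * I)) * (sin (2 * Real.pi * ν) / Real.pi))
      - (Gamma (1 / 2 + ν - κ))⁻¹ * (Gamma (1 / 2 - ν + κ))⁻¹ *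
      (exp ((ν + 1 / 2) * (Real.pi * I)) * (sin (2 * Real.pi * ν) / Real.pi)))
      = exp (-Real.pi * I * κ) := by
    rw [g2, mul_comm (Gamma (1 / 2 - ν - κ))⁻¹, g1]
    linear_combination (-σ ^ 2 * (sin (2 * Real.pi * ν) / Real.pi) / Real.pi) * key +
      exp (-Real.pi * I * κ) * hσ1
  rw [← hmain]
  linear_combination
    σ ^ 2 * (Gamma (1 / 2 - ν - κ))⁻¹ * (Gamma (1 / 2 - ν + κ))⁻¹ * h3
    - σ ^ 2 * (Gamma (1 / 2 - ν - κ))⁻¹ * (Gamma (1 / 2 + ν + κ))⁻¹ * h1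
    - σ ^ 2 * (Gamma (1 / 2 + ν - κ))⁻¹ * (Gamma (1 / 2 - ν + κ))⁻¹ * h2
    + σ ^ 2 * (Gamma (1 / 2 + ν - κ))⁻¹ * (Gamma (1 / 2 + ν + κ))⁻¹ * h4

/-- Near `μ` the `w`-derivative is a Cauchy integral of the derivative of the explicit formula, and
such an integral is analytic in the parameter inside the circle. -/
lemma continuousAt_deriv_whittakerWLog (κ μ w : ℂ) :
    ContinuousAt (fun ν => deriv (whittakerWLog κ ν) w) μ := by
  obtain ⟨r, hr, hs⟩ := exists_sphere_sin_param_ne_zero μ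
  have hg := continuousOn_whittakerWGen (κ := κ) hs
  have hg' := continuousOn_whittakerWGen' (κ := κ) hs
  set R : NNReal := ⟨r, hr.le⟩
  have hd : ∀ ν ∈ Metric.ball μ r, HasDerivAt (whittakerWLog κ ν)
      ((2 * Real.pi * I : ℂ)⁻¹ • ∮ ζ in C(μ, r), (ζ - ν)⁻¹ • whittakerWGen' κ ζ w) w := by
    intro ν hν
    have hW : whittakerWLog κ ν = fun w =>
        (2 * Real.pi * I : ℂ)⁻¹ • ∮ ζ in C(μ, r), (ζ - ν)⁻¹ • whittakerWGen κ ζ w := by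
      ext w
      have := (differentiable_whittakerWLog_param κ w).diffContOnCl
        |>.circleIntegral_sub_inv_smul (c := μ) (R := r) hν
      rw [eq_inv_smul_iff₀ two_pi_I_ne_zero, ← this]
      exact circleIntegral.integral_congr hr.le fun ζ hζ => by
        simp only [whittakerWLog_eq_gen (hs ζ hζ)]
    have hp : ContinuousOn (fun q : ℂ × ℂ => (q.1 - ν)⁻¹) (Metric.sphere μ r ×ˢ Set.univ) := by
      refine ContinuousOn.inv₀ (by fun_prop) fun q hq h => ?_
      rw [sub_eq_zero] at h
      have h1 := hq.1
      rw [h, Metric.mem_sphere] at h1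
      rw [Metric.mem_ball] at hν
      linarith
    rw [hW]
    exact (hasDerivAt_circleIntegral (f := fun ζ w => (ζ - ν)⁻¹ • whittakerWGen κ ζ w)
      (f' := fun ζ w => (ζ - ν)⁻¹ • whittakerWGen' κ ζ w) hr.le (hp.smul hg) (hp.smul hg')
      (fun ζ _ w => (isWhittakerSol_whittakerWGen κ ζ w).1.const_mul _) w).fun_const_smul _
  have ci : CircleIntegrable (fun ζ => whittakerWGen' κ ζ w) μ R :=
    (hg'.comp (f := fun ζ : ℂ => (ζ, w)) (by fun_prop : Continuous fun ζ : ℂ => (ζ, w)).continuousOn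
      fun ζ hζ => ⟨hζ, trivial⟩).circleIntegrable hr.le
  have hcont := ((hasFPowerSeriesOn_cauchy_integral ci (by exact hr)).analyticAt).continuousAt
  refine hcont.congr ?_
  filter_upwards [Metric.ball_mem_nhds μ hr] with ν hν
  exact (hd ν hν).deriv.symm

/-- The Wronskian of `W_{κ,μ}(z)` and `W_{-κ,μ}(z e^{π i})` in the variable `log z`. -/
theorem whittakerWLog_wronskian (κ μ w : ℂ) :
    exp (-w) * (whittakerWLog κ μ w * deriv (whittakerWLog (-κ) μ) (w + Real.pi * I)
      - deriv (whittakerWLog κ μ) w * whittakerWLog (-κ) μ (w + Real.pi * I))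
      = exp (-Real.pi * I * κ) := by
  set F : ℂ → ℂ := fun μ => exp (-w) *
    (whittakerWLog κ μ w * deriv (whittakerWLog (-κ) μ) (w + Real.pi * I)
      - deriv (whittakerWLog κ μ) w * whittakerWLog (-κ) μ (w + Real.pi * I))
  have hF : ContinuousAt F μ := by
    have h1 := (differentiable_whittakerWLog_param κ w).continuous.continuousAt (x := μ)
    have h2 := (differentiable_whittakerWLog_param (-κ) (w + Real.pi * I)).continuous.continuousAt
      (x := μ)
    have h3 := continuousAt_deriv_whittakerWLog κ μ w
    have h4 := continuousAt_deriv_whittakerWLog (-κ) μ (w + Real.pi * I)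
    exact continuousAt_const.mul ((h1.mul h4).sub (h3.mul h2))
  have hev : ∀ᶠ ν in 𝓝[≠] μ, exp (-Real.pi * I * κ) = F ν := by
    filter_upwards [eventually_sin_param_ne_zero μ] with ν hν
    have e : ∀ κ, whittakerWLog κ ν = whittakerWGen κ ν := fun κ =>
      funext fun w => whittakerWLog_eq_gen hν κ w
    simp only [F, e]
    rw [(isWhittakerSol_whittakerWGen _ ν _).1.deriv, (isWhittakerSol_whittakerWGen _ ν _).1.deriv,
      whittakerWGen_wronskian κ hν]
  exact tendsto_nhds_unique (hF.tendsto.mono_left nhdsWithin_le_nhds)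
    ((tendsto_congr' hev).1 tendsto_const_nhds)

/-! ### Second order linear equations on the real line -/

/-- `g' = dg/dt` and `g'' - g' + q g = r` on `ℝ`. -/
def IsLinearSol (q r g g' : ℝ → ℂ) : Prop :=
  ∀ t, HasDerivAt g (g' t) t ∧ HasDerivAt g' (g' t - q t * g t + r t) t

lemma IsLinearSol.wronskian_const {q g g' f f' : ℝ → ℂ} (hg : IsLinearSol q 0 g g')
    (hf : IsLinearSol q 0 f f') (t s : ℝ) :
    exp (-t) * (g t * f' t - g' t * f t) = exp (-s) * (g s * f' s - g' s * f s) := by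
  have hd : ∀ t : ℝ, HasDerivAt (fun t : ℝ => exp (-t) * (g t * f' t - g' t * f t)) 0 t := by
    intro t
    have he : HasDerivAt (fun t : ℝ => exp (-t)) (exp (-t) * (-1)) t :=
      (hasDerivAt_neg (t : ℂ)).cexp.comp_ofReal
    refine (he.mul (((hg t).1.mul (hf t).2).sub ((hg t).2.mul (hf t).1))).congr_deriv ?_
    simp only [Pi.mul_apply, Pi.sub_apply, Pi.zero_apply]
    ring
  exact is_const_of_deriv_eq_zero (fun t => (hd t).differentiableAt) (fun t => (hd t).deriv) t s

/-- Two solutions with nonzero Wronskian span the solutions. -/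
lemma IsLinearSol.exists_combination {q g g' f f' h h' : ℝ → ℂ} (hg : IsLinearSol q 0 g g')
    (hf : IsLinearSol q 0 f f') (hh : IsLinearSol q 0 h h') {W : ℂ} (hW : W ≠ 0)
    (hwr : ∀ t : ℝ, exp (-t) * (g t * f' t - g' t * f t) = W) :
    ∃ α β : ℂ, ∀ t, h t = α * g t + β * f t := by
  refine ⟨exp (-(0 : ℝ)) * (h 0 * f' 0 - h' 0 * f 0) / W,
    -(exp (-(0 : ℝ)) * (h 0 * g' 0 - h' 0 * g 0)) / W, fun t => ?_⟩
  -- Cramer's rule: the coefficients are Wronskians of `h` with the two solutions, constant in `t`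
  -- and so evaluable at the current point.
  rw [← hh.wronskian_const hf t 0, ← hh.wronskian_const hg t 0]
  rw [div_mul_eq_mul_div, div_mul_eq_mul_div, ← add_div, eq_div_iff hW, ← hwr t]
  ring

lemma IsWhittakerSol.real {κ ν : ℂ} {g g' : ℂ → ℂ} (hg : IsWhittakerSol κ ν g g') :
    IsLinearSol (fun t => 1 / 4 - ν ^ 2 + κ * exp t - exp t ^ 2 / 4) 0 (fun t => g t)
      (fun t => g' t) := fun t =>
  ⟨(hg t).1.comp_ofReal, (hg t).2.comp_ofReal.congr_deriv (by simp)⟩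

section

open MeasureTheory Set

/-! ### The integral representation of Tricomi's function -/

/-- The integrand of `kummerI`. -/
def kummerIntegrand (a a' : ℂ) (y t : ℝ) : ℂ :=
  (t : ℂ) ^ (a - 1) * (1 + t : ℂ) ^ (-a') * exp (-(y * t))

/-- `Γ(a) U(a, a - a' + 1, y)` as a Laplace integral. -/
def kummerI (a a' : ℂ) (y : ℝ) : ℂ := ∫ t in Ioi (0 : ℝ), kummerIntegrand a a' y t

lemma measurable_kummerIntegrand (a a' : ℂ) (y : ℝ) : Measurable (kummerIntegrand a a' y) := by
  unfold kummerIntegrand; fun_prop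

lemma norm_one_add_cpow_neg_le {a' : ℂ} (ha' : 0 < a'.re) {t : ℝ} (ht : 0 < t) :
    ‖(1 + t : ℂ) ^ (-a')‖ ≤ 1 := by
  rw [show (1 + t : ℂ) = ((1 + t : ℝ) : ℂ) by push_cast; rfl,
    norm_cpow_eq_rpow_re_of_pos (by linarith)]
  exact Real.rpow_le_one_of_one_le_of_nonpos (by linarith) (by simpa using ha'.le)

lemma norm_kummerIntegrand_le {a a' : ℂ} (ha' : 0 < a'.re) (y : ℝ) {t : ℝ} (ht : 0 < t) :
    ‖kummerIntegrand a a' y t‖ ≤ t ^ (a.re - 1) * Real.exp (-(y * t)) := by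
  unfold kummerIntegrand
  rw [norm_mul, norm_mul, norm_cpow_eq_rpow_re_of_pos ht, sub_re, one_re, norm_exp]
  have h1 := norm_one_add_cpow_neg_le ha' ht
  have h2 : (-((y : ℂ) * t)).re = -(y * t) := by simp
  rw [h2]
  have h3 : 0 ≤ t ^ (a.re - 1) := Real.rpow_nonneg ht.le _
  exact mul_le_mul_of_nonneg_right (mul_le_of_le_one_right h3 h1) (Real.exp_nonneg _)

lemma integrableOn_rpow_mul_exp {s y : ℝ} (hs : 0 < s) (hy : 0 < y) :
    IntegrableOn (fun t => t ^ (s - 1) * Real.exp (-(y * t))) (Ioi 0) := by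
  have := integrableOn_rpow_mul_exp_neg_mul_rpow (p := 1) (s := s - 1) (b := y) (by linarith)
    one_pos hy
  simpa [neg_mul] using this

lemma integrableOn_kummerIntegrand {a a' : ℂ} (ha : 0 < a.re) (ha' : 0 < a'.re) {y : ℝ}
    (hy : 0 < y) : IntegrableOn (kummerIntegrand a a' y) (Ioi 0) := by
  refine (integrableOn_rpow_mul_exp ha hy).mono'
    (measurable_kummerIntegrand a a' y).aestronglyMeasurable ?_
  filter_upwards [ae_restrict_mem measurableSet_Ioi] with t ht
  exact norm_kummerIntegrand_le ha' y ht

lemma norm_kummerI_le {a a' : ℂ} (ha : 0 < a.re) (ha' : 0 < a'.re) {y : ℝ} (hy : 1 ≤ y) :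
    ‖kummerI a a' y‖ ≤ Real.Gamma a.re := by
  have hy0 : 0 < y := by linarith
  have h1 : ‖kummerI a a' y‖ ≤ ∫ t in Ioi (0 : ℝ), t ^ (a.re - 1) * Real.exp (-(y * t)) := by
    refine norm_integral_le_of_norm_le (integrableOn_rpow_mul_exp ha hy0) ?_
    filter_upwards [ae_restrict_mem measurableSet_Ioi] with t ht
    exact norm_kummerIntegrand_le ha' y ht
  rw [Real.integral_rpow_mul_exp_neg_mul_Ioi ha hy0] at h1
  refine h1.trans (mul_le_of_le_one_left (Real.Gamma_pos_of_pos ha).le ?_)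
  refine Real.rpow_le_one (by positivity) ?_ ha.le
  rw [div_le_one hy0]; exact hy

lemma kummerIntegrand_add_one (a a' : ℂ) (y : ℝ) {t : ℝ} (ht : 0 < t) :
    kummerIntegrand (a + 1) a' y t = t * kummerIntegrand a a' y t := by
  have ht0 : (t : ℂ) ≠ 0 := by exact_mod_cast ht.ne'
  unfold kummerIntegrand
  rw [show a + 1 - 1 = (a - 1) + 1 by ring, cpow_add _ _ ht0, cpow_one]
  ring

/-- Differentiation under the integral sign, dominated on the half-line `v > y/2` by the integrand
with decay rate `y/2`. -/
lemma hasDerivAt_kummerI {a a' : ℂ} (ha : 0 < a.re) (ha' : 0 < a'.re) {y : ℝ} (hy : 0 < y) :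
    HasDerivAt (kummerI a a') (-kummerI (a + 1) a' y) y := by
  have hb : IntegrableOn (fun t : ℝ => t ^ ((a + 1).re - 1) * Real.exp (-(y / 2 * t))) (Ioi 0) :=
    integrableOn_rpow_mul_exp (by simp; linarith) (by linarith)
  have hs : Ioi (y / 2) ∈ 𝓝 y := Ioi_mem_nhds (by linarith)
  have h := (hasDerivAt_integral_of_dominated_loc_of_deriv_le (μ := volume.restrict (Ioi 0))
    (F := fun y t => kummerIntegrand a a' y t) (F' := fun y t => -kummerIntegrand (a + 1) a' y t)
    (x₀ := y) hs
    (Eventually.of_forall fun v => (measurable_kummerIntegrand a a' v).aestronglyMeasurable)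
    (integrableOn_kummerIntegrand ha ha' hy)
    (measurable_kummerIntegrand (a + 1) a' y).neg.aestronglyMeasurable ?_ hb ?_).2
  · rwa [integral_neg] at h
  · filter_upwards [ae_restrict_mem measurableSet_Ioi] with t ht v hv
    rw [norm_neg]
    refine (norm_kummerIntegrand_le ha' v ht).trans ?_
    have ht' : 0 < t := ht
    have hv' : y / 2 < v := hv
    refine mul_le_mul_of_nonneg_left (Real.exp_le_exp.2 ?_) (Real.rpow_nonneg ht'.le _)
    nlinarith
  · filter_upwards [ae_restrict_mem measurableSet_Ioi] with t ht v _
    rw [kummerIntegrand_add_one a a' v ht]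
    unfold kummerIntegrand
    have he : HasDerivAt (fun v : ℝ => exp (-((v : ℂ) * t))) (exp (-((v : ℂ) * t)) * (-(1 * t))) v :=
      (((hasDerivAt_id (v : ℂ)).mul_const (t : ℂ)).neg.cexp).comp_ofReal
    refine (he.const_mul _).congr_deriv ?_
    ring

lemma hasDerivAt_ofReal_cpow {t : ℝ} (ht : 0 < t) (s : ℂ) :
    HasDerivAt (fun t : ℝ => (t : ℂ) ^ s) (s * (t : ℂ) ^ (s - 1)) t := by
  have := ((hasDerivAt_id (t : ℂ)).cpow_const (c := s)
    (by simp [slitPlane, ht])).comp_ofReal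
  simpa using this

lemma kummerI_ode {a a' : ℂ} (ha : 0 < a.re) (ha' : 0 < a'.re) {y : ℝ} (hy : 0 < y) :
    y * kummerI (a + 2) a' y - (a - a' + 1 - y) * kummerI (a + 1) a' y - a * kummerI a a' y = 0 := by
  -- The integrand of the equation is, up to sign, the derivative of this `f`. The boundary terms
  -- vanish: `Re a > 0` at `0`, exponential decay at infinity.
  set f : ℝ → ℂ := fun t => (t : ℂ) ^ a * (1 + t : ℂ) ^ (1 - a') * exp (-(y * t)) with hf
  have i0 := integrableOn_kummerIntegrand ha ha' hy
  have i1 := integrableOn_kummerIntegrand (a := a + 1) (by simp; linarith) ha' hy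
  have i2 := integrableOn_kummerIntegrand (a := a + 2) (by simp; linarith) ha' hy
  have hd : ∀ t ∈ Ioi (0 : ℝ), HasDerivAt f (a * kummerIntegrand a a' y t
      + (a - a' + 1 - y) * kummerIntegrand (a + 1) a' y t - y * kummerIntegrand (a + 2) a' y t) t := by
    intro t ht
    have ht' : 0 < t := ht
    have ht0 : (t : ℂ) ≠ 0 := by exact_mod_cast ht'.ne'
    have ht1 : (1 + t : ℂ) ≠ 0 := by
      have : (1 + t : ℝ) ≠ 0 := by linarith
      exact_mod_cast this
    have h1 := hasDerivAt_ofReal_cpow ht' a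
    have h2 : HasDerivAt (fun t : ℝ => (1 + t : ℂ) ^ (1 - a'))
        ((1 - a') * (1 + t : ℂ) ^ (-a')) t := by
      have h := (((hasDerivAt_id (t : ℂ)).const_add 1).cpow_const (c := 1 - a')
        (by left; simp; linarith)).comp_ofReal
      refine h.congr_deriv ?_
      rw [show 1 - a' - 1 = -a' by ring]
      simp
    have h3 : HasDerivAt (fun t : ℝ => exp (-((y : ℂ) * t)))
        (exp (-((y : ℂ) * t)) * (-((y : ℂ) * 1))) t :=
      (((hasDerivAt_id (t : ℂ)).const_mul (y : ℂ)).neg.cexp).comp_ofReal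
    refine ((h1.mul h2).mul h3).congr_deriv ?_
    rw [show a + 2 = a + 1 + 1 by ring, kummerIntegrand_add_one (a + 1) _ _ ht',
      kummerIntegrand_add_one a _ _ ht']
    unfold kummerIntegrand
    have e1 : (t : ℂ) ^ a = t * (t : ℂ) ^ (a - 1) := by
      conv_lhs => rw [show a = (a - 1) + 1 by ring, cpow_add _ _ ht0, cpow_one]
      ring
    have e2 : (1 + t : ℂ) ^ (1 - a') = (1 + t) * (1 + t : ℂ) ^ (-a') := by
      rw [sub_eq_add_neg, cpow_add _ _ ht1, cpow_one]
    simp only [Pi.mul_apply]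
    rw [e1, e2]
    ring
  have hcont : ContinuousWithinAt f (Ici 0) 0 := by
    have h1 : Continuous fun t : ℝ => (t : ℂ) ^ a := continuous_ofReal_cpow_const ha
    have h2 : ContinuousAt (fun t : ℝ => (1 + t : ℂ) ^ (1 - a')) 0 :=
      ContinuousAt.cpow (by fun_prop) (by fun_prop) (by simp)
    exact ((h1.continuousAt.mul h2).mul (by fun_prop)).continuousWithinAt
  have hlim : Tendsto f atTop (𝓝 0) := by
    rw [tendsto_zero_iff_norm_tendsto_zero]
    have l1 := tendsto_rpow_mul_exp_neg_mul_atTop_nhds_zero a.re y hy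
    have l2 := tendsto_rpow_mul_exp_neg_mul_atTop_nhds_zero (a.re + 1) y hy
    have l3 := l1.add l2
    rw [add_zero] at l3
    refine squeeze_zero' (Eventually.of_forall fun t => norm_nonneg _) ?_ l3
    filter_upwards [eventually_gt_atTop 0] with t ht
    have ht1 : (1 + t : ℂ) ≠ 0 := by
      have : (1 + t : ℝ) ≠ 0 := by linarith
      exact_mod_cast this
    simp only [hf]
    rw [sub_eq_add_neg, cpow_add _ _ ht1, cpow_one, norm_mul, norm_mul, norm_mul,
      norm_cpow_eq_rpow_re_of_pos ht, norm_exp, Real.rpow_add_one ht.ne']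
    have h1 := norm_one_add_cpow_neg_le ha' ht
    have h2 : (-((y : ℂ) * t)).re = -y * t := by simp
    have h3 : ‖(1 + t : ℂ)‖ = 1 + t := by
      rw [show (1 + t : ℂ) = ((1 + t : ℝ) : ℂ) by push_cast; rfl, norm_real]
      exact abs_of_pos (by linarith)
    rw [h2, h3]
    have h4 : 0 ≤ t ^ a.re := Real.rpow_nonneg ht.le _
    calc _ ≤ t ^ a.re * ((1 + t) * 1) * Real.exp (-y * t) := by gcongr
      _ = _ := by ring
  have hint : IntegrableOn (fun t => a * kummerIntegrand a a' y t
      + (a - a' + 1 - y) * kummerIntegrand (a + 1) a' y t - y * kummerIntegrand (a + 2) a' y t)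
      (Ioi 0) := ((i0.const_mul a).add (i1.const_mul _)).sub (i2.const_mul _)
  have h := integral_Ioi_of_hasDerivAt_of_tendsto hcont hd hint hlim
  have hf0 : f 0 = 0 := by
    have : a ≠ 0 := by rintro rfl; simp at ha
    simp [hf, zero_cpow this]
  rw [integral_sub ((i0.const_mul a).fun_add (i1.const_mul _)) (i2.const_mul _),
    integral_add (i0.const_mul a) (i1.const_mul _), integral_const_mul, integral_const_mul,
    integral_const_mul, hf0] at h
  unfold kummerI
  linear_combination -h

/-! ### Kummer's symmetry and the behaviour at the origin -/

/-- The second form of the integral. -/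
def kummerJ (a a' : ℂ) (y : ℝ) : ℂ :=
  ∫ x in Ioi (0 : ℝ), (x : ℂ) ^ (a' - 1) * (y + x : ℂ) ^ (-a) * exp (-x)

lemma kummerJ_eq {a a' : ℂ} {y : ℝ} (hy : 0 < y) :
    kummerJ a a' y = (y : ℂ) ^ (a' - a) * kummerI a' a y := by
  have hy0 : (y : ℂ) ≠ 0 := by exact_mod_cast hy.ne'
  have h := integral_comp_mul_left_Ioi
    (fun x : ℝ => (x : ℂ) ^ (a' - 1) * (y + x : ℂ) ^ (-a) * exp (-x)) 0 hy
  rw [mul_zero, eq_inv_smul_iff₀ hy.ne'] at h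
  unfold kummerJ kummerI
  rw [← h, ← integral_const_mul, real_smul, ← integral_const_mul]
  refine setIntegral_congr_fun measurableSet_Ioi fun t ht => ?_
  have ht' : (0 : ℝ) < t := ht
  simp only [kummerIntegrand]
  rw [show ((y : ℂ) + (y * t : ℝ)) = (y : ℝ) * ((1 + t : ℝ) : ℂ) by push_cast; ring,
    mul_cpow_ofReal_nonneg hy.le (by linarith), ofReal_mul, mul_cpow_ofReal_nonneg hy.le ht'.le,
    show a' - a = (a' - 1) + (-a) + 1 by ring, cpow_add _ _ hy0, cpow_add _ _ hy0, cpow_one]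
  push_cast
  ring

/-- Writing `Γ(a')(1+t)^{-a'}` as a Gamma integral in `x` gives a double integral. Integrating over
`t` first produces the other form. -/
lemma Gamma_mul_kummerI {a a' : ℂ} (ha : 0 < a.re) (ha' : 0 < a'.re) {y : ℝ} (hy : 0 < y) :
    Gamma a' * kummerI a a' y = Gamma a * kummerJ a a' y := by
  set F : ℝ → ℝ → ℂ := fun t x =>
    ((t : ℂ) ^ (a - 1) * (x : ℂ) ^ (a' - 1)) * exp (-(y * t + (1 + t) * x)) with hF
  have hI : Gamma a' * kummerI a a' y = ∫ t in Ioi (0 : ℝ), ∫ x in Ioi (0 : ℝ), F t x := by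
    unfold kummerI
    rw [← integral_const_mul]
    refine setIntegral_congr_fun measurableSet_Ioi fun t ht => ?_
    have ht' : (0 : ℝ) < 1 + t := by have : (0 : ℝ) < t := ht; linarith
    have h := integral_cpow_mul_exp_neg_mul_Ioi (r := 1 + t) ha' ht'
    have h1 : (1 / ((1 + t : ℝ) : ℂ)) ^ a' = (1 + t : ℂ) ^ (-a') := by
      rw [one_div, inv_cpow _ _ (by rw [arg_ofReal_of_nonneg ht'.le]; exact Real.pi_ne_zero.symm),
        cpow_neg]
      push_cast; rfl
    rw [h1] at h
    have h2 : ∀ x : ℝ, F t x = ((t : ℂ) ^ (a - 1) * exp (-(y * t))) *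
        ((x : ℂ) ^ (a' - 1) * exp (-(((1 + t : ℝ) : ℂ) * x))) := by
      intro x
      simp only [hF]
      rw [neg_add, exp_add]
      push_cast
      ring
    simp only [h2]
    rw [integral_const_mul, h, kummerIntegrand]
    ring
  have hJ : Gamma a * kummerJ a a' y = ∫ x in Ioi (0 : ℝ), ∫ t in Ioi (0 : ℝ), F t x := by
    unfold kummerJ
    rw [← integral_const_mul]
    refine setIntegral_congr_fun measurableSet_Ioi fun x hx => ?_
    have hx' : (0 : ℝ) < y + x := by have : (0 : ℝ) < x := hx; linarith
    have h := integral_cpow_mul_exp_neg_mul_Ioi (r := y + x) ha hx'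
    have h1 : (1 / ((y + x : ℝ) : ℂ)) ^ a = (y + x : ℂ) ^ (-a) := by
      rw [one_div, inv_cpow _ _ (by rw [arg_ofReal_of_nonneg hx'.le]; exact Real.pi_ne_zero.symm),
        cpow_neg]
      push_cast; rfl
    rw [h1] at h
    have h2 : ∀ t : ℝ, F t x = ((x : ℂ) ^ (a' - 1) * exp (-x)) *
        ((t : ℂ) ^ (a - 1) * exp (-(((y + x : ℝ) : ℂ) * t))) := by
      intro t
      simp only [hF]
      rw [show -((y : ℂ) * t + (1 + t) * x) = -x + -(((y + x : ℝ) : ℂ) * t) by push_cast; ring,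
        exp_add]
      ring
    simp only [h2]
    rw [integral_const_mul, h]
    ring
  rw [hI, hJ]
  refine integral_integral_swap ?_
  -- Discarding `e^{-tx} ≤ 1` bounds the integrand by a product of two one-variable integrable
  -- functions, as Fubini requires.
  have g1 := integrableOn_rpow_mul_exp ha hy
  have g2 := integrableOn_rpow_mul_exp ha' one_pos
  refine (g1.mul_prod g2).mono' (by simp only [hF]; unfold Function.uncurry; fun_prop) ?_
  rw [Measure.prod_restrict]
  filter_upwards [ae_restrict_mem (measurableSet_Ioi.prod measurableSet_Ioi)] with p hp
  have hp1 : 0 < p.1 := hp.1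
  have hp2 : 0 < p.2 := hp.2
  simp only [Function.uncurry, hF]
  rw [norm_mul, norm_mul, norm_cpow_eq_rpow_re_of_pos hp1, norm_cpow_eq_rpow_re_of_pos hp2, norm_exp]
  have e1 : (-((y : ℂ) * p.1 + (1 + p.1) * p.2)).re = -(y * p.1) + -(1 * p.2) - p.1 * p.2 := by
    simp; ring
  have e2 : Real.exp (-(y * p.1) + -(1 * p.2) - p.1 * p.2)
      ≤ Real.exp (-(y * p.1)) * Real.exp (-(1 * p.2)) := by
    rw [← Real.exp_add]
    exact Real.exp_le_exp.2 (by nlinarith [mul_pos hp1 hp2])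
  rw [e1, sub_re, sub_re, one_re]
  calc _ ≤ p.1 ^ (a.re - 1) * p.2 ^ (a'.re - 1)
        * (Real.exp (-(y * p.1)) * Real.exp (-(1 * p.2))) :=
        mul_le_mul_of_nonneg_left e2
          (mul_nonneg (Real.rpow_nonneg hp1.le _) (Real.rpow_nonneg hp2.le _))
    _ = _ := by ring

/-- Kummer's symmetry of Tricomi's function. -/
lemma kummerI_symm {a a' : ℂ} (ha : 0 < a.re) (ha' : 0 < a'.re) {y : ℝ} (hy : 0 < y) :
    Gamma a' * kummerI a a' y = Gamma a * ((y : ℂ) ^ (a' - a) * kummerI a' a y) := by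
  rw [Gamma_mul_kummerI ha ha' hy, kummerJ_eq hy]

/-- Dominated convergence, using `(y+x)^{-Re a} ≤ x^{-Re a}`, which is valid because `Re a > 0`. The
limiting integral is Euler's integral for `Γ(a' - a)`. -/
lemma tendsto_kummerJ {a a' : ℂ} (ha : 0 < a.re) (h : a.re < a'.re) :
    Tendsto (kummerJ a a') (𝓝[>] 0) (𝓝 (Gamma (a' - a))) := by
  have hre : 0 < (a' - a).re := by rw [sub_re]; linarith
  rw [Gamma_eq_integral hre, GammaIntegral]
  refine tendsto_integral_filter_of_dominated_convergence
    (fun x => Real.exp (-x) * x ^ ((a' - a).re - 1)) (Eventually.of_forall fun y => ?_) ?_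
    (Real.GammaIntegral_convergent hre) ?_
  · exact (by fun_prop : Measurable fun x : ℝ =>
      (x : ℂ) ^ (a' - 1) * (y + x : ℂ) ^ (-a) * exp (-x)).aestronglyMeasurable
  · filter_upwards [self_mem_nhdsWithin] with y hy
    have hy' : 0 < y := hy
    filter_upwards [ae_restrict_mem measurableSet_Ioi] with x hx
    have hx' : 0 < x := hx
    rw [norm_mul, norm_mul, norm_cpow_eq_rpow_re_of_pos hx', ← ofReal_add,
      norm_cpow_eq_rpow_re_of_pos (by linarith), norm_exp, neg_re, neg_re, ofReal_re, sub_re, sub_re,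
      one_re, mul_comm, show a'.re - a.re - 1 = (a'.re - 1) + -a.re by ring, Real.rpow_add hx']
    refine mul_le_mul_of_nonneg_left (mul_le_mul_of_nonneg_left ?_ (Real.rpow_nonneg hx'.le _))
      (Real.exp_nonneg _)
    exact Real.rpow_le_rpow_of_nonpos hx' (by linarith) (by linarith)
  · filter_upwards [ae_restrict_mem measurableSet_Ioi] with x hx
    have hx' : 0 < x := hx
    have hx0 : (x : ℂ) ≠ 0 := by exact_mod_cast hx'.ne'
    have hc : ContinuousAt (fun y : ℝ => (x : ℂ) ^ (a' - 1) * (y + x : ℂ) ^ (-a) * exp (-x)) 0 := by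
      refine (continuousAt_const.mul (ContinuousAt.cpow (by fun_prop) (by fun_prop) ?_)).mul
        continuousAt_const
      simp [slitPlane, hx']
    have := hc.tendsto.mono_left (nhdsWithin_le_nhds (s := Ioi 0))
    convert this using 2
    rw [ofReal_zero, zero_add, show a' - a - 1 = (a' - 1) + -a by ring, cpow_add _ _ hx0]
    push_cast
    ring

end

/-! ### The integral representation of the Whittaker function -/

/-- `Γ(ν - κ + 1/2) W_{κ,ν}(e^t)` in the range of validity of the integral. -/
def whittakerT (κ ν : ℂ) (t : ℝ) : ℂ :=
  exp (-exp t / 2) * exp ((ν + 1 / 2) * t)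
    * kummerI (ν - κ + 1 / 2) (-ν - κ + 1 / 2) (Real.exp t)

/-- The derivative of `whittakerT`. -/
def whittakerT' (κ ν : ℂ) (t : ℝ) : ℂ :=
  exp (-exp t / 2) * exp ((ν + 1 / 2) * t) *
    ((-exp t / 2 + (ν + 1 / 2)) * kummerI (ν - κ + 1 / 2) (-ν - κ + 1 / 2) (Real.exp t)
      - exp t * kummerI (ν - κ + 1 / 2 + 1) (-ν - κ + 1 / 2) (Real.exp t))

lemma isLinearSol_whittakerT {κ ν : ℂ} (ha : 0 < (ν - κ + 1 / 2).re)
    (ha' : 0 < (-ν - κ + 1 / 2).re) :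
    IsLinearSol (fun t => 1 / 4 - ν ^ 2 + κ * exp t - exp t ^ 2 / 4) 0 (whittakerT κ ν)
      (whittakerT' κ ν) := by
  intro t
  set a := ν - κ + 1 / 2 with hadef
  set a' := -ν - κ + 1 / 2 with hadef'
  have he : HasDerivAt (fun t : ℝ => exp t) (exp t) t := (hasDerivAt_exp (t : ℂ)).comp_ofReal
  have h1 : HasDerivAt (fun t : ℝ => exp (-exp t / 2)) (exp (-exp t / 2) * (-exp t / 2)) t :=
    (((hasDerivAt_exp (t : ℂ)).neg.div_const 2).cexp).comp_ofReal
  have h2 : HasDerivAt (fun t : ℝ => exp ((ν + 1 / 2) * t))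
      (exp ((ν + 1 / 2) * t) * (ν + 1 / 2)) t := by
    simpa using (((hasDerivAt_id (t : ℂ)).const_mul (ν + 1 / 2)).cexp).comp_ofReal
  have h3 : HasDerivAt (fun t => kummerI a a' (Real.exp t))
      (-kummerI (a + 1) a' (Real.exp t) * exp t) t := by
    refine ((hasDerivAt_kummerI ha ha' (Real.exp_pos t)).scomp t (Real.hasDerivAt_exp t)).congr_deriv
      ?_
    rw [real_smul, ofReal_exp]; ring
  have h4 : HasDerivAt (fun t => kummerI (a + 1) a' (Real.exp t))
      (-kummerI (a + 2) a' (Real.exp t) * exp t) t := by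
    refine ((hasDerivAt_kummerI (a := a + 1) (by simp at ha ⊢; linarith) ha'
      (Real.exp_pos t)).scomp t (Real.hasDerivAt_exp t)).congr_deriv ?_
    rw [real_smul, ofReal_exp, show a + 1 + 1 = a + 2 by ring]; ring
  have h5 : HasDerivAt (fun t : ℝ => -exp t / 2 + (ν + 1 / 2)) (-exp t / 2) t :=
    (he.neg.div_const 2).add_const _
  constructor
  · refine ((h1.mul h2).mul h3).congr_deriv ?_
    unfold whittakerT'
    simp only [Pi.mul_apply, ← hadef, ← hadef']
    ring
  · refine ((h1.mul h2).mul ((h5.mul h3).sub (he.mul h4))).congr_deriv ?_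
    have ode := kummerI_ode ha ha' (Real.exp_pos t)
    rw [ofReal_exp] at ode
    unfold whittakerT' whittakerT
    simp only [Pi.mul_apply, Pi.sub_apply, Pi.zero_apply, ← hadef, ← hadef']
    have hb : a - a' + 1 = 1 + 2 * ν := by rw [hadef, hadef']; ring
    rw [hb] at ode
    have hav : a = ν - κ + 1 / 2 := hadef
    linear_combination exp (-exp t / 2) * exp ((ν + 1 / 2) * t) * exp t * ode
      + exp (-exp t / 2) * exp ((ν + 1 / 2) * t) * exp t * kummerI a a' (Real.exp t) * hav

lemma whittakerR_hasDerivAt_real (κ ν : ℂ) (t : ℝ) :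
    HasDerivAt (fun t : ℝ => whittakerR κ ν t) (whittakerR' κ ν t) t :=
  (isWhittakerSol_whittakerR κ ν t).1.comp_ofReal

lemma whittakerR_combination_eq_zero {κ ν c d : ℂ} (hν : sin (2 * Real.pi * ν) ≠ 0)
    (h : ∀ t : ℝ, c * whittakerR κ ν t + d * whittakerR κ (-ν) t = 0) : c = 0 ∧ d = 0 := by
  have h' : c * whittakerR' κ ν (0 : ℝ) + d * whittakerR' κ (-ν) (0 : ℝ) = 0 := by
    have h1 := ((whittakerR_hasDerivAt_real κ ν 0).const_mul c).add
      ((whittakerR_hasDerivAt_real κ (-ν) 0).const_mul d)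
    refine h1.unique ((hasDerivAt_const (0 : ℝ) (0 : ℂ)).congr_of_eventuallyEq ?_)
    exact Eventually.of_forall h
  have hw := whittakerR_wronskian κ ν (0 : ℝ)
  have hne : -(sin (2 * Real.pi * ν) / Real.pi) ≠ 0 :=
    neg_ne_zero.2 (div_ne_zero hν (by exact_mod_cast Real.pi_ne_zero))
  have h0 := h 0
  rw [← hw] at hne
  refine ⟨(mul_eq_zero.1 ?_).resolve_right hne, (mul_eq_zero.1 ?_).resolve_right hne⟩
  · linear_combination exp (-(0 : ℝ)) *
      (whittakerR' κ (-ν) (0 : ℝ) * h0 - whittakerR κ (-ν) (0 : ℝ) * h')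
  · linear_combination exp (-(0 : ℝ)) *
      (whittakerR κ ν (0 : ℝ) * h' - whittakerR' κ ν (0 : ℝ) * h0)

/-! ### Parameter shifts and the connection formula -/

/-- This first-order operator moves `(κ, ν)` to `(κ - 1/2, ν + 1/2)`. It acts compatibly on both
power-series solutions and on the integral, so connection coefficients can be carried to larger `Re
ν`. -/
lemma whittakerR_shift (κ ν w : ℂ) :
    (-exp w / 2 + (ν + 1 / 2)) * whittakerR κ ν w - whittakerR' κ ν w
      = -(ν - κ + 1 / 2) * (exp (w / 2) * whittakerR (κ - 1 / 2) (ν + 1 / 2) w) := by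
  unfold whittakerR whittakerR'
  have he : exp ((ν + 1 / 2 + 1 / 2) * w) = exp ((ν + 1 / 2) * w) * exp (w / 2) := by
    rw [← exp_add]; ring_nf
  have he2 : exp w = exp (w / 2) * exp (w / 2) := by rw [← exp_add]; ring_nf
  rw [he, show ν + 1 / 2 - (κ - 1 / 2) + 1 / 2 = ν - κ + 1 / 2 + 1 by ring,
    show 1 + 2 * (ν + 1 / 2) = 1 + 2 * ν + 1 by ring]
  linear_combination (-exp (-exp w / 2) * exp ((ν + 1 / 2) * w) * ((ν - κ + 1 / 2) *
    regKummer (ν - κ + 1 / 2 + 1) (1 + 2 * ν + 1) (exp w))) * he2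

lemma whittakerR_neg_shift (κ ν w : ℂ) :
    (-exp w / 2 + (ν + 1 / 2)) * whittakerR κ (-ν) w - whittakerR' κ (-ν) w
      = -(exp (w / 2) * whittakerR (κ - 1 / 2) (-(ν + 1 / 2)) w) := by
  have h := regKummer_contiguous_right (-ν - κ + 1 / 2) (-2 * ν) (exp w)
  unfold whittakerR whittakerR'
  have he : exp ((-ν + 1 / 2) * w) = exp ((-(ν + 1 / 2) + 1 / 2) * w) * exp (w / 2) := by
    rw [← exp_add]; ring_nf
  rw [show -(ν + 1 / 2) - (κ - 1 / 2) + 1 / 2 = -ν - κ + 1 / 2 by ring,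
    show 1 + 2 * -(ν + 1 / 2) = -2 * ν by ring, show 1 + 2 * -ν = -2 * ν + 1 by ring,
    show -2 * ν + 1 + 1 = -2 * ν + 2 by ring, he]
  linear_combination
    (-exp (-exp w / 2) * exp ((-(ν + 1 / 2) + 1 / 2) * w) * exp (w / 2)) * h

lemma whittakerT_shift (κ ν : ℂ) (t : ℝ) :
    (-exp t / 2 + (ν + 1 / 2)) * whittakerT κ ν t - whittakerT' κ ν t
      = exp ((t : ℂ) / 2) * whittakerT (κ - 1 / 2) (ν + 1 / 2) t := by
  unfold whittakerT whittakerT'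
  have he : exp ((ν + 1 / 2 + 1 / 2) * t) = exp ((ν + 1 / 2) * t) * exp ((t : ℂ) / 2) := by
    rw [← exp_add]; ring_nf
  have he2 : exp (t : ℂ) = exp ((t : ℂ) / 2) * exp ((t : ℂ) / 2) := by rw [← exp_add]; ring_nf
  rw [he, show ν + 1 / 2 - (κ - 1 / 2) + 1 / 2 = ν - κ + 1 / 2 + 1 by ring,
    show -(ν + 1 / 2) - (κ - 1 / 2) + 1 / 2 = -ν - κ + 1 / 2 by ring]
  linear_combination (exp (-exp (t : ℂ) / 2) * exp ((ν + 1 / 2) * t) *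
    kummerI (ν - κ + 1 / 2 + 1) (-ν - κ + 1 / 2) (Real.exp t)) * he2

lemma ofReal_exp_cpow (t : ℝ) (s : ℂ) : (Real.exp t : ℂ) ^ s = exp (t * s) := by
  rw [cpow_def_of_ne_zero (by exact_mod_cast (Real.exp_pos t).ne'), ← ofReal_log (Real.exp_pos t).le,
    Real.log_exp]

lemma whittakerT_exists_combination {κ ν : ℂ} (hν : sin (2 * Real.pi * ν) ≠ 0)
    (ha : 0 < (ν - κ + 1 / 2).re) (ha' : 0 < (-ν - κ + 1 / 2).re) : ∃ α β : ℂ, ∀ t : ℝ,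
    whittakerT κ ν t = α * whittakerR κ ν t + β * whittakerR κ (-ν) t ∧
    whittakerT' κ ν t = α * whittakerR' κ ν t + β * whittakerR' κ (-ν) t := by
  have hne : -(sin (2 * Real.pi * ν) / Real.pi) ≠ 0 :=
    neg_ne_zero.2 (div_ne_zero hν (by exact_mod_cast Real.pi_ne_zero))
  obtain ⟨α, β, h⟩ := (isWhittakerSol_whittakerR κ ν).real.exists_combination
    (isWhittakerSol_whittakerR κ (-ν)).neg_param.real (isLinearSol_whittakerT ha ha') hne
    fun t => whittakerR_wronskian κ ν t
  refine ⟨α, β, fun t => ⟨h t, ?_⟩⟩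
  have h1 := ((whittakerR_hasDerivAt_real κ ν t).const_mul α).add
      ((whittakerR_hasDerivAt_real κ (-ν) t).const_mul β)
  exact (isLinearSol_whittakerT ha ha' t).1.unique
    (h1.congr_of_eventuallyEq (Eventually.of_forall h))

/-- Multiply by `e^{(ν-1/2)t}` and let `t → -∞`. The integral tends to `Γ(2ν)`, the solution with
exponent `-ν` to `1/Γ(1-2ν)`, and the other to `0`, so `β = Γ(2ν)Γ(1-2ν)`. -/
lemma whittakerT_dominant_coeff {κ ν α β : ℂ} (hν : sin (2 * Real.pi * ν) ≠ 0)
    (ha' : 0 < (-ν - κ + 1 / 2).re) (hre : 0 < ν.re)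
    (h : ∀ t : ℝ, whittakerT κ ν t = α * whittakerR κ ν t + β * whittakerR κ (-ν) t) :
    β = Real.pi / sin (2 * Real.pi * ν) := by
  have hexp : Tendsto (fun t : ℝ => (Real.exp t : ℂ)) atBot (𝓝 0) := by
    have := (continuous_ofReal.tendsto 0).comp Real.tendsto_exp_atBot
    simpa [Function.comp_def] using this
  have hE : Tendsto (fun t : ℝ => exp (-exp (t : ℂ) / 2)) atBot (𝓝 1) := by
    have h1 : Continuous fun z : ℂ => exp (-z / 2) := by fun_prop
    have := (h1.tendsto 0).comp hexp
    simpa [Function.comp_def] using this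
  have l1 : Tendsto (fun t : ℝ => exp ((ν - 1 / 2) * t) * whittakerT κ ν t) atBot
      (𝓝 (1 * Gamma (2 * ν))) := by
    have hJ := (tendsto_kummerJ (a := -ν - κ + 1 / 2) (a' := ν - κ + 1 / 2) ha' (by simp; linarith)).comp
      (tendsto_nhdsWithin_iff.2 ⟨Real.tendsto_exp_atBot,
        Eventually.of_forall fun t => Set.mem_Ioi.2 (Real.exp_pos t)⟩)
    rw [show ν - κ + 1 / 2 - (-ν - κ + 1 / 2) = 2 * ν by ring] at hJ
    refine (hE.mul hJ).congr fun t => ?_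
    rw [Function.comp_apply, kummerJ_eq (Real.exp_pos t), ofReal_exp_cpow, whittakerT,
      show ν - κ + 1 / 2 - (-ν - κ + 1 / 2) = 2 * ν by ring]
    have : exp (t * (2 * ν)) = exp ((ν - 1 / 2) * t) * exp ((ν + 1 / 2) * t) := by
      rw [← exp_add]; ring_nf
    rw [this]; ring
  have hcore : ∀ ν', Tendsto (fun t : ℝ => whittakerRCore κ ν' (exp t)) atBot
      (𝓝 (Gamma (1 + 2 * ν'))⁻¹) := fun ν' => by
    have := ((continuous_whittakerRCore κ ν').tendsto 0).comp hexp
    rw [whittakerRCore_zero] at this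
    simpa [Function.comp_def] using this
  have l2 : Tendsto (fun t : ℝ => exp ((ν - 1 / 2) * t) * whittakerR κ (-ν) t) atBot
      (𝓝 (Gamma (1 + 2 * -ν))⁻¹) := by
    refine (hcore (-ν)).congr fun t => ?_
    have : exp ((ν - 1 / 2) * t) * exp ((-ν + 1 / 2) * t) = 1 := by
      rw [← exp_add, exp_eq_one_iff]; exact ⟨0, by push_cast; ring⟩
    rw [whittakerR_eq_core, ← mul_assoc, this, one_mul]
  have l3 : Tendsto (fun t : ℝ => exp ((ν - 1 / 2) * t) * whittakerR κ ν t) atBot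
      (𝓝 (0 * (Gamma (1 + 2 * ν))⁻¹)) := by
    have h0 : Tendsto (fun t : ℝ => exp (2 * ν * t)) atBot (𝓝 0) := by
      rw [tendsto_zero_iff_norm_tendsto_zero]
      have h1 : Tendsto (fun t : ℝ => 2 * ν.re * t) atBot atBot :=
        tendsto_id.const_mul_atBot (by linarith)
      refine (Real.tendsto_exp_atBot.comp h1).congr fun t => ?_
      rw [norm_exp]; simp
    refine (h0.mul (hcore ν)).congr fun t => ?_
    rw [whittakerR_eq_core, ← mul_assoc, ← exp_add]
    ring_nf
  have l4 := (l3.const_mul α).add (l2.const_mul β)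
  have l5 := tendsto_nhds_unique l1 (l4.congr fun t => by rw [h t]; ring)
  have hG := Gamma_mul_Gamma_one_sub (2 * ν)
  rw [show (Real.pi : ℂ) * (2 * ν) = 2 * Real.pi * ν by ring] at hG
  have hne : Gamma (1 - 2 * ν) ≠ 0 := by
    intro h0
    rw [h0, mul_zero] at hG
    exact div_ne_zero (by exact_mod_cast Real.pi_ne_zero) hν hG.symm
  rw [show 1 + 2 * -ν = 1 - 2 * ν by ring] at l5
  rw [← hG, show Gamma (2 * ν) = β * (Gamma (1 - 2 * ν))⁻¹ by linear_combination l5]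
  field_simp

/-- `N` counts the shifts needed to make `Re ν` positive, where the coefficient is dominant. Each
shift changes the sign of both `β` and `sin(2πν)`, so the formula is preserved. -/
lemma whittakerT_combination (N : ℕ) : ∀ {κ ν α β : ℂ}, sin (2 * Real.pi * ν) ≠ 0 →
    0 < (ν - κ + 1 / 2).re → 0 < (-ν - κ + 1 / 2).re → 0 < ν.re + N / 2 →
    (∀ t : ℝ, whittakerT κ ν t = α * whittakerR κ ν t + β * whittakerR κ (-ν) t) →
    β = Real.pi / sin (2 * Real.pi * ν) := by
  induction N with
  | zero =>
    intro κ ν α β hν _ ha' hre h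
    exact whittakerT_dominant_coeff hν ha' (by simpa using hre) h
  | succ N ih =>
    intro κ ν α β hν ha ha' hre h
    obtain ⟨α', β', h'⟩ := whittakerT_exists_combination hν ha ha'
    have hc := whittakerR_combination_eq_zero (c := α - α') (d := β - β') hν
      fun t => by linear_combination (h' t).1 - h t
    have hβ : β = β' := sub_eq_zero.1 hc.2
    have hs : sin (2 * Real.pi * (ν + 1 / 2)) = -sin (2 * Real.pi * ν) := by
      rw [show 2 * (Real.pi : ℂ) * (ν + 1 / 2) = 2 * Real.pi * ν + Real.pi by ring, sin_add_pi]
    have key := ih (κ := κ - 1 / 2) (ν := ν + 1 / 2) (α := -(ν - κ + 1 / 2) * α') (β := -β')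
      (by rw [hs]; exact neg_ne_zero.2 hν)
      (by simp at ha ⊢; linarith) (by simp at ha' ⊢; linarith)
      (by push_cast at hre; simp; linarith) (fun t => by
        have e1 := whittakerT_shift κ ν t
        have e2 := whittakerR_shift κ ν t
        have e3 := whittakerR_neg_shift κ ν t
        rw [(h' t).1, (h' t).2] at e1
        refine mul_left_cancel₀ (exp_ne_zero ((t : ℂ) / 2)) ?_
        linear_combination -e1 + α' * e2 + β' * e3)
    rw [hs, div_neg, neg_inj] at key
    rw [hβ, key]

/-- The connection formula. -/
theorem Gamma_mul_whittakerWGen {κ ν : ℂ} (hν : sin (2 * Real.pi * ν) ≠ 0)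
    (ha : 0 < (ν - κ + 1 / 2).re) (ha' : 0 < (-ν - κ + 1 / 2).re) (t : ℝ) :
    Gamma (ν - κ + 1 / 2) * whittakerWGen κ ν t = whittakerT κ ν t := by
  have hν' : sin (2 * Real.pi * -ν) ≠ 0 := by rw [mul_neg, sin_neg]; exact neg_ne_zero.2 hν
  have hbig : ∀ x : ℝ, ∃ N : ℕ, 0 < x + N / 2 := fun x => by
    obtain ⟨N, hN⟩ := exists_nat_gt (-x * 2)
    exact ⟨N, by linarith⟩
  obtain ⟨α, β, h⟩ := whittakerT_exists_combination hν ha ha'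
  obtain ⟨α₂, β₂, h₂⟩ := whittakerT_exists_combination (κ := κ) hν' ha' (by rwa [neg_neg])
  obtain ⟨N, hN⟩ := hbig ν.re
  obtain ⟨M, hM⟩ := hbig (-ν).re
  have hβ := whittakerT_combination N hν ha ha' hN fun t => (h t).1
  have hβ₂ := whittakerT_combination M hν' ha' (by rwa [neg_neg]) hM fun t => (h₂ t).1
  rw [mul_neg, sin_neg, div_neg] at hβ₂
  -- Kummer's symmetry exchanges `ν` and `-ν`. It turns the coefficient known for `-ν` into the one
  -- still missing for `ν`.
  have hsymm : ∀ t : ℝ, Gamma (-ν - κ + 1 / 2) * whittakerT κ ν t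
      = Gamma (ν - κ + 1 / 2) * whittakerT κ (-ν) t := by
    intro t
    have hs := kummerI_symm ha ha' (Real.exp_pos t)
    rw [ofReal_exp_cpow] at hs
    unfold whittakerT
    rw [neg_neg]
    have he : exp ((-ν + 1 / 2) * t) = exp ((ν + 1 / 2) * t)
        * exp (t * (-ν - κ + 1 / 2 - (ν - κ + 1 / 2))) := by
      rw [← exp_add]; ring_nf
    rw [he]
    linear_combination exp (-exp (t : ℂ) / 2) * exp ((ν + 1 / 2) * t) * hs
  have hc := whittakerR_combination_eq_zero (κ := κ)
    (c := Gamma (-ν - κ + 1 / 2) * α - Gamma (ν - κ + 1 / 2) * β₂)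
    (d := Gamma (-ν - κ + 1 / 2) * β - Gamma (ν - κ + 1 / 2) * α₂) hν fun t => by
      have e := hsymm t
      rw [(h t).1, (h₂ t).1, neg_neg] at e
      linear_combination e
  have g1 := Gamma_ne_zero_of_re_pos ha
  have g2 := Gamma_ne_zero_of_re_pos ha'
  have hα : α = Gamma (ν - κ + 1 / 2) * β₂ * (Gamma (-ν - κ + 1 / 2))⁻¹ := by
    rw [eq_mul_inv_iff_mul_eq₀ g2]
    linear_combination hc.1
  rw [(h t).1, hα, hβ, hβ₂, whittakerWGen, whittakerB,
    show 1 / 2 - ν - κ = -ν - κ + 1 / 2 by ring, show 1 / 2 + ν - κ = ν - κ + 1 / 2 by ring]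
  have g3 : Gamma (ν - κ + 1 / 2) * (Gamma (ν - κ + 1 / 2))⁻¹ = 1 := mul_inv_cancel₀ g1
  linear_combination (Real.pi / sin (2 * Real.pi * ν)) * whittakerR κ (-ν) t * g3

lemma Gamma_mul_whittakerWGen' {κ ν : ℂ} (hν : sin (2 * Real.pi * ν) ≠ 0)
    (ha : 0 < (ν - κ + 1 / 2).re) (ha' : 0 < (-ν - κ + 1 / 2).re) (t : ℝ) :
    Gamma (ν - κ + 1 / 2) * whittakerWGen' κ ν t = whittakerT' κ ν t :=
  ((isWhittakerSol_whittakerWGen κ ν t).1.comp_ofReal.const_mul _).unique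
    ((isLinearSol_whittakerT ha ha' t).1.congr_of_eventuallyEq
      (Eventually.of_forall fun t => Gamma_mul_whittakerWGen hν ha ha' t))

/-! ### Decay of the Whittaker function, locally uniformly in the parameter -/

lemma whittakerR_raise (κ ν w : ℂ) :
    (exp w / 2 - κ) * whittakerR κ ν w - whittakerR' κ ν w
      = -(κ + ν + 1 / 2) * whittakerR (κ + 1) ν w := by
  have h := regKummer_lower (ν - κ + 1 / 2) (1 + 2 * ν) (exp w)
  unfold whittakerR whittakerR'
  rw [show ν - (κ + 1) + 1 / 2 = ν - κ + 1 / 2 - 1 by ring]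
  linear_combination (-exp (-exp w / 2) * exp ((ν + 1 / 2) * w)) * h

/-- The raising factors `κ ± ν + 1/2` on the two power-series solutions are absorbed by the
functional equation of `1/Γ`, so `W` itself is raised without any factor. -/
lemma whittakerWGen_raise (κ ν w : ℂ) :
    whittakerWGen (κ + 1) ν w = (exp w / 2 - κ) * whittakerWGen κ ν w - whittakerWGen' κ ν w := by
  have h1 := whittakerR_raise κ ν w
  have h2 := whittakerR_raise κ (-ν) w
  have g1 := one_div_Gamma_eq_self_mul_one_div_Gamma_add_one (1 / 2 - ν - (κ + 1))
  have g2 := one_div_Gamma_eq_self_mul_one_div_Gamma_add_one (1 / 2 + ν - (κ + 1))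
  rw [show 1 / 2 - ν - (κ + 1) + 1 = 1 / 2 - ν - κ by ring] at g1
  rw [show 1 / 2 + ν - (κ + 1) + 1 = 1 / 2 + ν - κ by ring] at g2
  unfold whittakerWGen whittakerWGen' whittakerB whittakerB'
  rw [g1, g2]
  linear_combination (-(-Real.pi / sin (2 * Real.pi * ν))) * (Gamma (1 / 2 - ν - κ))⁻¹ * h1
    + (-Real.pi / sin (2 * Real.pi * ν)) * (Gamma (1 / 2 + ν - κ))⁻¹ * h2

lemma whittakerWGen'_raise (κ ν w : ℂ) :
    whittakerWGen' (κ + 1) ν w = (exp w / 2 - κ) * whittakerWGen' κ ν w - whittakerWGen' κ ν w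
      + (1 / 4 - ν ^ 2 + κ * exp w - exp w ^ 2 / 4 + exp w / 2) * whittakerWGen κ ν w := by
  have h0 := (isWhittakerSol_whittakerWGen (κ + 1) ν w).1
  obtain ⟨h1, h2⟩ := isWhittakerSol_whittakerWGen κ ν w
  have h3 := ((((hasDerivAt_exp w).div_const 2).sub_const κ).mul h1).sub h2
  rw [h0.unique (h3.congr_of_eventuallyEq
    (Eventually.of_forall fun w => whittakerWGen_raise κ ν w))]
  ring

/-- Combine `At ≤ A²/(2ε) + εt²/2` with `t²/2 ≤ e^t`. This is what lets powers of `e^t` be absorbed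
at an arbitrarily small cost in the rate. -/
lemma exists_exp_mul_le (A : ℝ) {ε : ℝ} (hε : 0 < ε) :
    ∃ C : ℝ, ∀ t : ℝ, 0 ≤ t → Real.exp (A * t) ≤ C * Real.exp (ε * Real.exp t) := by
  refine ⟨Real.exp (A ^ 2 / (2 * ε)), fun t ht => ?_⟩
  rw [← Real.exp_add]
  refine Real.exp_le_exp.2 ?_
  have h1 := Real.quadratic_le_exp_of_nonneg ht
  have h2 : A * t ≤ A ^ 2 / (2 * ε) + ε * (t ^ 2 / 2) := by
    rw [div_add' _ _ _ (by positivity), le_div_iff₀ (by positivity)]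
    nlinarith [sq_nonneg (A - ε * t)]
  have h3 : ε * (t ^ 2 / 2) ≤ ε * Real.exp t := mul_le_mul_of_nonneg_left (by linarith) hε.le
  linarith

/-- Exponential decay in `e^t` at every rate below `1/2`, uniformly for `ν ∈ K`. -/
def WhittakerDecayOn (κ : ℂ) (K : Set ℂ) : Prop :=
  ∀ b : ℝ, b < 1 / 2 → ∃ C : ℝ, ∀ ν ∈ K, ∀ t : ℝ, 0 ≤ t →
    ‖whittakerWGen κ ν t‖ ≤ C * Real.exp (-b * Real.exp t) ∧
    ‖whittakerWGen' κ ν t‖ ≤ C * Real.exp (-b * Real.exp t)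

lemma continuousAt_realGamma_of_pos {s : ℝ} (hs : 0 < s) : ContinuousAt Real.Gamma s :=
  (Real.differentiableAt_Gamma fun m => by
    have : (0 : ℝ) ≤ m := m.cast_nonneg
    linarith).continuousAt

/-- For `e^t ≥ 1` the Laplace integrals are bounded by Gamma values, uniformly on `K`. The decay
comes from the prefactor `e^{-e^t/2}`. -/
lemma WhittakerDecayOn.of_integral {κ : ℂ} {K : Set ℂ} (hK : IsCompact K)
    (hs : ∀ ν ∈ K, sin (2 * Real.pi * ν) ≠ 0)
    (ha : ∀ ν ∈ K, 0 < (ν - κ + 1 / 2).re ∧ 0 < (-ν - κ + 1 / 2).re) : WhittakerDecayOn κ K := by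
  intro b hb
  obtain ⟨M, hM⟩ := hK.exists_bound_of_continuousOn (f := fun ν : ℂ => |ν.re| + ‖ν + 1 / 2‖ + 1)
    (by fun_prop)
  have hΓ : ∀ ν ∈ K, ContinuousWithinAt
      (fun ν : ℂ => ‖(Gamma (ν - κ + 1 / 2))⁻¹‖ * (Real.Gamma (ν - κ + 1 / 2).re
        + Real.Gamma (ν - κ + 1 / 2 + 1).re)) K ν := by
    intro ν hν
    refine ContinuousAt.continuousWithinAt (ContinuousAt.mul ?_ (ContinuousAt.add ?_ ?_))
    · exact ((continuous_inv_Gamma_comp (by fun_prop)).norm).continuousAt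
    · exact (continuousAt_realGamma_of_pos (ha ν hν).1).comp
        (f := fun ν : ℂ => (ν - κ + 1 / 2).re) (by fun_prop)
    · exact (continuousAt_realGamma_of_pos (s := (ν - κ + 1 / 2 + 1).re)
        (by have := (ha ν hν).1; rw [add_re _ 1, one_re]; linarith)).comp
        (f := fun ν : ℂ => (ν - κ + 1 / 2 + 1).re) (by fun_prop)
  obtain ⟨G, hG⟩ := hK.exists_bound_of_continuousOn hΓ
  -- The gap `1/2 - b` pays for the factor `e^{(ν+1/2)t}` and for the additional `e^t` in the
  -- derivative.
  obtain ⟨C, hC⟩ := exists_exp_mul_le (M + 1) (ε := 1 / 2 - b) (by linarith)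
  refine ⟨(M + 1) * G * C, fun ν hν t ht => ?_⟩
  have ha1 := (ha ν hν).1
  have ha2 : 0 < (ν - κ + 1 / 2 + 1).re := by rw [add_re _ 1, one_re]; linarith
  have ha' := (ha ν hν).2
  have g0 : Gamma (ν - κ + 1 / 2) ≠ 0 := Gamma_ne_zero_of_re_pos ha1
  have hy : 1 ≤ Real.exp t := Real.one_le_exp ht
  have b1 := norm_kummerI_le ha1 ha' hy
  have b2 := norm_kummerI_le ha2 ha' hy
  have p1 := Real.Gamma_pos_of_pos ha1
  have p2 := Real.Gamma_pos_of_pos ha2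
  have hG' := (le_abs_self _).trans (hG ν hν)
  have hM' := (le_abs_self _).trans (hM ν hν)
  set gi := ‖(Gamma (ν - κ + 1 / 2))⁻¹‖ with hgi
  have gi0 : 0 ≤ gi := norm_nonneg _
  have hE : ‖exp (-exp (t : ℂ) / 2) * exp ((ν + 1 / 2) * t)‖ * Real.exp t
      ≤ C * Real.exp (-b * Real.exp t) := by
    rw [norm_mul, norm_exp, norm_exp, ← ofReal_exp]
    have e1 : (-(Real.exp t : ℂ) / 2).re = -Real.exp t / 2 := by
      rw [show (-(Real.exp t : ℂ) / 2) = ((-Real.exp t / 2 : ℝ) : ℂ) by push_cast; ring, ofReal_re]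
    have e2 : ((ν + 1 / 2) * (t : ℂ)).re = (ν.re + 1 / 2) * t := by
      rw [re_mul_ofReal, add_re]; norm_num
    rw [e1, e2]
    have e3 : (ν.re + 1 / 2) * t + t ≤ (M + 1) * t := by
      have := le_abs_self ν.re
      have := norm_nonneg (ν + 1 / 2)
      nlinarith
    calc _ = Real.exp (-Real.exp t / 2) * Real.exp ((ν.re + 1 / 2) * t + t) := by
          rw [Real.exp_add]; ring
      _ ≤ Real.exp (-Real.exp t / 2) * (C * Real.exp ((1 / 2 - b) * Real.exp t)) :=
          mul_le_mul_of_nonneg_left ((Real.exp_le_exp.2 e3).trans (hC t ht)) (Real.exp_nonneg _)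
      _ = C * (Real.exp (-Real.exp t / 2) * Real.exp ((1 / 2 - b) * Real.exp t)) := by ring
      _ = _ := by rw [← Real.exp_add]; ring_nf
  have hE0 := norm_nonneg (exp (-exp (t : ℂ) / 2) * exp ((ν + 1 / 2) * t))
  set E := ‖exp (-exp (t : ℂ) / 2) * exp ((ν + 1 / 2) * t)‖ with hEdef
  have hEt : 0 ≤ E * Real.exp t := by positivity
  have hM1 : 1 ≤ M := by
    have := abs_nonneg ν.re
    have := norm_nonneg (ν + 1 / 2)
    linarith
  have hfin : ∀ x : ℝ, x ≤ (M + 1) * G * (E * Real.exp t) →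
      x ≤ (M + 1) * G * C * Real.exp (-b * Real.exp t) := by
    intro x hx
    have hG0 : 0 ≤ G := le_trans (by positivity) hG'
    refine hx.trans ?_
    rw [mul_assoc ((M + 1) * G)]
    exact mul_le_mul_of_nonneg_left hE (by positivity)
  constructor
  · have e : whittakerWGen κ ν t = (Gamma (ν - κ + 1 / 2))⁻¹ * whittakerT κ ν t := by
      rw [← Gamma_mul_whittakerWGen (hs ν hν) ha1 ha', inv_mul_cancel_left₀ g0]
    refine hfin _ ?_
    rw [e, norm_mul, ← hgi, whittakerT, norm_mul, ← hEdef]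
    calc _ ≤ gi * (E * Real.Gamma (ν - κ + 1 / 2).re) := by gcongr
      _ = (gi * Real.Gamma (ν - κ + 1 / 2).re) * (E * 1) := by ring
      _ ≤ G * (E * Real.exp t) := by
        refine mul_le_mul (le_trans ?_ hG') (by gcongr) (by positivity)
          (le_trans (by positivity) hG')
        exact mul_le_mul_of_nonneg_left (by linarith) gi0
      _ ≤ (M + 1) * (G * (E * Real.exp t)) := le_mul_of_one_le_left
        (mul_nonneg (le_trans (by positivity) hG') hEt) (by linarith)
      _ = _ := by ring
  · have e : whittakerWGen' κ ν t = (Gamma (ν - κ + 1 / 2))⁻¹ * whittakerT' κ ν t := by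
      rw [← Gamma_mul_whittakerWGen' (hs ν hν) ha1 ha', inv_mul_cancel_left₀ g0]
    refine hfin _ ?_
    rw [e, norm_mul, ← hgi, whittakerT', norm_mul, ← hEdef]
    have hn : ‖exp (t : ℂ)‖ = Real.exp t := by rw [norm_exp, ofReal_re]
    have h1 : ‖-exp (t : ℂ) / 2 + (ν + 1 / 2)‖ ≤ (M + 1) * Real.exp t := by
      have := norm_add_le (-exp (t : ℂ) / 2) (ν + 1 / 2)
      rw [norm_div, norm_neg, hn, Complex.norm_ofNat] at this
      have := abs_nonneg ν.re
      nlinarith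
    have h2 : ‖(-exp (t : ℂ) / 2 + (ν + 1 / 2)) *
        kummerI (ν - κ + 1 / 2) (-ν - κ + 1 / 2) (Real.exp t)
        - exp t * kummerI (ν - κ + 1 / 2 + 1) (-ν - κ + 1 / 2) (Real.exp t)‖
        ≤ (M + 1) * Real.exp t * (Real.Gamma (ν - κ + 1 / 2).re
          + Real.Gamma (ν - κ + 1 / 2 + 1).re) := by
      refine (norm_sub_le _ _).trans ?_
      rw [norm_mul, norm_mul, hn, mul_add]
      refine add_le_add (mul_le_mul h1 b1 (norm_nonneg _) (by positivity)) ?_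
      refine mul_le_mul ?_ b2 (norm_nonneg _) (by positivity)
      exact le_mul_of_one_le_left (Real.exp_nonneg _) (by linarith)
    calc _ ≤ gi * (E * ((M + 1) * Real.exp t * (Real.Gamma (ν - κ + 1 / 2).re
          + Real.Gamma (ν - κ + 1 / 2 + 1).re))) := by gcongr
      _ = (gi * (Real.Gamma (ν - κ + 1 / 2).re + Real.Gamma (ν - κ + 1 / 2 + 1).re))
          * ((M + 1) * (E * Real.exp t)) := by ring
      _ ≤ G * ((M + 1) * (E * Real.exp t)) := mul_le_mul_of_nonneg_right hG' (by positivity)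
      _ = _ := by ring

/-- The raising formulas cost at most a factor of order `e^{2t}`. Starting from the intermediate
rate `(b + 1/2)/2` leaves room to absorb it. -/
lemma WhittakerDecayOn.raise {κ : ℂ} {K : Set ℂ} (hK : IsCompact K) (h : WhittakerDecayOn κ K) :
    WhittakerDecayOn (κ + 1) K := by
  intro b hb
  obtain ⟨C, hC⟩ := h ((b + 1 / 2) / 2) (by linarith)
  obtain ⟨D, hD⟩ := exists_exp_mul_le 2 (ε := (1 / 2 - b) / 2) (by linarith)
  obtain ⟨M, hM⟩ := hK.exists_bound_of_continuousOn (f := fun ν : ℂ => ‖ν‖ ^ 2) (by fun_prop)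
  refine ⟨(4 + 2 * ‖κ‖ + M) * C * D, fun ν hν t ht => ?_⟩
  obtain ⟨h1, h2⟩ := hC ν hν t ht
  have hM' := (le_abs_self _).trans (hM ν hν)
  have hM0 : 0 ≤ M := (by positivity : (0 : ℝ) ≤ ‖ν‖ ^ 2).trans hM'
  have hy : 1 ≤ Real.exp t := Real.one_le_exp ht
  have hn : ‖exp (t : ℂ)‖ = Real.exp t := by rw [norm_exp, ofReal_re]
  set y := Real.exp t with hydef
  set B := C * Real.exp (-((b + 1 / 2) / 2) * y) with hB
  have hB0 : 0 ≤ B := (norm_nonneg _).trans h1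
  have hκ := norm_nonneg κ
  have hfin : y ^ 2 * B ≤ C * D * Real.exp (-b * y) := by
    have hC0 : 0 ≤ C := nonneg_of_mul_nonneg_left hB0 (Real.exp_pos _)
    have e1 : y ^ 2 = Real.exp (2 * t) := by rw [hydef, ← Real.exp_nat_mul]; norm_num
    calc y ^ 2 * B = C * (y ^ 2 * Real.exp (-((b + 1 / 2) / 2) * y)) := by rw [hB]; ring
      _ ≤ C * (D * Real.exp ((1 / 2 - b) / 2 * y) * Real.exp (-((b + 1 / 2) / 2) * y)) := by
        rw [e1]
        exact mul_le_mul_of_nonneg_left (mul_le_mul_of_nonneg_right (hD t ht) (Real.exp_nonneg _)) hC0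
      _ = C * D * Real.exp (-b * y) := by
        rw [mul_assoc D, ← Real.exp_add, mul_assoc]; ring_nf
  have hall : ∀ x : ℝ, x ≤ (4 + 2 * ‖κ‖ + M) * (y ^ 2 * B) →
      x ≤ (4 + 2 * ‖κ‖ + M) * C * D * Real.exp (-b * y) := fun x hx => by
    refine hx.trans ?_
    rw [mul_assoc _ C, mul_assoc _ (C * D)]
    exact mul_le_mul_of_nonneg_left hfin (by positivity)
  have hyy : y ≤ y ^ 2 := by nlinarith
  have hc : ‖exp (t : ℂ) / 2 - κ‖ ≤ (1 + ‖κ‖) * y ^ 2 := by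
    refine (norm_sub_le _ _).trans ?_
    rw [norm_div, hn, Complex.norm_ofNat]
    nlinarith
  constructor
  · refine hall _ ?_
    rw [whittakerWGen_raise]
    refine (norm_sub_le _ _).trans ?_
    rw [norm_mul]
    have := mul_le_mul hc h1 (norm_nonneg _) (by positivity)
    have h5 : B ≤ y ^ 2 * B := le_mul_of_one_le_left hB0 (by nlinarith)
    have h6 : 0 ≤ (2 + ‖κ‖ + M) * (y ^ 2 * B) := by positivity
    nlinarith
  · refine hall _ ?_
    rw [whittakerWGen'_raise]
    refine (norm_add_le _ _).trans ?_
    have s1 := norm_sub_le ((exp (t : ℂ) / 2 - κ) * whittakerWGen' κ ν t) (whittakerWGen' κ ν t)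
    rw [norm_mul] at s1
    have s2 := mul_le_mul hc h2 (norm_nonneg _) (by positivity)
    have h5 : B ≤ y ^ 2 * B := le_mul_of_one_le_left hB0 (by nlinarith)
    have hq : ‖1 / 4 - ν ^ 2 + κ * exp (t : ℂ) - exp (t : ℂ) ^ 2 / 4 + exp (t : ℂ) / 2‖
        ≤ (1 + ‖κ‖ + M) * y ^ 2 := by
      have n1 := norm_add_le (1 / 4 - ν ^ 2 + κ * exp (t : ℂ) - exp (t : ℂ) ^ 2 / 4) (exp (t : ℂ) / 2)
      have n2 := norm_sub_le (1 / 4 - ν ^ 2 + κ * exp (t : ℂ)) (exp (t : ℂ) ^ 2 / 4)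
      have n3 := norm_add_le (1 / 4 - ν ^ 2) (κ * exp (t : ℂ))
      have n4 := norm_sub_le (1 / 4 : ℂ) (ν ^ 2)
      rw [norm_div _ (2 : ℂ), hn, Complex.norm_ofNat] at n1
      rw [norm_div _ (4 : ℂ), norm_pow, hn, Complex.norm_ofNat] at n2
      rw [norm_mul, hn] at n3
      rw [norm_pow] at n4
      have n5 : ‖(1 / 4 : ℂ)‖ = 1 / 4 := by norm_num
      rw [n5] at n4
      have m1 : ‖κ‖ * y ≤ ‖κ‖ * y ^ 2 := mul_le_mul_of_nonneg_left hyy hκ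
      have m2 : M ≤ M * y ^ 2 := le_mul_of_one_le_right hM0 (by nlinarith)
      nlinarith
    have s3 := mul_le_mul hq h1 (norm_nonneg _) (by positivity)
    rw [norm_mul]
    have h6 : 0 ≤ y ^ 2 * B := by positivity
    nlinarith

/-- Lowering `κ` by a large integer `N` makes both arguments of the integral have positive real part
throughout `K`; then `N` raising steps return to `κ`. -/
theorem whittakerDecayOn (κ : ℂ) {K : Set ℂ} (hK : IsCompact K)
    (hs : ∀ ν ∈ K, sin (2 * Real.pi * ν) ≠ 0) : WhittakerDecayOn κ K := by
  obtain ⟨M, hM⟩ := hK.exists_bound_of_continuousOn (f := fun ν : ℂ => |ν.re|) (by fun_prop)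
  obtain ⟨N, hN⟩ := exists_nat_gt (κ.re + M)
  have hbase : WhittakerDecayOn (κ - N) K := by
    refine WhittakerDecayOn.of_integral hK hs fun ν hν => ?_
    have h1 := (le_abs_self _).trans (hM ν hν)
    have h2 := abs_le.1 h1
    constructor
    · simp; linarith [h2.1]
    · simp; linarith [h2.2]
  have hstep : ∀ j : ℕ, WhittakerDecayOn (κ - N + j) K := by
    intro j
    induction j with
    | zero => simpa using hbase
    | succ j ih =>
      have := ih.raise hK
      rwa [add_assoc, ← Nat.cast_succ] at this
  simpa using hstep N

/-- The derivatives of `W_{κ,μ}(e^t)` with respect to `μ` decay exponentially in `e^t`. -/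
theorem whittakerWDeriv_decay (κ μ : ℂ) (j : ℕ) {b : ℝ} (hb : b < 1 / 2) :
    ∃ C : ℝ, ∀ t : ℝ, 0 ≤ t → ‖whittakerWDeriv κ μ j t‖ ≤ C * Real.exp (-b * Real.exp t) := by
  obtain ⟨r, hr, hs⟩ := exists_sphere_sin_param_ne_zero μ
  obtain ⟨C, hC⟩ := whittakerDecayOn κ (isCompact_sphere μ r) hs b hb
  refine ⟨j ! * C / r ^ j, fun t ht => ?_⟩
  refine (norm_whittakerWDeriv_le hr hs (fun ζ hζ => (hC ζ hζ t ht).1) j).trans (le_of_eq ?_)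
  ring

section

/-! ### Growth of solutions on the exponential-of-exponential scale -/

/-- `G(t) = O(e^{b e^t})` as `t → ∞`. -/
def ExpBigO (b : ℝ) (G : ℝ → ℂ) : Prop := G =O[atTop] fun t : ℝ => Real.exp (b * Real.exp t)

lemma ExpBigO.mono {a b : ℝ} {G : ℝ → ℂ} (h : ExpBigO a G) (hab : a ≤ b) : ExpBigO b G := by
  refine IsBigO.trans h (IsBigO.of_bound 1 (Eventually.of_forall fun t => ?_))
  rw [one_mul, Real.norm_eq_abs, Real.norm_eq_abs, Real.abs_exp, Real.abs_exp]
  exact Real.exp_le_exp.2 (mul_le_mul_of_nonneg_right hab (Real.exp_nonneg _))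

lemma ExpBigO.add {b : ℝ} {G H : ℝ → ℂ} (hG : ExpBigO b G) (hH : ExpBigO b H) :
    ExpBigO b fun t => G t + H t := IsBigO.add hG hH

lemma ExpBigO.sub {b : ℝ} {G H : ℝ → ℂ} (hG : ExpBigO b G) (hH : ExpBigO b H) :
    ExpBigO b fun t => G t - H t := IsBigO.sub hG hH

lemma ExpBigO.const_mul {b : ℝ} {G : ℝ → ℂ} (c : ℂ) (hG : ExpBigO b G) :
    ExpBigO b fun t => c * G t := IsBigO.const_mul_left hG c

lemma ExpBigO.mul {a b : ℝ} {G H : ℝ → ℂ} (hG : ExpBigO a G) (hH : ExpBigO b H) :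
    ExpBigO (a + b) fun t => G t * H t :=
  (IsBigO.mul hG hH).congr_right fun t => by rw [← Real.exp_add, add_mul]

lemma expBigO_of_le_exp {A C b : ℝ} (hb : 0 < b) {p : ℝ → ℂ}
    (hp : ∀ t, 0 ≤ t → ‖p t‖ ≤ C * Real.exp (A * t)) : ExpBigO b p := by
  obtain ⟨D, hD⟩ := exists_exp_mul_le A hb
  refine IsBigO.of_bound (|C| * D) ?_
  filter_upwards [eventually_ge_atTop 0] with t ht
  rw [Real.norm_eq_abs, Real.abs_exp, mul_assoc]
  calc _ ≤ C * Real.exp (A * t) := hp t ht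
    _ ≤ |C| * Real.exp (A * t) := mul_le_mul_of_nonneg_right (le_abs_self _) (Real.exp_nonneg _)
    _ ≤ _ := mul_le_mul_of_nonneg_left (hD t ht) (abs_nonneg _)

lemma mul_exp_neg_mul_le {η : ℝ} (hη : 0 < η) (x : ℝ) : x * Real.exp (-(η * x)) ≤ 1 / η := by
  have h1 := Real.add_one_le_exp (η * x)
  rw [Real.exp_neg, ← div_eq_mul_inv, div_le_div_iff₀ (Real.exp_pos _) hη]
  linarith

/-- A Landau type inequality: bounds for `G` and `G''` give a bound for `G'`. -/
lemma ExpBigO.deriv_of_landau {a b : ℝ} (hab : a < b) {G G' G'' : ℝ → ℂ}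
    (h1 : ∀ t, HasDerivAt G (G' t) t) (h2 : ∀ t, HasDerivAt G' (G'' t) t) (hG : ExpBigO a G)
    (hG'' : ExpBigO b G'') : ExpBigO ((a + b) / 2) G' := by
  obtain ⟨A, hA⟩ := hG.bound
  obtain ⟨B, hB⟩ := hG''.bound
  obtain ⟨T, hT⟩ := eventually_atTop.1 (hA.and hB)
  -- The window length `δ = e^{-η e^t}` balances the bound `‖G'‖ ≲ ‖G‖/δ + δ‖G''‖`: the rates `a +
  -- η` and `b - η` are both `(a+b)/2`.
  set η := (b - a) / 2 with hη
  have hη0 : 0 < η := by rw [hη]; linarith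
  -- On the window `e^s` changes by at most `2e^t δ ≤ 2/η`, so the comparison functions change only
  -- by a bounded factor.
  have key : ∀ c t δ s : ℝ, δ = Real.exp (-(η * Real.exp t)) → t ≤ s → s ≤ t + δ →
      Real.exp (c * Real.exp s) ≤ Real.exp (2 * |c| / η) * Real.exp (c * Real.exp t) := by
    intro c t δ s hδ hs1 hs2
    have hδ1 : δ ≤ 1 := by
      rw [hδ]; exact Real.exp_le_one_iff.2 (by have := Real.exp_pos t; nlinarith)
    have hδ0 : 0 < δ := hδ ▸ Real.exp_pos _
    have e1 : Real.exp δ - 1 ≤ 2 * δ := by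
      have h := Real.abs_exp_sub_one_le (x := δ) (by rw [abs_of_pos hδ0]; exact hδ1)
      rw [abs_of_pos hδ0] at h
      exact (le_abs_self _).trans h
    have e2 : Real.exp s ≤ Real.exp t * Real.exp δ := by
      rw [← Real.exp_add]; exact Real.exp_le_exp.2 hs2
    have e3 : Real.exp t ≤ Real.exp s := Real.exp_le_exp.2 hs1
    have e4 : Real.exp t * δ ≤ 1 / η := by rw [hδ]; exact mul_exp_neg_mul_le hη0 _
    have e5 : Real.exp s - Real.exp t ≤ 2 / η := by
      have := mul_le_mul_of_nonneg_left e1 (Real.exp_nonneg t)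
      calc _ ≤ 2 * (Real.exp t * δ) := by linarith
        _ ≤ 2 * (1 / η) := by linarith
        _ = _ := by ring
    rw [← Real.exp_add]
    refine Real.exp_le_exp.2 ?_
    have e6 : c * (Real.exp s - Real.exp t) ≤ |c| * (2 / η) :=
      (mul_le_mul_of_nonneg_right (le_abs_self c) (by linarith)).trans
        (mul_le_mul_of_nonneg_left e5 (abs_nonneg c))
    have e7 : 2 * |c| / η = |c| * (2 / η) := by ring
    linarith
  refine IsBigO.of_bound (2 * (|A| * Real.exp (2 * |a| / η)) + |B| * Real.exp (2 * |b| / η)) ?_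
  filter_upwards [eventually_ge_atTop T] with t ht
  set δ := Real.exp (-(η * Real.exp t)) with hδ
  have hδ0 : 0 < δ := Real.exp_pos _
  set KA := |A| * Real.exp (2 * |a| / η) with hKA
  set KB := |B| * Real.exp (2 * |b| / η) with hKB
  have bG : ∀ s ∈ Set.Icc t (t + δ), ‖G s‖ ≤ KA * Real.exp (a * Real.exp t) := by
    intro s hs
    have h := (hT s (ht.trans hs.1)).1
    rw [Real.norm_eq_abs, Real.abs_exp] at h
    calc _ ≤ A * Real.exp (a * Real.exp s) := h
      _ ≤ |A| * Real.exp (a * Real.exp s) :=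
        mul_le_mul_of_nonneg_right (le_abs_self _) (Real.exp_nonneg _)
      _ ≤ |A| * (Real.exp (2 * |a| / η) * Real.exp (a * Real.exp t)) :=
        mul_le_mul_of_nonneg_left (key a t δ s hδ hs.1 hs.2) (abs_nonneg _)
      _ = _ := by rw [hKA]; ring
  have bG'' : ∀ s ∈ Set.Icc t (t + δ), ‖G'' s‖ ≤ KB * Real.exp (b * Real.exp t) := by
    intro s hs
    have h := (hT s (ht.trans hs.1)).2
    rw [Real.norm_eq_abs, Real.abs_exp] at h
    calc _ ≤ B * Real.exp (b * Real.exp s) := h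
      _ ≤ |B| * Real.exp (b * Real.exp s) :=
        mul_le_mul_of_nonneg_right (le_abs_self _) (Real.exp_nonneg _)
      _ ≤ |B| * (Real.exp (2 * |b| / η) * Real.exp (b * Real.exp t)) :=
        mul_le_mul_of_nonneg_left (key b t δ s hδ hs.1 hs.2) (abs_nonneg _)
      _ = _ := by rw [hKB]; ring
  have ht0 : t ∈ Set.Icc t (t + δ) := ⟨le_rfl, by linarith⟩
  have ht1 : t + δ ∈ Set.Icc t (t + δ) := ⟨by linarith, le_rfl⟩
  set Y := KB * Real.exp (b * Real.exp t) with hY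
  have hY0 : 0 ≤ Y := by positivity
  have c1 : ∀ s ∈ Set.Icc t (t + δ), ‖G' s - G' t‖ ≤ Y * δ := by
    intro s hs
    have := (convex_Icc t (t + δ)).norm_image_sub_le_of_norm_hasDerivWithin_le
      (fun x _ => (h2 x).hasDerivWithinAt) bG'' ht0 hs
    refine this.trans (mul_le_mul_of_nonneg_left ?_ hY0)
    rw [Real.norm_eq_abs, abs_of_nonneg (by linarith [hs.1])]
    linarith [hs.2]
  have c2 := (convex_Icc t (t + δ)).norm_image_sub_le_of_norm_hasDerivWithin_le
    (f := fun s => G s - (s : ℂ) * G' t) (f' := fun s => G' s - G' t)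
    (fun x _ => (((h1 x).sub (((hasDerivAt_id x).ofReal_comp).mul_const (G' t))).congr_deriv
      (by simp)).hasDerivWithinAt) c1 ht0 ht1
  have e1 : G (t + δ) - ((t + δ : ℝ) : ℂ) * G' t - (G t - (t : ℂ) * G' t)
      = G (t + δ) - G t - δ * G' t := by push_cast; ring
  rw [e1, add_sub_cancel_left, Real.norm_eq_abs, abs_of_pos hδ0] at c2
  have c3 : δ * ‖G' t‖ ≤ 2 * (KA * Real.exp (a * Real.exp t)) + Y * δ * δ := by
    have n1 : ‖(δ : ℂ) * G' t‖ = δ * ‖G' t‖ := by rw [norm_mul, norm_real, Real.norm_of_nonneg hδ0.le]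
    have n2 : (δ : ℂ) * G' t = (G (t + δ) - G t) - (G (t + δ) - G t - δ * G' t) := by ring
    rw [← n1, n2]
    refine (norm_sub_le _ _).trans ?_
    have n3 := norm_sub_le (G (t + δ)) (G t)
    linarith [bG _ ht0, bG _ ht1]
  have e2 : Real.exp (a * Real.exp t) = δ * Real.exp ((a + b) / 2 * Real.exp t) := by
    rw [hδ, ← Real.exp_add, hη]; ring_nf
  have e3 : Y * δ = KB * Real.exp ((a + b) / 2 * Real.exp t) := by
    rw [hY, hδ, mul_assoc, ← Real.exp_add, hη]; ring_nf
  rw [Real.norm_eq_abs, Real.abs_exp]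
  rw [e3, e2] at c3
  refine le_of_mul_le_mul_left (c3.trans (le_of_eq ?_)) hδ0
  ring

/-- Growth at most `e^{a e^t}` with `a < ω`. -/
def SubExp (ω : ℝ) (G : ℝ → ℂ) : Prop := ∃ a < ω, ExpBigO a G

/-- Growth at most `e^{b e^t}` for all `b > ω`. -/
def TameExp (ω : ℝ) (G : ℝ → ℂ) : Prop := ∀ b > ω, ExpBigO b G

variable {ω : ℝ}

lemma SubExp.add {G H : ℝ → ℂ} (hG : SubExp ω G) (hH : SubExp ω H) :
    SubExp ω fun t => G t + H t := by
  obtain ⟨a, ha, hG⟩ := hG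
  obtain ⟨b, hb, hH⟩ := hH
  exact ⟨max a b, max_lt ha hb, (hG.mono (le_max_left _ _)).add (hH.mono (le_max_right _ _))⟩

lemma SubExp.const_mul {G : ℝ → ℂ} (c : ℂ) (hG : SubExp ω G) : SubExp ω fun t => c * G t := by
  obtain ⟨a, ha, hG⟩ := hG
  exact ⟨a, ha, hG.const_mul c⟩

lemma SubExp.sub {G H : ℝ → ℂ} (hG : SubExp ω G) (hH : SubExp ω H) :
    SubExp ω fun t => G t - H t := by
  have := hG.add (hH.const_mul (-1))
  refine (funext fun t => ?_ : (fun t => G t - H t) = _) ▸ this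
  ring

lemma SubExp.sum {ι : Type*} (s : Finset ι) {G : ι → ℝ → ℂ} (h : ∀ i ∈ s, SubExp ω (G i)) :
    SubExp ω fun t => ∑ i ∈ s, G i t := by
  classical
  induction s using Finset.induction_on with
  | empty => exact ⟨ω - 1, by linarith, by simpa [ExpBigO] using isBigO_zero _ _⟩
  | insert i s hi ih =>
    simp only [Finset.sum_insert hi]
    exact (h i (Finset.mem_insert_self i s)).add (ih fun j hj => h j (Finset.mem_insert_of_mem hj))

/-- Functions growing more slowly than every `e^{ε e^t}`. -/
def SlowExp (p : ℝ → ℂ) : Prop := ∀ ε > 0, ExpBigO ε p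

lemma SubExp.slow_mul {p G : ℝ → ℂ} (hp : SlowExp p) (hG : SubExp ω G) :
    SubExp ω fun t => p t * G t := by
  obtain ⟨a, ha, hG⟩ := hG
  exact ⟨(ω - a) / 2 + a, by linarith, (hp _ (by linarith)).mul hG⟩

lemma TameExp.slow_mul {p G : ℝ → ℂ} (hp : SlowExp p) (hG : TameExp ω G) :
    TameExp ω fun t => p t * G t := fun b hb =>
  ((hp ((b - ω) / 2) (by linarith)).mul (hG ((b + ω) / 2) (by linarith))).mono (by linarith)

lemma TameExp.add {G H : ℝ → ℂ} (hG : TameExp ω G) (hH : TameExp ω H) :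
    TameExp ω fun t => G t + H t := fun b hb => (hG b hb).add (hH b hb)

lemma TameExp.sub {G H : ℝ → ℂ} (hG : TameExp ω G) (hH : TameExp ω H) :
    TameExp ω fun t => G t - H t := fun b hb => (hG b hb).sub (hH b hb)

lemma SubExp.deriv_of_landau {G G' G'' : ℝ → ℂ}
    (h1 : ∀ t, HasDerivAt G (G' t) t) (h2 : ∀ t, HasDerivAt G' (G'' t) t) (hG : SubExp ω G)
    (hG'' : TameExp ω G'') : SubExp ω G' := by
  obtain ⟨a, ha, hG⟩ := hG
  exact ⟨(a + (ω + (ω - a) / 2)) / 2, by linarith,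
    hG.deriv_of_landau (by linarith) h1 h2 (hG'' (ω + (ω - a) / 2) (by linarith))⟩

/-- Growth of the solutions of `G'' - G' + q G = r` when `q ~ -ω² e^{2t}`. -/
lemma IsLinearSol.tameExp {q r G G' : ℝ → ℂ} (hω : 0 < ω) {M : ℝ}
    (hq : ∀ t, 0 ≤ t → ‖q t‖ ≤ ω ^ 2 * Real.exp t ^ 2 + M * Real.exp t)
    (h : IsLinearSol q r G G') (hr : TameExp ω r) : TameExp ω G ∧ TameExp ω G' := by
  have hM : ∀ t, 0 ≤ t → ‖q t‖ ≤ ω ^ 2 * Real.exp t ^ 2 + |M| * Real.exp t := fun t ht =>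
    (hq t ht).trans (add_le_add le_rfl (mul_le_mul_of_nonneg_right (le_abs_self _) (Real.exp_nonneg _)))
  -- Energy estimate. The energy is `‖G'‖² + ω²e^{2t}‖G‖²`, and its derivative is at most `2ωe^t +
  -- O(1)` times itself plus `‖r‖²`. The excess `b - ω` absorbs the bounded term.
  have main : ∀ b > ω, ∃ C : ℝ, ∀ᶠ t in atTop,
      ‖G' t‖ ^ 2 + (ω * Real.exp t * ‖G t‖) ^ 2 ≤ C * Real.exp (2 * b * Real.exp t) := by
    intro b hb
    set b₁ := (b + ω) / 2 with hb₁
    obtain ⟨R, hR⟩ := (hr b₁ (by rw [hb₁]; linarith)).bound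
    set C₁ := 3 + 2 * |M| / ω with hC₁
    set N : ℝ → ℝ := fun t => ‖G' t‖ ^ 2 + ω ^ 2 * Real.exp t ^ 2 * ‖G t‖ ^ 2 with hN
    set N' : ℝ → ℝ := fun t => 2 * inner ℝ (G' t) (G' t - q t * G t + r t)
      + (ω ^ 2 * (2 * Real.exp t * Real.exp t) * ‖G t‖ ^ 2
        + ω ^ 2 * Real.exp t ^ 2 * (2 * inner ℝ (G t) (G' t))) with hN'
    have hNd : ∀ t, HasDerivAt N (N' t) t := by
      intro t
      have d1 := (h t).2.norm_sq
      have d2 := (h t).1.norm_sq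
      have d3 := ((Real.hasDerivAt_exp t).pow 2).const_mul (ω ^ 2)
      exact (d1.add (d3.mul d2)).congr_deriv (by simp [hN'])
    have hNb : ∀ t, 0 ≤ t → N' t ≤ (2 * ω * Real.exp t + C₁) * N t + ‖r t‖ ^ 2 := by
      intro t ht
      set x := ‖G' t‖
      set z := ‖G t‖
      set E := Real.exp t
      have hE : 1 ≤ E := Real.one_le_exp ht
      have hx : 0 ≤ x := norm_nonneg _
      have hz : 0 ≤ z := norm_nonneg _
      have i1 : inner ℝ (G' t) (G' t - q t * G t + r t) ≤ x * (x + ‖q t‖ * z + ‖r t‖) := by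
        refine (real_inner_le_norm _ _).trans (mul_le_mul_of_nonneg_left ?_ hx)
        refine (norm_add_le _ _).trans (add_le_add ((norm_sub_le _ _).trans ?_) le_rfl)
        rw [norm_mul]
      have i2 : inner ℝ (G t) (G' t) ≤ z * x := real_inner_le_norm _ _
      have i3 : x * (‖q t‖ * z) ≤ x * ((ω ^ 2 * E ^ 2 + |M| * E) * z) := by
        have := hM t ht
        gcongr
      have i4 : 2 * (x * ‖r t‖) ≤ x ^ 2 + ‖r t‖ ^ 2 := by nlinarith [sq_nonneg (x - ‖r t‖)]
      have i5 : 2 * (x * (ω * E * z)) ≤ x ^ 2 + (ω * E * z) ^ 2 := by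
        nlinarith [sq_nonneg (x - ω * E * z)]
      have i6 : ω ^ 2 * E ^ 2 * (2 * inner ℝ (G t) (G' t)) ≤ ω ^ 2 * E ^ 2 * (2 * (z * x)) := by
        gcongr
      have hK : 0 ≤ |M| / ω := by positivity
      have i7 : 2 * (x * (|M| * E * z)) ≤ |M| / ω * (x ^ 2 + (ω * E * z) ^ 2) := by
        have := mul_le_mul_of_nonneg_left i5 hK
        refine le_trans (le_of_eq ?_) this
        field_simp
      have i8 : 4 * (ω * E) * (x * (ω * E * z)) ≤ 2 * ω * E * (x ^ 2 + (ω * E * z) ^ 2) := by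
        have := mul_le_mul_of_nonneg_left i5 (by positivity : (0 : ℝ) ≤ 2 * (ω * E))
        linarith
      have hy : 0 ≤ (ω * E * z) ^ 2 := by positivity
      have i9 : 0 ≤ |M| / ω * (x ^ 2 + (ω * E * z) ^ 2) := by positivity
      have hNt : N t = x ^ 2 + (ω * E * z) ^ 2 := by simp only [hN, x, z, E]; ring
      have hNt' : N' t ≤ 2 * x ^ 2 + 2 * (x * ((ω ^ 2 * E ^ 2 + |M| * E) * z)) + 2 * (x * ‖r t‖)
          + 2 * (ω * E * z) ^ 2 + ω ^ 2 * E ^ 2 * (2 * (z * x)) := by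
        simp only [hN']
        nlinarith
      rw [hNt, hC₁]
      have hexp : (2 * ω * E + (3 + 2 * |M| / ω)) * (x ^ 2 + (ω * E * z) ^ 2)
          = 2 * ω * E * (x ^ 2 + (ω * E * z) ^ 2) + 3 * (x ^ 2 + (ω * E * z) ^ 2)
            + 2 * (|M| / ω * (x ^ 2 + (ω * E * z) ^ 2)) := by ring
      rw [hexp]
      nlinarith [sq_nonneg x]
    set ε := b - ω with hε
    have hε0 : 0 < ε := by rw [hε]; linarith
    set D := R ^ 2 / ε with hD
    have hlarge : ∀ᶠ t : ℝ in atTop, C₁ ≤ 2 * ε * Real.exp t :=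
      (Real.tendsto_exp_atTop.const_mul_atTop (by linarith : 0 < 2 * ε)).eventually_ge_atTop C₁
    obtain ⟨T, hT⟩ := eventually_atTop.1 ((hR.and hlarge).and (eventually_ge_atTop 0))
    -- The weighted forcing is at most `R²e^{-εe^t} ≤ D e^{-t}`. The added term `D e^{-t}` decreases
    -- fast enough to compensate, so `P` is eventually nonincreasing.
    set P : ℝ → ℝ := fun t => N t * Real.exp (-(2 * b * Real.exp t)) + D * Real.exp (-t) with hP
    set P' : ℝ → ℝ := fun t => N' t * Real.exp (-(2 * b * Real.exp t))
      + N t * (Real.exp (-(2 * b * Real.exp t)) * (-(2 * b * Real.exp t)))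
      + D * (Real.exp (-t) * -1) with hP'
    have hPd : ∀ t, HasDerivAt P (P' t) t := fun t =>
      ((hNd t).mul ((Real.hasDerivAt_exp t).const_mul (2 * b)).neg.exp).add
        ((hasDerivAt_neg t).exp.const_mul D)
    have hPneg : ∀ t, T ≤ t → P' t ≤ 0 := by
      intro t ht
      obtain ⟨⟨hr', hl⟩, ht0⟩ := hT t ht
      have hb' := hNb t ht0
      have hNn : 0 ≤ N t := by simp only [hN]; positivity
      set X := Real.exp (-(2 * b * Real.exp t)) with hX
      have hX0 : 0 < X := Real.exp_pos _
      have r1 : ‖r t‖ ^ 2 * X ≤ R ^ 2 * Real.exp (-(ε * Real.exp t)) := by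
        rw [Real.norm_eq_abs, Real.abs_exp] at hr'
        have := pow_le_pow_left₀ (norm_nonneg _) hr' 2
        refine (mul_le_mul_of_nonneg_right this hX0.le).trans (le_of_eq ?_)
        rw [mul_pow, ← Real.exp_nat_mul, mul_assoc, hX, ← Real.exp_add, hb₁, hε]
        push_cast
        ring_nf
      have r2 : R ^ 2 * Real.exp (-(ε * Real.exp t)) ≤ D * Real.exp (-t) := by
        have := mul_exp_neg_mul_le hε0 (Real.exp t)
        have h3 : Real.exp (-(ε * Real.exp t)) ≤ 1 / ε * Real.exp (-t) := by
          rw [Real.exp_neg t, ← div_eq_mul_inv, le_div_iff₀ (Real.exp_pos t), mul_comm]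
          exact this
        calc _ ≤ R ^ 2 * (1 / ε * Real.exp (-t)) := mul_le_mul_of_nonneg_left h3 (sq_nonneg _)
          _ = _ := by rw [hD]; ring
      have r3 : N' t * X ≤ ((2 * ω * Real.exp t + C₁) * N t + ‖r t‖ ^ 2) * X :=
        mul_le_mul_of_nonneg_right hb' hX0.le
      have r4 : (C₁ - 2 * ε * Real.exp t) * (N t * X) ≤ 0 :=
        mul_nonpos_of_nonpos_of_nonneg (by linarith) (by positivity)
      simp only [hP']
      rw [hε] at r4
      nlinarith
    have hanti : AntitoneOn P (Set.Ici T) := by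
      refine antitoneOn_of_deriv_nonpos (convex_Ici T)
        (fun t _ => (hPd t).continuousAt.continuousWithinAt)
        (fun t _ => (hPd t).differentiableAt.differentiableWithinAt) fun t ht => ?_
      rw [interior_Ici] at ht
      rw [(hPd t).deriv]
      exact hPneg t (le_of_lt ht)
    refine ⟨P T, ?_⟩
    filter_upwards [eventually_ge_atTop T] with t ht
    have h1 := hanti (Set.mem_Ici.2 le_rfl) (Set.mem_Ici.2 ht) ht
    have hD0 : 0 ≤ D * Real.exp (-t) := by rw [hD]; positivity
    have h2 : N t * Real.exp (-(2 * b * Real.exp t)) ≤ P T := by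
      have : P t = N t * Real.exp (-(2 * b * Real.exp t)) + D * Real.exp (-t) := rfl
      linarith
    rw [Real.exp_neg, ← div_eq_mul_inv, div_le_iff₀ (Real.exp_pos _)] at h2
    refine le_trans (le_of_eq ?_) h2
    simp only [hN]; ring
  have conv : ∀ (H : ℝ → ℂ) (k : ℝ), (∀ t, 0 ≤ t → k * ‖H t‖ ^ 2 ≤
      ‖G' t‖ ^ 2 + (ω * Real.exp t * ‖G t‖) ^ 2) → 0 < k → TameExp ω H := by
    intro H k hk hk0 b hb
    obtain ⟨C, hC⟩ := main b hb
    refine IsBigO.of_bound (Real.sqrt (|C| / k)) ?_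
    filter_upwards [hC, eventually_ge_atTop 0] with t ht ht0
    rw [Real.norm_eq_abs, Real.abs_exp]
    refine le_of_sq_le_sq ?_ (by positivity)
    rw [mul_pow, Real.sq_sqrt (by positivity), ← Real.exp_nat_mul, div_mul_eq_mul_div,
      le_div_iff₀ hk0]
    have h1 := (hk t ht0).trans (ht.trans
      (mul_le_mul_of_nonneg_right (le_abs_self C) (Real.exp_nonneg _)))
    push_cast
    rw [show 2 * (b * Real.exp t) = 2 * b * Real.exp t by ring]
    linarith
  refine ⟨conv G (ω ^ 2) (fun t ht => ?_) (by positivity), conv G' 1 (fun t _ => ?_) one_pos⟩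
  · have : (1 : ℝ) ≤ Real.exp t := Real.one_le_exp ht
    have h2 : 1 ≤ Real.exp t ^ 2 := one_le_pow₀ this
    have h3 : 0 ≤ ω ^ 2 * ‖G t‖ ^ 2 := by positivity
    nlinarith [sq_nonneg ‖G' t‖]
  · nlinarith [sq_nonneg (ω * Real.exp t * ‖G t‖)]

end

section

/-! ### Chains of generalized solutions -/

variable {ω : ℝ} {q : ℝ → ℂ}

lemma IsLinearSol.congr {r r' g g' : ℝ → ℂ} (h : IsLinearSol q r g g') (hr : ∀ t, r t = r' t) :
    IsLinearSol q r' g g' := (funext hr : r = r') ▸ h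

lemma IsLinearSol.zero : IsLinearSol q 0 0 0 := fun t =>
  ⟨hasDerivAt_const t 0, (hasDerivAt_const t (0 : ℂ)).congr_deriv (by simp)⟩

lemma IsLinearSol.add {r s g g' f f' : ℝ → ℂ} (hg : IsLinearSol q r g g')
    (hf : IsLinearSol q s f f') : IsLinearSol q (r + s) (g + f) (g' + f') := fun t =>
  ⟨(hg t).1.add (hf t).1, ((hg t).2.add (hf t).2).congr_deriv (by simp only [Pi.add_apply]; ring)⟩

lemma IsLinearSol.smul {r g g' : ℝ → ℂ} (c : ℂ) (hg : IsLinearSol q r g g') :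
    IsLinearSol q (c • r) (c • g) (c • g') := fun t =>
  ⟨(hg t).1.const_smul c,
    ((hg t).2.const_smul c).congr_deriv (by simp only [Pi.smul_apply, smul_eq_mul]; ring)⟩

lemma IsLinearSol.sub {r s g g' f f' : ℝ → ℂ} (hg : IsLinearSol q r g g')
    (hf : IsLinearSol q s f f') : IsLinearSol q (r - s) (g - f) (g' - f') := fun t =>
  ⟨(hg t).1.sub (hf t).1, ((hg t).2.sub (hf t).2).congr_deriv (by simp only [Pi.sub_apply]; ring)⟩

/-- `(D² - D + q)^m G = 0`. -/
def IsPolySol (q : ℝ → ℂ) : ℕ → (ℝ → ℂ) → Prop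
  | 0, G => G = 0
  | m + 1, G => ∃ r G' : ℝ → ℂ, IsLinearSol q r G G' ∧ IsPolySol q m r

/-- `D² - D + q` kills `u 0` and maps `u (j + 1)` to `e j • u j + f j • u (j - 1)`, with `e j ≠ 0`
and `f 0 = 0`. -/
structure IsChain (q : ℝ → ℂ) (e f : ℕ → ℂ) (u u' : ℕ → ℝ → ℂ) : Prop where
  zero : IsLinearSol q 0 (u 0) (u' 0)
  succ : ∀ j, IsLinearSol q (e j • u j + f j • u (j - 1)) (u (j + 1)) (u' (j + 1))
  ne_zero : ∀ j, e j ≠ 0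
  f_zero : f 0 = 0

/-- The span of the first `N` members of a sequence of functions. -/
def spanLT (u : ℕ → ℝ → ℂ) (N : ℕ) : Submodule ℂ (ℝ → ℂ) := Submodule.span ℂ (u '' Set.Iio N)

lemma mem_spanLT {u : ℕ → ℝ → ℂ} {j N : ℕ} (h : j < N) : u j ∈ spanLT u N :=
  Submodule.subset_span ⟨j, h, rfl⟩

lemma spanLT_mono {u : ℕ → ℝ → ℂ} {M N : ℕ} (h : M ≤ N) : spanLT u M ≤ spanLT u N :=
  Submodule.span_mono (Set.image_mono (Set.Iio_subset_Iio h))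

lemma exists_of_mem_spanLT {u : ℕ → ℝ → ℂ} {N : ℕ} {g : ℝ → ℂ} (h : g ∈ spanLT u N) :
    ∃ a : ℕ → ℂ, ∀ t, g t = ∑ j ∈ Finset.range N, a j * u j t := by
  induction h using Submodule.span_induction with
  | mem x hx =>
    obtain ⟨j, hj, rfl⟩ := hx
    refine ⟨Pi.single j 1, fun t => ?_⟩
    rw [Finset.sum_eq_single j (fun i _ hi => by simp [hi])
      (fun h => absurd (Finset.mem_range.2 hj) h)]
    simp
  | zero => exact ⟨0, fun t => by simp⟩
  | add x y _ _ hx hy =>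
    obtain ⟨a, ha⟩ := hx
    obtain ⟨b, hb⟩ := hy
    refine ⟨a + b, fun t => ?_⟩
    rw [Pi.add_apply, ha, hb, ← Finset.sum_add_distrib]
    exact Finset.sum_congr rfl fun j _ => by simp [add_mul]
  | smul c x _ hx =>
    obtain ⟨a, ha⟩ := hx
    refine ⟨c • a, fun t => ?_⟩
    rw [Pi.smul_apply, ha, smul_eq_mul, Finset.mul_sum]
    exact Finset.sum_congr rfl fun j _ => by simp [mul_assoc]

namespace IsChain

variable {e f e₁ f₁ : ℕ → ℂ} {u u' v v' : ℕ → ℝ → ℂ}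

lemma f_smul_mem (hu : IsChain q e f u u') (j : ℕ) : f j • u (j - 1) ∈ spanLT u j := by
  rcases j with _ | j
  · simp [hu.f_zero]
  · exact Submodule.smul_mem _ _ (mem_spanLT (by simp))

lemma exists_image (hu : IsChain q e f u u') {N : ℕ} {g : ℝ → ℂ} (hg : g ∈ spanLT u (N + 1)) :
    ∃ r ∈ spanLT u N, ∃ g', IsLinearSol q r g g' := by
  induction hg using Submodule.span_induction with
  | mem x hx =>
    obtain ⟨j, hj, rfl⟩ := hx
    rcases j with _ | j
    · exact ⟨0, Submodule.zero_mem _, _, hu.zero⟩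
    · have hj' : j < N := Nat.lt_of_succ_lt_succ hj
      exact ⟨_, Submodule.add_mem _ (Submodule.smul_mem _ _ (mem_spanLT hj'))
        (spanLT_mono hj'.le (hu.f_smul_mem j)), _, hu.succ j⟩
  | zero => exact ⟨0, Submodule.zero_mem _, 0, IsLinearSol.zero⟩
  | add x y _ _ hx hy =>
    obtain ⟨r, hr, x', hx⟩ := hx
    obtain ⟨s, hs, y', hy⟩ := hy
    exact ⟨_, Submodule.add_mem _ hr hs, _, hx.add hy⟩
  | smul c x _ hx =>
    obtain ⟨r, hr, x', hx⟩ := hx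
    exact ⟨_, Submodule.smul_mem _ c hr, _, hx.smul c⟩

/-- Inside the span of a chain the operator can be inverted at the price of one more member: divide
by `e j` after subtracting a preimage of the lower term `f j • u (j - 1)`. -/
lemma exists_preimage (hu : IsChain q e f u u') {N : ℕ} {r : ℝ → ℂ} (hr : r ∈ spanLT u N) :
    ∃ g ∈ spanLT u (N + 1), ∃ g', IsLinearSol q r g g' := by
  induction N generalizing r with
  | zero =>
    obtain rfl : r = 0 := by simpa [spanLT] using hr
    exact ⟨0, Submodule.zero_mem _, 0, IsLinearSol.zero⟩
  | succ N ih =>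
    induction hr using Submodule.span_induction with
    | mem x hx =>
      obtain ⟨j, hj, rfl⟩ := hx
      obtain ⟨g, hg, g', hg'⟩ := ih (spanLT_mono (Nat.le_of_lt_succ hj) (hu.f_smul_mem j))
      refine ⟨(e j)⁻¹ • (u (j + 1) - g), Submodule.smul_mem _ _ (Submodule.sub_mem _
        (mem_spanLT (Nat.succ_lt_succ hj)) (spanLT_mono (Nat.le_succ _) hg)), _,
        (((hu.succ j).sub hg').smul (e j)⁻¹).congr fun t => ?_⟩
      have := hu.ne_zero j
      simp only [Pi.smul_apply, Pi.sub_apply, Pi.add_apply, smul_eq_mul]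
      field_simp
      ring
    | zero => exact ⟨0, Submodule.zero_mem _, 0, IsLinearSol.zero⟩
    | add x y _ _ hx hy =>
      obtain ⟨r, hr, x', hx⟩ := hx
      obtain ⟨s, hs, y', hy⟩ := hy
      exact ⟨_, Submodule.add_mem _ hr hs, _, hx.add hy⟩
    | smul c x _ hx =>
      obtain ⟨r, hr, x', hx⟩ := hx
      exact ⟨_, Submodule.smul_mem _ c hr, _, hx.smul c⟩

/-- Two chains with linearly independent first members span the solutions of
`(D² - D + q)^m G = 0`. -/
theorem exists_expansion (hu : IsChain q e f u u') (hv : IsChain q e₁ f₁ v v') {W : ℂ} (hW : W ≠ 0)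
    (hwr : ∀ t : ℝ, exp (-t) * (u 0 t * v' 0 t - u' 0 t * v 0 t) = W) {m : ℕ} {G : ℝ → ℂ}
    (hG : IsPolySol q m G) : ∃ a b : ℕ → ℂ, ∀ t,
      G t = ∑ j ∈ Finset.range m, (a j * u j t + b j * v j t) := by
  have main : ∃ g ∈ spanLT u m, ∃ h ∈ spanLT v m, G = g + h := by
    induction m generalizing G with
    | zero => exact ⟨0, Submodule.zero_mem _, 0, Submodule.zero_mem _, by simpa [IsPolySol] using hG⟩
    | succ m ih =>
      obtain ⟨r, G', hlin, hr⟩ := hG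
      obtain ⟨g, hg, h, hh, rfl⟩ := ih hr
      -- Particular solutions are taken from the two spans; what remains solves the homogeneous
      -- equation and is a combination of `u 0` and `v 0`.
      obtain ⟨p, hp, p', hp'⟩ := hu.exists_preimage hg
      obtain ⟨s, hs, s', hs'⟩ := hv.exists_preimage hh
      obtain ⟨α, β, hαβ⟩ := hu.zero.exists_combination hv.zero
        ((hlin.sub (hp'.add hs')).congr (r' := 0) fun t => by simp) hW hwr
      refine ⟨p + α • u 0, Submodule.add_mem _ hp (Submodule.smul_mem _ _ (mem_spanLT m.succ_pos)),
        s + β • v 0, Submodule.add_mem _ hs (Submodule.smul_mem _ _ (mem_spanLT m.succ_pos)),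
        funext fun t => ?_⟩
      have := hαβ t
      simp only [Pi.sub_apply, Pi.add_apply, Pi.smul_apply, smul_eq_mul] at this ⊢
      linear_combination this
  obtain ⟨g, hg, h, hh, rfl⟩ := main
  obtain ⟨a, ha⟩ := exists_of_mem_spanLT hg
  obtain ⟨b, hb⟩ := exists_of_mem_spanLT hh
  exact ⟨a, b, fun t => by rw [Pi.add_apply, ha, hb, Finset.sum_add_distrib]⟩

end IsChain

/-! ### Uniqueness among functions of moderate growth -/

/-- The growth conditions on the coefficient `q ~ -ω² e^{2t}`. -/
structure IsExpPotential (ω : ℝ) (q q' : ℝ → ℂ) : Prop where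
  pos : 0 < ω
  hasDerivAt : ∀ t, HasDerivAt q (q' t) t
  slow : SlowExp q
  slow_deriv : SlowExp q'
  bound : ∃ M : ℝ, ∀ t, 0 ≤ t → ‖q t‖ ≤ ω ^ 2 * Real.exp t ^ 2 + M * Real.exp t

lemma TameExp.zero : TameExp ω 0 := fun _ _ => isBigO_zero _ _

variable {q' : ℝ → ℂ}

lemma IsExpPotential.tameExp (hq : IsExpPotential ω q q') {r G G' : ℝ → ℂ}
    (h : IsLinearSol q r G G') (hr : TameExp ω r) : TameExp ω G ∧ TameExp ω G' :=
  have ⟨_, hM⟩ := hq.bound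
  h.tameExp hq.pos hM hr

lemma IsExpPotential.subExp_deriv (hq : IsExpPotential ω q q') {r G G' : ℝ → ℂ}
    (h : IsLinearSol q r G G') (hr : TameExp ω r) (hG : SubExp ω G) : SubExp ω G' :=
  hG.deriv_of_landau (fun t => (h t).1) (fun t => (h t).2)
    (((hq.tameExp h hr).2.sub (TameExp.slow_mul hq.slow (hq.tameExp h hr).1)).add hr)

/-- The operator `D² - D + q` preserves growth below `e^{ω e^t}`. -/
lemma IsExpPotential.subExp_image (hq : IsExpPotential ω q q') {r r' G G' : ℝ → ℂ}
    (h : IsLinearSol q r G G') (hr : TameExp ω r) (hr' : TameExp ω r')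
    (hd : ∀ t, HasDerivAt r (r' t) t) (hG : SubExp ω G) : SubExp ω r := by
  have hG' := hq.subExp_deriv h hr hG
  obtain ⟨tG, tG'⟩ := hq.tameExp h hr
  -- This function is the derivative of `G' - G`, whose growth is below the threshold. A second use
  -- of Landau's inequality applies because the next derivative is tame.
  have hZ : SubExp ω fun t => r t - q t * G t := by
    refine (hG'.sub hG).deriv_of_landau (fun t => ((h t).2.sub (h t).1).congr_deriv (by ring))
      (fun t => (hd t).sub ((hq.hasDerivAt t).mul (h t).1))
      (hr'.sub ((TameExp.slow_mul hq.slow_deriv tG).add (TameExp.slow_mul hq.slow tG')))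
  refine (funext fun t => ?_ : r = _) ▸ hZ.add (SubExp.slow_mul hq.slow hG)
  ring

/-- A solution dominating a decaying solution grows like `e^{ω e^t}`. -/
lemma IsExpPotential.not_subExp (hq : IsExpPotential ω q q') {u u' v v' : ℝ → ℂ}
    (hu : IsLinearSol q 0 u u') (hv : IsLinearSol q 0 v v') {W : ℂ} (hW : W ≠ 0)
    (hwr : ∀ t : ℝ, exp (-t) * (u t * v' t - u' t * v t) = W)
    (hdec : ∀ b < ω, ExpBigO (-b) u) : ¬ SubExp ω v := by
  intro hs
  have hs' := hq.subExp_deriv hv TameExp.zero hs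
  have lim : ∀ g : ℝ → ℂ, SubExp ω g → Tendsto (fun t : ℝ => exp (-t) * (u t * g t)) atTop (𝓝 0) := by
    intro g hg
    obtain ⟨a, ha, hg⟩ := hg
    have h1 : ExpBigO (-((a + ω) / 2) + a) fun t => u t * g t :=
      (hdec ((a + ω) / 2) (by linarith)).mul hg
    have h2 : Tendsto (fun t : ℝ => Real.exp ((-((a + ω) / 2) + a) * Real.exp t)) atTop (𝓝 0) := by
      refine Real.tendsto_exp_atBot.comp ?_
      exact Real.tendsto_exp_atTop.const_mul_atTop_of_neg (by linarith)
    have h3 : Tendsto (fun t : ℝ => exp (-(t : ℂ))) atTop (𝓝 0) := by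
      rw [tendsto_zero_iff_norm_tendsto_zero]
      simpa [Complex.norm_exp] using Real.tendsto_exp_neg_atTop_nhds_zero
    simpa using h3.mul (h1.trans_tendsto h2)
  set P : ℝ → ℂ := fun t => exp (-t) * (u t * v t) with hP
  -- Eliminating `u'` through the Wronskian gives `(P + tW)' = S`. If `v` grew slowly, both `P` and
  -- `S` would tend to `0`, so the increment of `P + tW` over a unit interval would contradict `W ≠
  -- 0`. No bound on `u'` is used.
  set S : ℝ → ℂ := fun t => 2 * (exp (-t) * (u t * v' t)) - exp (-t) * (u t * v t) with hS
  have hd : ∀ t : ℝ, HasDerivAt (fun t : ℝ => P t + t * W) (S t) t := by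
    intro t
    have he : HasDerivAt (fun t : ℝ => exp (-t)) (exp (-t) * (-1)) t :=
      (hasDerivAt_neg (t : ℂ)).cexp.comp_ofReal
    refine ((he.mul ((hu t).1.mul (hv t).1)).add
      (((hasDerivAt_id t).ofReal_comp).mul_const W)).congr_deriv ?_
    simp only [hS, ← hwr t, ofReal_one, Pi.mul_apply]
    ring
  have hS0 : Tendsto S atTop (𝓝 0) := by
    simpa using ((lim v' hs').const_mul 2).sub (lim v hs)
  have hW0 : 0 < ‖W‖ / 4 := by positivity
  obtain ⟨T, hT⟩ := eventually_atTop.1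
    (((tendsto_zero_iff_norm_tendsto_zero.1 hS0).eventually (gt_mem_nhds hW0)).and
      ((tendsto_zero_iff_norm_tendsto_zero.1 (lim v hs)).eventually (gt_mem_nhds hW0)))
  have h1 := (convex_Ici T).norm_image_sub_le_of_norm_hasDerivWithin_le
    (fun x _ => (hd x).hasDerivWithinAt) (fun x hx => (hT x hx).1.le)
    (Set.mem_Ici.2 le_rfl) (Set.mem_Ici.2 (by linarith : T ≤ T + 1))
  rw [add_sub_cancel_left, norm_one, mul_one] at h1
  have h2 := (hT T le_rfl).2
  have h3 := (hT (T + 1) (by linarith)).2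
  have h4 : W = (P (T + 1) + ((T + 1 : ℝ) : ℂ) * W - (P T + T * W)) - P (T + 1) + P T := by
    push_cast; ring
  have h5 : ‖W‖ ≤ ‖W‖ / 4 + ‖P (T + 1)‖ + ‖P T‖ := by
    conv_lhs => rw [h4]
    exact (norm_add_le _ _).trans (add_le_add ((norm_sub_le _ _).trans (add_le_add h1 le_rfl)) le_rfl)
  linarith

namespace IsChain

variable {e f e₁ f₁ : ℕ → ℂ} {u u' v v' : ℕ → ℝ → ℂ}

/-- The operator sends the span of `N + 1` members into that of `N`, so the energy estimate can be
applied inductively with a forcing already known to be tame. -/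
lemma tameExp (hu : IsChain q e f u u') (hq : IsExpPotential ω q q') {N : ℕ} {g : ℝ → ℂ}
    (hg : g ∈ spanLT u N) : TameExp ω g ∧ ∃ g', (∀ t, HasDerivAt g (g' t) t) ∧ TameExp ω g' := by
  induction N generalizing g with
  | zero =>
    have : g = 0 := by simpa [spanLT] using hg
    exact this ▸ ⟨TameExp.zero, 0, fun t => hasDerivAt_const t 0, TameExp.zero⟩
  | succ N ih =>
    obtain ⟨r, hr, g', h⟩ := hu.exists_image hg
    have := hq.tameExp h (ih hr).1
    exact ⟨this.1, g', fun t => (h t).1, this.2⟩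

/-- A nontrivial combination of a chain whose first member is dominant is dominant. -/
lemma coeff_top_eq_zero (hv : IsChain q e f v v') (hq : IsExpPotential ω q q')
    (h0 : ¬ SubExp ω (v 0)) (J : ℕ) {c : ℂ} {w : ℝ → ℂ} (hw : w ∈ spanLT v J)
    (h : SubExp ω (c • v J + w)) : c = 0 := by
  induction J generalizing c w with
  | zero =>
    have : w = 0 := by simpa [spanLT] using hw
    rw [this, add_zero] at h
    by_contra hc
    refine h0 ?_
    have := h.const_mul c⁻¹
    refine (funext fun t => ?_ : v 0 = _) ▸ this
    simp [hc]
  | succ J ih =>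
    -- Applying the operator lowers the top index by one and multiplies its coefficient by the
    -- nonzero `e J`, while growth below the threshold is preserved.
    obtain ⟨r, hr, w', hlin⟩ := hv.exists_image hw
    have hs := ((hv.succ J).smul c).add hlin
    have hmem : c • f J • v (J - 1) + r ∈ spanLT v J :=
      Submodule.add_mem _ (Submodule.smul_mem _ _ (hv.f_smul_mem J)) hr
    have heq : c • (e J • v J + f J • v (J - 1)) + r
        = (c * e J) • v J + (c • f J • v (J - 1) + r) := by
      rw [smul_add, smul_smul, add_assoc]
    rw [heq] at hs
    obtain ⟨ht, r', hd, ht'⟩ := hv.tameExp hq (Submodule.add_mem _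
      (Submodule.smul_mem (spanLT v (J + 1)) (c * e J) (mem_spanLT J.lt_succ_self))
      (spanLT_mono J.le_succ hmem))
    exact (mul_eq_zero.1 (ih hmem (hq.subExp_image hs ht ht' hd h))).resolve_right (hv.ne_zero J)

lemma coeff_eq_zero (hv : IsChain q e f v v') (hq : IsExpPotential ω q q')
    (h0 : ¬ SubExp ω (v 0)) {m : ℕ} {b : ℕ → ℂ}
    (h : SubExp ω fun t => ∑ j ∈ Finset.range m, b j * v j t) : ∀ j < m, b j = 0 := by
  induction m with
  | zero => intro j hj; omega
  | succ m ih =>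
    have hb : b m = 0 := by
      refine hv.coeff_top_eq_zero hq h0 m (w := ∑ j ∈ Finset.range m, b j • v j)
        (Submodule.sum_mem _ fun j hj =>
          Submodule.smul_mem _ _ (mem_spanLT (Finset.mem_range.1 hj))) ?_
      refine (funext fun t => ?_ : b m • v m + ∑ j ∈ Finset.range m, b j • v j = _) ▸ h
      simp [Finset.sum_range_succ, add_comm]
    simp only [Finset.sum_range_succ, hb, zero_mul, add_zero] at h
    intro j hj
    rcases Nat.lt_succ_iff_lt_or_eq.1 hj with h' | rfl
    · exact ih h j h'
    · exact hb

/-- In an expansion of a function growing less than `e^{ω e^t}` along a decaying and a growing chain,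
the growing chain does not occur. -/
theorem coeff_eq_zero_of_subExp (hu : IsChain q e f u u') (hv : IsChain q e₁ f₁ v v')
    (hq : IsExpPotential ω q q') {W : ℂ} (hW : W ≠ 0)
    (hwr : ∀ t : ℝ, exp (-t) * (u 0 t * v' 0 t - u' 0 t * v 0 t) = W)
    (hdec : ∀ j, ∀ b < ω, ExpBigO (-b) (u j)) {m : ℕ} {a b : ℕ → ℂ}
    (h : SubExp ω fun t => ∑ j ∈ Finset.range m, (a j * u j t + b j * v j t)) :
    ∀ j < m, b j = 0 := by
  refine hv.coeff_eq_zero hq (hq.not_subExp hu.zero hv.zero hW hwr (hdec 0)) ?_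
  -- The decaying chain lies below the threshold by itself, so subtracting it leaves a purely
  -- growing combination to which the previous lemma applies.
  have hsub : SubExp ω fun t => ∑ j ∈ Finset.range m, a j * u j t :=
    SubExp.sum _ fun j _ => SubExp.const_mul _
      ⟨-(ω / 2), by linarith [hq.pos], hdec j _ (by linarith [hq.pos])⟩
  refine (funext fun t => ?_ : (fun t => ∑ j ∈ Finset.range m, b j * v j t) = _) ▸ h.sub hsub
  rw [Finset.sum_add_distrib]
  ring

end IsChain

end

section

/-! ### Chains of parameter derivatives -/

/-- The relations satisfied by the `μ`-derivatives of a family of solutions of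
`g'' - g' + q g = 0`, when `q` depends on `μ` through `-μ²`. -/
def IsParamFamily (q : ℝ → ℂ) (μ : ℂ) (D D' : ℕ → ℝ → ℂ) : Prop :=
  ∀ j : ℕ, IsLinearSol q (fun t => 2 * μ * j * D (j - 1) t + j * (j - 1) * D (j - 2) t) (D j) (D' j)

variable {q : ℝ → ℂ} {μ : ℂ} {D D' : ℕ → ℝ → ℂ}

lemma IsParamFamily.isChain (h : IsParamFamily q μ D D') (hμ : μ ≠ 0) :
    IsChain q (fun j => 2 * μ * (j + 1)) (fun j => (j + 1) * j) D D' where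
  zero := (h 0).congr fun t => by simp
  succ j := (h (j + 1)).congr fun t => by
    simp only [Pi.add_apply, Pi.smul_apply, smul_eq_mul, Nat.add_sub_cancel]
    push_cast
    ring
  ne_zero j := mul_ne_zero (mul_ne_zero two_ne_zero hμ) (Nat.cast_add_one_ne_zero j)
  f_zero := by simp

/-- At `μ = 0` the operator sends `D j` to `j(j-1) D (j-2)`, so the family splits into two chains by
parity `p`. The power functions use both parities, the Whittaker functions only the even one. -/
lemma IsParamFamily.isChain_of_eq_zero (h : IsParamFamily q 0 D D') {p : ℕ} (hp : p < 2) :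
    IsChain q (fun j => (2 * j + p + 2) * (2 * j + p + 1)) 0 (fun j => D (2 * j + p))
      (fun j => D' (2 * j + p)) where
  zero := (h (2 * 0 + p)).congr fun t => by
    interval_cases p <;> simp
  succ j := (h (2 * (j + 1) + p)).congr fun t => by
    simp only [Pi.add_apply, Pi.smul_apply, smul_eq_mul, Pi.zero_apply, zero_smul]
    rw [show 2 * (j + 1) + p - 2 = 2 * j + p by omega]
    push_cast
    ring
  ne_zero j := by
    have h1 : ((2 * j + p + 2 : ℕ) : ℂ) ≠ 0 := Nat.cast_ne_zero.2 (by omega)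
    have h2 : ((2 * j + p + 1 : ℕ) : ℂ) ≠ 0 := Nat.cast_ne_zero.2 (by omega)
    push_cast at h1 h2
    exact mul_ne_zero h1 h2
  f_zero := rfl

/-- Only the even derivatives are used at `μ = 0`. -/
def chainIndex (μ : ℂ) (j : ℕ) : ℕ :=
  open scoped Classical in if μ = 0 then 2 * j else j

lemma chainIndex_zero (μ : ℂ) : chainIndex μ 0 = 0 := by simp [chainIndex]

lemma IsParamFamily.exists_isChain (h : IsParamFamily q μ D D') :
    ∃ e f, IsChain q e f (fun j => D (chainIndex μ j)) (fun j => D' (chainIndex μ j)) := by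
  by_cases hμ : μ = 0
  · subst hμ
    simp only [chainIndex, if_true]
    exact ⟨_, _, h.isChain_of_eq_zero two_pos⟩
  · simp only [chainIndex, if_neg hμ]
    exact ⟨_, _, h.isChain hμ⟩

/-! ### The Whittaker chains -/

/-- The coefficient of Whittaker's equation in the variable `t`, where `z = c e^t`. -/
def whittakerPotential (κ μ : ℂ) (c : ℝ) (t : ℝ) : ℂ :=
  1 / 4 - μ ^ 2 + κ * (c * exp t) - (c * exp t) ^ 2 / 4

/-- The complex shift `L` serves both families: `log c` for `W`, and `log c + πi` with `-κ` in place
of `κ` for the rotated function. -/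
lemma isParamFamily_whittakerWDeriv (κ μ L : ℂ) {q : ℝ → ℂ}
    (hq : ∀ t : ℝ, q t = 1 / 4 - μ ^ 2 + κ * exp (t + L) - exp (t + L) ^ 2 / 4) :
    IsParamFamily q μ (fun j t => whittakerWDeriv κ μ j (t + L))
      (fun j t => deriv (whittakerWDeriv κ μ j) (t + L)) := by
  intro j t
  obtain ⟨U', hU⟩ := whittakerWDeriv_ode κ μ j
  have hd : deriv (whittakerWDeriv κ μ j) = U' := funext fun w => (hU w).1.deriv
  simp only [hd]
  have h1 := ((hU (t + L)).1.comp_add_const (t : ℂ) L).comp_ofReal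
  have h2 := ((hU (t + L)).2.comp_add_const (t : ℂ) L).comp_ofReal
  exact ⟨h1, h2.congr_deriv (by rw [hq])⟩

lemma slowExp_of_le_exp {A C : ℝ} {p : ℝ → ℂ} (hp : ∀ t, 0 ≤ t → ‖p t‖ ≤ C * Real.exp (A * t)) :
    SlowExp p := fun _ hε => expBigO_of_le_exp hε hp

lemma isExpPotential_whittakerPotential (κ μ : ℂ) {c : ℝ} (hc : 0 < c) :
    IsExpPotential (c / 2) (whittakerPotential κ μ c)
      (fun t => κ * (c * exp t) - (c * exp t) ^ 2 / 2) := by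
  have hn : ∀ t : ℝ, ‖(c : ℂ) * exp t‖ = c * Real.exp t := fun t => by
    rw [norm_mul, norm_real, Real.norm_of_nonneg hc.le, Complex.norm_exp, ofReal_re]
  have hb : ∀ t : ℝ, 0 ≤ t → ‖whittakerPotential κ μ c t‖ ≤
      (c / 2) ^ 2 * Real.exp t ^ 2 + (‖1 / 4 - μ ^ 2‖ + ‖κ‖ * c) * Real.exp t := by
    intro t ht
    have n1 := norm_sub_le (1 / 4 - μ ^ 2 + κ * (c * exp t)) ((c * exp t) ^ 2 / 4)
    have n2 := norm_add_le (1 / 4 - μ ^ 2) (κ * (c * exp t))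
    rw [norm_div _ (4 : ℂ), norm_pow, hn, Complex.norm_ofNat] at n1
    rw [norm_mul, hn] at n2
    have n3 : ‖1 / 4 - μ ^ 2‖ ≤ ‖1 / 4 - μ ^ 2‖ * Real.exp t :=
      le_mul_of_one_le_right (norm_nonneg _) (Real.one_le_exp ht)
    rw [whittakerPotential]
    linarith
  have hexp : ∀ t : ℝ, Real.exp (2 * t) = Real.exp t ^ 2 := fun t => by
    rw [← Real.exp_nat_mul]; norm_num
  refine ⟨by positivity, fun t => ?_, slowExp_of_le_exp (A := 2)
    (C := (c / 2) ^ 2 + (‖1 / 4 - μ ^ 2‖ + ‖κ‖ * c)) fun t ht => ?_,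
    slowExp_of_le_exp (A := 2) (C := ‖κ‖ * c + c ^ 2) fun t ht => ?_, _, hb⟩
  · have he : HasDerivAt (fun t : ℝ => (c : ℂ) * exp t) (c * exp t) t :=
      ((hasDerivAt_exp (t : ℂ)).const_mul (c : ℂ)).comp_ofReal
    refine (((he.const_mul κ).const_add (1 / 4 - μ ^ 2)).sub ((he.pow 2).div_const 4)).congr_deriv ?_
    simp only [Nat.add_one_sub_one, pow_one]
    push_cast
    ring
  · rw [hexp]
    have h1 := Real.one_le_exp ht
    have h2 : Real.exp t ≤ Real.exp t ^ 2 := le_self_pow₀ h1 two_ne_zero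
    have h3 := mul_le_mul_of_nonneg_left h2
      (by positivity : 0 ≤ ‖1 / 4 - μ ^ 2‖ + ‖κ‖ * c)
    linarith [hb t ht]
  · rw [hexp]
    have h1 := Real.one_le_exp ht
    have h2 : Real.exp t ≤ Real.exp t ^ 2 := le_self_pow₀ h1 two_ne_zero
    have n1 := norm_sub_le (κ * (c * exp t)) ((c * exp t) ^ 2 / 2)
    rw [norm_div _ (2 : ℂ), norm_pow, hn, Complex.norm_ofNat, norm_mul, hn] at n1
    have h3 := mul_le_mul_of_nonneg_left h2 (by positivity : 0 ≤ ‖κ‖ * c)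
    have h4 : 0 ≤ c ^ 2 * Real.exp t ^ 2 := by positivity
    linarith

lemma expBigO_whittakerWDeriv (κ μ : ℂ) (j : ℕ) {c b : ℝ} (hc : 0 < c) (hb : b < c / 2) :
    ExpBigO (-b) fun t : ℝ => whittakerWDeriv κ μ j (t + (Real.log c : ℂ)) := by
  obtain ⟨C, hC⟩ := whittakerWDeriv_decay κ μ j (b := b / c) (by rw [div_lt_iff₀ hc]; linarith)
  refine IsBigO.of_bound C ?_
  filter_upwards [eventually_ge_atTop (-Real.log c)] with t ht
  have := hC (t + Real.log c) (by linarith)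
  rw [Real.exp_add, Real.exp_log hc] at this
  rw [Real.norm_eq_abs, Real.abs_exp]
  push_cast at this
  convert this using 3
  field_simp

/-- The functions `∂^j/∂μ^j W_{κ,μ}(c e^t)` and `∂^j/∂μ^j W_{-κ,μ}(c e^{t + π i})` span the solutions
of the iterated Whittaker equation, and the latter do not contribute to solutions of moderate
growth. -/
theorem whittaker_expansion (κ μ : ℂ) {c : ℝ} (hc : 0 < c) (m : ℕ) :
    (∀ G, IsPolySol (whittakerPotential κ μ c) m G → ∃ a b : ℕ → ℂ, ∀ t : ℝ,
      G t = ∑ j ∈ Finset.range m,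
        (a j * whittakerWDeriv κ μ (chainIndex μ j) (t + (Real.log c : ℂ))
          + b j * whittakerWDeriv (-κ) μ (chainIndex μ j) (t + (Real.log c + Real.pi * I)))) ∧
    ∀ a b : ℕ → ℂ, (SubExp (c / 2) fun t : ℝ => ∑ j ∈ Finset.range m,
        (a j * whittakerWDeriv κ μ (chainIndex μ j) (t + (Real.log c : ℂ))
          + b j * whittakerWDeriv (-κ) μ (chainIndex μ j) (t + (Real.log c + Real.pi * I)))) →
      ∀ j < m, b j = 0 := by
  have hlog : ∀ t : ℝ, exp (t + (Real.log c : ℂ)) = c * exp t := fun t => by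
    rw [Complex.exp_add, ← ofReal_exp (Real.log c), Real.exp_log hc, mul_comm]
  have hlog' : ∀ t : ℝ, exp (t + (Real.log c + Real.pi * I)) = -(c * exp t) := fun t => by
    rw [← add_assoc, Complex.exp_add, exp_pi_mul_I, hlog]; ring
  obtain ⟨e, f, hu⟩ := (isParamFamily_whittakerWDeriv κ μ (Real.log c)
    (q := whittakerPotential κ μ c) fun t => by rw [hlog, whittakerPotential]).exists_isChain
  obtain ⟨e₁, f₁, hv⟩ := (isParamFamily_whittakerWDeriv (-κ) μ (Real.log c + Real.pi * I)
    (q := whittakerPotential κ μ c) fun t => by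
      rw [hlog', whittakerPotential]; ring).exists_isChain
  -- The factor `c` arises because the Wronskian is normalized by `e^{-t}` here, but by `e^{-w}`
  -- with `w = t + log c` before.
  have hW : (c : ℂ) * exp (-Real.pi * I * κ) ≠ 0 :=
    mul_ne_zero (ofReal_ne_zero.2 hc.ne') (exp_ne_zero _)
  have hD : ∀ κ, whittakerWDeriv κ μ 0 = whittakerWLog κ μ := fun κ => funext fun w => by
    simp [whittakerWDeriv]
  have hwr : ∀ t : ℝ, exp (-t) *
      (whittakerWDeriv κ μ (chainIndex μ 0) (t + (Real.log c : ℂ))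
          * deriv (whittakerWDeriv (-κ) μ (chainIndex μ 0)) (t + (Real.log c + Real.pi * I))
        - deriv (whittakerWDeriv κ μ (chainIndex μ 0)) (t + (Real.log c : ℂ))
          * whittakerWDeriv (-κ) μ (chainIndex μ 0) (t + (Real.log c + Real.pi * I)))
      = c * exp (-Real.pi * I * κ) := by
    intro t
    rw [chainIndex_zero, hD, hD, ← whittakerWLog_wronskian κ μ (t + (Real.log c : ℂ)), ← mul_assoc,
      add_assoc, neg_add, Complex.exp_add, exp_neg (Real.log c : ℂ), ← ofReal_exp (Real.log c),
      Real.exp_log hc]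
    have : (c : ℂ) ≠ 0 := ofReal_ne_zero.2 hc.ne'
    field_simp
  refine ⟨fun G hG => hu.exists_expansion hv hW hwr hG, fun a b h => ?_⟩
  exact hu.coeff_eq_zero_of_subExp hv (isExpPotential_whittakerPotential κ μ hc) hW hwr
    (fun j b hb => expBigO_whittakerWDeriv κ μ _ hc hb) h

/-! ### The power chains -/

/-- The functions `t^j e^{(μ + 1/2) t}`. -/
def powChain (μ : ℂ) (j : ℕ) (t : ℝ) : ℂ := t ^ j * exp ((μ + 1 / 2) * t)

/-- The derivative of `powChain`. -/
def powChain' (μ : ℂ) (j : ℕ) (t : ℝ) : ℂ := j * powChain μ (j - 1) t + (μ + 1 / 2) * powChain μ j t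

lemma hasDerivAt_powChain (μ : ℂ) (j : ℕ) (t : ℝ) :
    HasDerivAt (powChain μ j) (powChain' μ j t) t := by
  have h1 : HasDerivAt (fun t : ℂ => t ^ j * exp ((μ + 1 / 2) * t)) _ (t : ℂ) :=
    (hasDerivAt_pow j (t : ℂ)).mul (((hasDerivAt_id (t : ℂ)).const_mul (μ + 1 / 2)).cexp)
  refine h1.comp_ofReal.congr_deriv ?_
  simp only [powChain', powChain, id]
  ring

lemma isParamFamily_powChain {μ : ℂ} {q : ℝ → ℂ} (hq : ∀ t, q t = 1 / 4 - μ ^ 2) :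
    IsParamFamily q μ (powChain μ) (powChain' μ) := by
  intro j t
  refine ⟨hasDerivAt_powChain μ j t, (((hasDerivAt_powChain μ (j - 1) t).const_mul (j : ℂ)).add
    ((hasDerivAt_powChain μ j t).const_mul (μ + 1 / 2))).congr_deriv ?_⟩
  rw [hq]
  rcases j with _ | j
  · simp [powChain']; ring
  · simp only [powChain', Nat.add_sub_cancel, show j + 1 - 2 = j - 1 by omega]
    push_cast
    ring

/-- The solutions of the iterated Euler equation, distinct exponents. -/
theorem powChain_expansion {μ : ℂ} (hμ : μ ≠ 0) {q : ℝ → ℂ} (hq : ∀ t, q t = 1 / 4 - μ ^ 2) {m : ℕ}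
    {G : ℝ → ℂ} (hG : IsPolySol q m G) : ∃ a b : ℕ → ℂ, ∀ t,
      G t = ∑ j ∈ Finset.range m, (a j * powChain (-μ) j t + b j * powChain μ j t) := by
  refine ((isParamFamily_powChain (μ := -μ) (q := q) (by simpa using hq)).isChain
    (neg_ne_zero.2 hμ)).exists_expansion ((isParamFamily_powChain hq).isChain hμ)
    (W := 2 * μ) (mul_ne_zero two_ne_zero hμ) (fun t => ?_) hG
  have h : exp (-(t : ℂ)) * (exp ((-μ + 1 / 2) * t) * exp ((μ + 1 / 2) * t)) = 1 := by
    rw [← Complex.exp_add, ← Complex.exp_add, Complex.exp_eq_one_iff]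
    exact ⟨0, by push_cast; ring⟩
  simp only [powChain', powChain]
  push_cast
  linear_combination (2 * μ) * h

/-- The solutions of the iterated Euler equation, equal exponents. -/
theorem powChain_expansion_zero {q : ℝ → ℂ} (hq : ∀ t, q t = 1 / 4) {m : ℕ} {G : ℝ → ℂ}
    (hG : IsPolySol q m G) : ∃ a b : ℕ → ℂ, ∀ t,
      G t = ∑ j ∈ Finset.range m, (a j * powChain 0 (2 * j) t + b j * powChain 0 (2 * j + 1) t) := by
  have hf : IsParamFamily q 0 (powChain 0) (powChain' 0) := isParamFamily_powChain (by simpa using hq)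
  refine (hf.isChain_of_eq_zero (p := 0) two_pos).exists_expansion
    (hf.isChain_of_eq_zero (p := 1) one_lt_two) one_ne_zero (fun t => ?_) hG
  have h : exp (-(t : ℂ)) * (exp ((0 + 1 / 2) * t) * exp ((0 + 1 / 2) * t)) = 1 := by
    rw [← Complex.exp_add, ← Complex.exp_add, Complex.exp_eq_one_iff]
    exact ⟨0, by push_cast; ring⟩
  simp only [powChain', powChain]
  push_cast
  simp only [zero_add, pow_zero, pow_one]
  simp only [zero_add] at h
  linear_combination h

end

/-! ### Separation of variables -/

/-- The function `h(y) e^{2π i n x}`. -/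
def fourierTerm (n : ℤ) (h : ℝ → ℂ) (z : ℍ) : ℂ := h z.im * exp (2 * Real.pi * I * n * z.re)

lemma fourierTerm_ofComplex (n : ℤ) (h : ℝ → ℂ) {w : ℂ} (hw : 0 < w.im) :
    fourierTerm n h (UpperHalfPlane.ofComplex w) = h w.im * exp (2 * Real.pi * I * n * w.re) := by
  rw [UpperHalfPlane.ofComplex_apply_of_im_pos hw]
  rfl

lemma fourierTerm_mul_I (n : ℤ) (h : ℝ → ℂ) {y : ℝ} (hy : 0 < y) :
    fourierTerm n h ⟨y * I, by rwa [mul_I_im, ofReal_re]⟩ = h y := by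
  simp [fourierTerm, UpperHalfPlane.im, UpperHalfPlane.re]

lemma partialX_fourierTerm (n : ℤ) (h : ℝ → ℂ) :
    partialX (fourierTerm n h) = fourierTerm n fun y => 2 * Real.pi * I * n * h y := by
  funext z
  have h1 : (fun t : ℝ => fourierTerm n h (UpperHalfPlane.ofComplex ((z : ℂ) + t)))
      = fun t : ℝ => h z.im * exp (2 * Real.pi * I * n * (z.re + t)) := by
    funext t
    rw [fourierTerm_ofComplex n h (by simpa using z.im_pos)]
    simp
  have h2 : HasDerivAt (fun t : ℂ => h z.im * exp (2 * Real.pi * I * n * (z.re + t))) _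
      ((0 : ℝ) : ℂ) :=
    ((((hasDerivAt_id _).const_add (z.re : ℂ)).const_mul (2 * Real.pi * I * n)).cexp).const_mul _
  rw [partialX, h1, h2.comp_ofReal.deriv, fourierTerm]
  simp
  ring

lemma partialY_fourierTerm (n : ℤ) (h : ℝ → ℂ) :
    partialY (fourierTerm n h) = fourierTerm n (deriv h) := by
  funext z
  have h1 : (fun t : ℝ => fourierTerm n h (UpperHalfPlane.ofComplex ((z : ℂ) + t * I)))
      =ᶠ[𝓝 0] fun t : ℝ => h (z.im + t) * exp (2 * Real.pi * I * n * z.re) := by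
    filter_upwards [lt_mem_nhds (neg_lt_zero.2 z.im_pos)] with t ht
    rw [fourierTerm_ofComplex n h (by simp; linarith)]
    simp
  rw [partialY, h1.deriv_eq, deriv_mul_const_field, deriv_comp_const_add, add_zero, fourierTerm]

/-- The operator on `h` induced by `Δ_k - λ` on `h(y) e^{2π i n x}`. -/
def radialOp (k n : ℤ) (lam : ℂ) (h : ℝ → ℂ) (y : ℝ) : ℂ :=
  y ^ 2 * deriv (deriv h) y + k * y * deriv h y
    + (2 * Real.pi * n * k * y - 4 * Real.pi ^ 2 * n ^ 2 * y ^ 2 - lam) * h y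

lemma shiftedLaplacian_fourierTerm (k n : ℤ) (lam : ℂ) (h : ℝ → ℂ) :
    shiftedLaplacian k lam (fourierTerm n h) = fourierTerm n (radialOp k n lam h) := by
  funext z
  rw [shiftedLaplacian, hypLaplacian, partialX_fourierTerm, partialX_fourierTerm,
    partialY_fourierTerm, partialY_fourierTerm]
  simp only [fourierTerm, radialOp]
  linear_combination (4 * Real.pi ^ 2 * n ^ 2 * (z.im : ℂ) ^ 2 * h z.im
    - 2 * Real.pi * n * k * z.im * h z.im - k * z.im * deriv h z.im)
    * exp (2 * Real.pi * I * n * z.re) * I_sq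

lemma shiftedLaplacian_iterate_fourierTerm (k n : ℤ) (lam : ℂ) (h : ℝ → ℂ) (m : ℕ) :
    (shiftedLaplacian k lam)^[m] (fourierTerm n h) = fourierTerm n ((radialOp k n lam)^[m] h) := by
  induction m generalizing h with
  | zero => rfl
  | succ m ih => rw [Function.iterate_succ_apply, shiftedLaplacian_fourierTerm, ih,
      Function.iterate_succ_apply]

lemma eq_zero_of_fourierTerm_eq_zero {n : ℤ} {h : ℝ → ℂ} (hz : ∀ z, fourierTerm n h z = 0) {y : ℝ}
    (hy : 0 < y) : h y = 0 := by
  rw [← fourierTerm_mul_I n h hy, hz]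

lemma contDiffOn_of_fourierTerm {r : ℕ} {n : ℤ} {h : ℝ → ℂ} (hc : ContDiffUHP r (fourierTerm n h)) :
    ContDiffOn ℝ r h (Set.Ioi 0) := by
  have h1 : ContDiffOn ℝ r (fun y : ℝ => (y : ℂ) * I) (Set.Ioi 0) :=
    (ofRealCLM.contDiff.mul contDiff_const).contDiffOn
  refine (hc.comp h1 fun y hy => by simpa using hy).congr fun y hy => ?_
  rw [Function.comp_apply, fourierTerm_ofComplex n h (by simpa using hy)]
  simp

/-! ### Reduction to the normal form -/

/-- `G(t) = e^{kt/2} h(e^t)`. -/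
def normalForm (k : ℤ) (h : ℝ → ℂ) (t : ℝ) : ℂ := exp (k / 2 * t) * h (Real.exp t)

/-- With `D = y d/dy` the radial operator begins `D² + (k-1)D`. Conjugation by `y^{k/2}` turns this
into `D² - D + k/2 - k²/4`, so the first-order term no longer depends on `k`. -/
lemma isLinearSol_normalForm {k n : ℤ} {lam μ κ : ℂ} {c : ℝ} (hlam : 1 / 4 - μ ^ 2 = k / 2 - k ^ 2 / 4 - lam)
    (hκ : κ * c = 2 * Real.pi * n * k) (hc : (c : ℂ) ^ 2 / 4 = 4 * Real.pi ^ 2 * n ^ 2) {h : ℝ → ℂ}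
    (hh : ContDiffOn ℝ 2 h (Set.Ioi 0)) :
    IsLinearSol (whittakerPotential κ μ c) (normalForm k (radialOp k n lam h)) (normalForm k h)
      (fun t => exp (k / 2 * t) * (k / 2 * h (Real.exp t) + Real.exp t * deriv h (Real.exp t))) := by
  intro t
  have hy := Real.exp_pos t
  have hmem : Set.Ioi (0 : ℝ) ∈ 𝓝 (Real.exp t) := Ioi_mem_nhds hy
  have hd1 : ContDiffOn ℝ 1 (deriv h) (Set.Ioi 0) := hh.deriv_of_isOpen isOpen_Ioi (by norm_num)
  have e0 : HasDerivAt (fun t : ℝ => exp ((k : ℂ) / 2 * t)) (exp (k / 2 * t) * (k / 2)) t := by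
    refine (((hasDerivAt_id (t : ℂ)).const_mul ((k : ℂ) / 2)).cexp).comp_ofReal.congr_deriv ?_
    simp
  have e1 : HasDerivAt (fun t : ℝ => ((Real.exp t : ℝ) : ℂ)) (Real.exp t : ℂ) t :=
    (Real.hasDerivAt_exp t).ofReal_comp
  have d0 : HasDerivAt (fun t => h (Real.exp t)) (Real.exp t * deriv h (Real.exp t)) t := by
    have := ((hh.differentiableOn (by norm_num)).differentiableAt hmem).hasDerivAt
    exact (this.scomp t (Real.hasDerivAt_exp t)).congr_deriv (by simp)
  have d1 : HasDerivAt (fun t => deriv h (Real.exp t))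
      (Real.exp t * deriv (deriv h) (Real.exp t)) t := by
    have := ((hd1.differentiableOn (by norm_num)).differentiableAt hmem).hasDerivAt
    exact (this.scomp t (Real.hasDerivAt_exp t)).congr_deriv (by simp)
  refine ⟨(e0.mul d0).congr_deriv (by ring),
    (e0.mul ((d0.const_mul ((k : ℂ) / 2)).add (e1.mul d1))).congr_deriv ?_⟩
  simp only [normalForm, radialOp, whittakerPotential, Pi.add_apply, Pi.mul_apply]
  rw [← ofReal_exp]
  linear_combination (exp (k / 2 * t) * h (Real.exp t)) * hlam
    + (exp (k / 2 * t) * h (Real.exp t) * Real.exp t) * hκ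
    - (exp (k / 2 * t) * h (Real.exp t) * Real.exp t ^ 2) * hc

lemma contDiffOn_radialOp {k n : ℤ} {lam : ℂ} {r : ℕ} {h : ℝ → ℂ}
    (hh : ContDiffOn ℝ (r + 2 : ℕ) h (Set.Ioi 0)) :
    ContDiffOn ℝ r (radialOp k n lam h) (Set.Ioi 0) := by
  have h1 : ContDiffOn ℝ (r + 1 : ℕ) (deriv h) (Set.Ioi 0) :=
    hh.deriv_of_isOpen isOpen_Ioi (by norm_cast)
  have h2 : ContDiffOn ℝ r (deriv (deriv h)) (Set.Ioi 0) :=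
    h1.deriv_of_isOpen isOpen_Ioi (by norm_cast)
  have hid : ContDiffOn ℝ r (fun y : ℝ => (y : ℂ)) (Set.Ioi 0) := ofRealCLM.contDiff.contDiffOn
  have h1' : ContDiffOn ℝ r (deriv h) (Set.Ioi 0) := h1.of_le (by norm_cast; omega)
  have h0' : ContDiffOn ℝ r h (Set.Ioi 0) := hh.of_le (by norm_cast; omega)
  exact (((hid.pow 2).mul h2).add ((contDiffOn_const.mul hid).mul h1')).add
    ((((contDiffOn_const.mul hid).sub (contDiffOn_const.mul (hid.pow 2))).sub contDiffOn_const).mul h0')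

lemma isPolySol_normalForm {k n : ℤ} {lam μ κ : ℂ} {c : ℝ} (hlam : 1 / 4 - μ ^ 2 = k / 2 - k ^ 2 / 4 - lam)
    (hκ : κ * c = 2 * Real.pi * n * k) (hc : (c : ℂ) ^ 2 / 4 = 4 * Real.pi ^ 2 * n ^ 2) {m : ℕ}
    {h : ℝ → ℂ} (hh : ContDiffOn ℝ (2 * m : ℕ) h (Set.Ioi 0))
    (hz : ∀ y > 0, (radialOp k n lam)^[m] h y = 0) :
    IsPolySol (whittakerPotential κ μ c) m (normalForm k h) := by
  induction m generalizing h with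
  | zero =>
    refine funext fun t => ?_
    have := hz _ (Real.exp_pos t)
    simp only [Function.iterate_zero, id] at this
    simp [normalForm, this]
  | succ m ih =>
    exact ⟨_, _, isLinearSol_normalForm hlam hκ hc (hh.of_le (by norm_cast; omega)),
      ih (contDiffOn_radialOp hh) hz⟩

/-- A bound `y^K` becomes `e^{(k/2+K)t}`, which is negligible against `e^{ε e^t}` for every `ε > 0`.
-/
lemma slowExp_normalForm {k n : ℤ} {h : ℝ → ℂ} (hg : HasPolynomialGrowth (fourierTerm n h)) :
    SlowExp (normalForm k h) := by
  obtain ⟨K, hK⟩ := hg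
  obtain ⟨C, hC⟩ := hK.bound
  obtain ⟨A, hA⟩ := UpperHalfPlane.atImInfty_mem _ |>.1 hC
  intro ε hε
  have h1 : ExpBigO ε fun t : ℝ => ((Real.exp ((k / 2 + K) * t) : ℝ) : ℂ) :=
    expBigO_of_le_exp (A := k / 2 + K) (C := 1) hε fun t _ => by
      rw [norm_real, Real.norm_of_nonneg (Real.exp_nonneg _), one_mul]
  refine IsBigO.trans (IsBigO.of_bound C ?_) h1
  filter_upwards [Real.tendsto_exp_atTop.eventually_ge_atTop A] with t ht
  have hy := Real.exp_pos t
  have h2 : ‖fourierTerm n h ⟨(Real.exp t : ℝ) * I, by rwa [mul_I_im, ofReal_re]⟩‖ ≤ _ := hA _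
    (by rwa [UpperHalfPlane.im, mul_I_im, ofReal_re])
  rw [fourierTerm_mul_I n h hy, UpperHalfPlane.im, mul_I_im, ofReal_re,
    Real.norm_of_nonneg (Real.rpow_nonneg hy.le _), ← Real.exp_mul, mul_comm t K] at h2
  rw [normalForm, norm_mul, Complex.norm_exp, norm_real, Real.norm_of_nonneg (Real.exp_nonneg _),
    add_mul, Real.exp_add]
  have h5 : ((k : ℂ) / 2 * t).re = k / 2 * t := by
    have : (k : ℂ) / 2 * t = ((k / 2 * t : ℝ) : ℂ) := by push_cast; ring
    rw [this, ofReal_re]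
  rw [h5]
  calc _ ≤ Real.exp (k / 2 * t) * (C * Real.exp (K * t)) :=
        mul_le_mul_of_nonneg_left h2 (Real.exp_nonneg _)
    _ = _ := by ring

/-! ### The basic functions in normal form -/

/-- The substitution `y = e^t` covers all `y > 0` and the factor `e^{kt/2}` never vanishes, so
expansions correspond in both directions. The reverse direction gives existence, the forward one the
vanishing of coefficients. -/
lemma isExpansion_iff {k n : ℤ} {m : ℕ} {s₀ : ℂ} {h : ℝ → ℂ} {U V : ℕ → ℝ → ℂ}
    (hU : ∀ j, normalForm k (uMinus k n j s₀) = U j) (hV : ∀ j, normalForm k (uPlus k n j s₀) = V j)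
    (a b : ℕ → ℂ) : IsExpansion k n m s₀ h (fun j => a j) (fun j => b j) ↔
      ∀ t, normalForm k h t = ∑ j ∈ Finset.range m, (a j * U j t + b j * V j t) := by
  have key : ∀ t, (normalForm k h t = ∑ j ∈ Finset.range m, (a j * U j t + b j * V j t)) ↔
      h (Real.exp t) = ∑ j : Fin m, (a j * uMinus k n j s₀ (Real.exp t)
        + b j * uPlus k n j s₀ (Real.exp t)) := by
    intro t
    rw [normalForm, Fin.sum_univ_eq_sum_range
      fun j => a j * uMinus k n j s₀ (Real.exp t) + b j * uPlus k n j s₀ (Real.exp t)]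
    rw [show ∑ j ∈ Finset.range m, (a j * U j t + b j * V j t) = exp (k / 2 * t) *
        ∑ j ∈ Finset.range m, (a j * uMinus k n j s₀ (Real.exp t)
          + b j * uPlus k n j s₀ (Real.exp t)) from ?_]
    · exact mul_right_inj' (exp_ne_zero _)
    · rw [Finset.mul_sum]
      refine Finset.sum_congr rfl fun j _ => ?_
      rw [← hU, ← hV, normalForm, normalForm]
      ring
  simp only [key]
  exact ⟨fun H t => H _ (Real.exp_pos t), fun H y hy => by simpa [Real.exp_log hy] using H (Real.log y)⟩

lemma normalForm_cpow (k : ℤ) (j : ℕ) (a : ℂ) {μ : ℂ} (h : k / 2 + a = μ + 1 / 2) :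
    normalForm k (fun y => (Real.log y : ℂ) ^ j * (y : ℂ) ^ a) = powChain μ j := by
  funext t
  rw [normalForm, ofReal_exp_cpow, mul_comm (t : ℂ) a, Real.log_exp, powChain, ← h, add_mul, Complex.exp_add]
  ring

lemma add_eq_zero_iff_param (k : ℤ) (s₀ : ℂ) : s₀ + (k - 1) / 2 = 0 ↔ s₀ = (1 - k) / 2 := by
  rw [add_eq_zero_iff_eq_neg]
  ring_nf

lemma normalForm_cpow_mul (k : ℤ) (g : ℝ → ℂ) :
    normalForm k (fun y => (y : ℂ) ^ (-(k : ℂ) / 2) * g y) = fun t => g (Real.exp t) := by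
  funext t
  rw [normalForm, ofReal_exp_cpow, ← mul_assoc, ← Complex.exp_add]
  rw [show (k : ℂ) / 2 * t + t * (-k / 2) = 0 by ring, Complex.exp_zero, one_mul]

lemma log_mul_exp {c : ℝ} (hc : 0 < c) (t : ℝ) :
    (Real.log (c * Real.exp t) : ℂ) = t + (Real.log c : ℂ) := by
  rw [Real.log_mul hc.ne' (Real.exp_pos t).ne', Real.log_exp]
  push_cast; ring

lemma normalForm_uMinus {k n : ℤ} (hn : n ≠ 0) (s₀ : ℂ) (j : ℕ) :
    normalForm k (uMinus k n j s₀) = fun t : ℝ => whittakerWDeriv (n.sign * (k / 2)) (s₀ + (k - 1) / 2)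
      (chainIndex (s₀ + (k - 1) / 2) j) (t + (Real.log (4 * Real.pi * |(n : ℝ)|) : ℂ)) := by
  have hc : 0 < 4 * Real.pi * |(n : ℝ)| := by positivity
  have h1 : uMinus k n j s₀ = fun y : ℝ => (y : ℂ) ^ (-(k : ℂ) / 2) *
      iteratedDeriv (chainIndex (s₀ + (k - 1) / 2) j) (fun s : ℂ =>
        whittakerW (n.sign * (k / 2)) (s + (k - 1) / 2) (4 * Real.pi * |(n : ℝ)| * y)) s₀ := by
    funext y
    simp only [uMinus, if_neg hn, chainIndex, add_eq_zero_iff_param]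
  rw [h1, normalForm_cpow_mul]
  funext t
  simp only [whittakerW, log_mul_exp hc]
  exact congrFun (iteratedDeriv_comp_add_const _ (fun ν => whittakerWLog _ ν _) _) s₀

lemma normalForm_uPlus {k n : ℤ} (hn : n ≠ 0) (s₀ : ℂ) (j : ℕ) :
    normalForm k (uPlus k n j s₀) = fun t : ℝ => whittakerWDeriv (-(n.sign * (k / 2)))
      (s₀ + (k - 1) / 2) (chainIndex (s₀ + (k - 1) / 2) j)
      (t + ((Real.log (4 * Real.pi * |(n : ℝ)|) : ℂ) + Real.pi * I)) := by
  have hc : 0 < 4 * Real.pi * |(n : ℝ)| := by positivity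
  have h1 : uPlus k n j s₀ = fun y : ℝ => (y : ℂ) ^ (-(k : ℂ) / 2) *
      iteratedDeriv (chainIndex (s₀ + (k - 1) / 2) j) (fun s : ℂ =>
        whittakerMPlus (n.sign * (k / 2)) (s + (k - 1) / 2) (4 * Real.pi * |(n : ℝ)| * y)) s₀ := by
    funext y
    simp only [uPlus, if_neg hn, chainIndex, add_eq_zero_iff_param]
  rw [h1, normalForm_cpow_mul]
  funext t
  simp only [whittakerMPlus, log_mul_exp hc, add_assoc]
  exact congrFun (iteratedDeriv_comp_add_const _ (fun ν => whittakerWLog _ ν _) _) s₀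

end PolyMaass

end


/-! ### Assembly of the theorem -/

theorem mainTheorem7 (k n : ℤ) (hk : Even k) (m : ℕ) (lam s₀ : ℂ)
    (hlam : lam = s₀ * (s₀ + k - 1)) (h : ℝ → ℂ) (f : ℍ → ℂ)
    (hf : ∀ z : ℍ, f z = h z.im * Complex.exp (2 * Real.pi * Complex.I * n * z.re))
    (hharm : PolyMaass.IsShiftedPolyharmonic k lam m f)
    (hgrowth : PolyMaass.HasPolynomialGrowth f) :
    (∃ aMinus aPlus : Fin m → ℂ, PolyMaass.IsExpansion k n m s₀ h aMinus aPlus) ∧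
    (n ≠ 0 → ∀ aMinus aPlus : Fin m → ℂ,
      PolyMaass.IsExpansion k n m s₀ h aMinus aPlus → ∀ j : Fin m, aPlus j = 0) := by
  obtain rfl : f = PolyMaass.fourierTerm n h := funext hf
  -- The choice `μ = s₀ + (k-1)/2` makes `1/4 - μ² = k/2 - k²/4 - λ`. For `n = 0` both `κ` and `c`
  -- vanish and the potential is the constant `1/4 - μ²`.
  have hpoly := PolyMaass.isPolySol_normalForm (k := k) (n := n) (lam := lam)
    (μ := s₀ + (k - 1) / 2) (κ := n.sign * (k / 2)) (c := 4 * Real.pi * |(n : ℝ)|)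
    (by rw [hlam]; ring)
    (by
      have h1 : ((n.sign : ℤ) : ℂ) * ((|(n : ℝ)| : ℝ) : ℂ) = n := by
        have := Int.sign_mul_abs n
        rw [← Int.cast_abs]
        exact_mod_cast this
      push_cast
      linear_combination (2 * Real.pi * k) * h1)
    (by
      have h1 : ((|(n : ℝ)| : ℝ) : ℂ) ^ 2 = n ^ 2 := by
        rw [← ofReal_pow, sq_abs]; push_cast; rfl
      push_cast
      linear_combination (4 * Real.pi ^ 2) * h1)
    (PolyMaass.contDiffOn_of_fourierTerm hharm.1)
    (fun y hy => PolyMaass.eq_zero_of_fourierTerm_eq_zero (n := n) (fun z => by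
      rw [← PolyMaass.shiftedLaplacian_iterate_fourierTerm]; exact hharm.2 z) hy)
  by_cases hn : n = 0
  · subst hn
    refine ⟨?_, fun h0 => absurd rfl h0⟩
    by_cases hs : s₀ = (1 - k) / 2
    · have hμ := (PolyMaass.add_eq_zero_iff_param k s₀).2 hs
      obtain ⟨a, b, hab⟩ := PolyMaass.powChain_expansion_zero
        (fun t => by simp [PolyMaass.whittakerPotential, hμ]) hpoly
      refine ⟨_, _, (PolyMaass.isExpansion_iff (fun j => ?_) (fun j => ?_) a b).2 hab⟩
      · unfold PolyMaass.uMinus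
        simp only [if_true, if_pos hs]
        exact PolyMaass.normalForm_cpow k _ _ (by ring)
      · unfold PolyMaass.uPlus
        simp only [if_true, if_pos hs]
        exact PolyMaass.normalForm_cpow k _ _ (by ring)
    · have hμ := mt (PolyMaass.add_eq_zero_iff_param k s₀).1 hs
      obtain ⟨a, b, hab⟩ := PolyMaass.powChain_expansion hμ
        (fun t => by simp [PolyMaass.whittakerPotential]) hpoly
      refine ⟨_, _, (PolyMaass.isExpansion_iff (fun j => ?_) (fun j => ?_) a b).2 hab⟩
      · unfold PolyMaass.uMinus
        simp only [if_true, if_neg hs]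
        exact PolyMaass.normalForm_cpow k _ _ (by ring)
      · unfold PolyMaass.uPlus
        simp only [if_true, if_neg hs]
        exact PolyMaass.normalForm_cpow k _ _ (by ring)
  · have hc : 0 < 4 * Real.pi * |(n : ℝ)| := by positivity
    obtain ⟨hex, huniq⟩ := PolyMaass.whittaker_expansion (n.sign * (k / 2)) (s₀ + (k - 1) / 2) hc m
    have hiff := PolyMaass.isExpansion_iff (m := m) (h := h)
      (PolyMaass.normalForm_uMinus (k := k) hn s₀) (PolyMaass.normalForm_uPlus hn s₀)
    refine ⟨?_, fun _ aMinus aPlus hexp j => ?_⟩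
    · obtain ⟨a, b, hab⟩ := hex _ hpoly
      exact ⟨_, _, (hiff a b).2 hab⟩
    · have hext : ∀ a : Fin m → ℂ,
          (fun j : Fin m => if hj : (j : ℕ) < m then a ⟨j, hj⟩ else 0) = a := fun a =>
        funext fun j => by simp
      have h1 := (hiff (fun j => if hj : j < m then aMinus ⟨j, hj⟩ else 0)
        (fun j => if hj : j < m then aPlus ⟨j, hj⟩ else 0)).1 (by rwa [hext, hext])
      -- Half the critical rate `c/2` is an admissible witness, since polynomial growth lies below
      -- every positive rate.
      have hsub : PolyMaass.SubExp (4 * Real.pi * |(n : ℝ)| / 2) (PolyMaass.normalForm k h) :=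
        ⟨4 * Real.pi * |(n : ℝ)| / 2 / 2, by linarith,
          PolyMaass.slowExp_normalForm hgrowth _ (by linarith)⟩
      rw [funext h1] at hsub
      simpa using huniq _ _ hsub j j.2
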